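/- **Asymptotic distribution of the QIF test statistic under local alternatives.** *Data and model.* The observation on one subject is a pair $(Y,X)$ with responses $Y=(Y_1,\dots,Y_n)^T\in\mathbb R^n$ and covariates $X=(X_1,\dots,X_n)$, $X_t\in\mathbb R^q$. Let $h$ (the inverse link) be $C^2$ on $\mathbb R$, $v_{\rm var}>0$ (the variance function) be $C^1$ on $\mathbb R$, $\phi>0$, and let $M_1,\dots,M_s$ be real $n\times n$ matrices. The parameter space $\mathcal B\subset\mathbb R^q$ is compact. For every $\theta$ let $F_\theta$ be a probability law of $(Y,X)$ such that, for $\theta\in\mathcal B$, each $Y_t$ is integrable and $E_\theta(Y_t\mid X)=h(X_t^T\theta)$. *Extended scores.* For $\beta\in\mathbb R^q$ put $\mathbf h(\beta)=(h(X_t^T\beta))_{t\le n}$, $A(\beta)=\mathrm{diag}(\phi\,v_{\rm var}(X_t^T\beta))_{t\le n}$, and let $g(\beta)\in\mathbb R^{qs}$ be the vector with the blocks $\nabla\mathbf h^TA^{-1/2}M_jA^{-1/2}(Y-\mathbf h)$, $j=1,\dots,s$. For a sample of size $N$, with scores $g_1,\dots,g_N$, put $$\bar g_N(\beta)=\tfrac1N\sum_i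 g_i(\beta),\quad \widehat C_N(\beta)=\tfrac1N\sum_i g_i(\beta)g_i(\beta)^T,\quad Q_N(\beta)=N\,\bar g_N(\beta)^T\,\widehat C_N(\beta)^{-1}\,\bar g_N(\beta),$$ where $\widehat C_N^{-1}$ is the Moore–Penrose inverse if $\widehat C_N$ is singular. *Assumptions.* Let $\beta_0$ be an interior point of $\mathcal B$, and put $\Sigma(\beta)=E_{\beta_0}\{g(\beta)g(\beta)^T\}$, $D(\beta)=E_{\beta_0}\{\nabla g(\beta)\}$ and $J(\beta_0)=D(\beta_0)^T\Sigma(\beta_0)^{-1}D(\beta_0)$. Assume: 1. $\theta\mapsto F_\theta$ is continuous at $\beta_0$ for weak convergence, and $\sup_{\beta\in\mathcal B}\|g(\beta)\|^2$ and $\sup_{\beta\in\mathcal B}\|\nabla g(\beta)\|$ are uniformly integrable under $F_\theta$ as $\theta\to\beta_0$, that is, for each of them, denoted by $G$, and every $\varepsilon>0$ there is $K$ with $E_\theta(G\,1\{G>K\})\le\varepsilon$ for all $\theta$ in a neighbourhood of $\beta_0$; 2. for $\beta\in\mathcal B$: $E_{\beta_0}\{g(\beta)\}=0$ if and only if $\beta=\beta_0$;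 3. $\Sigma(\beta)$ is positive definite for every $\beta\in\mathcal B$, and $J(\beta_0)$ is invertible. *Test statistic.* Let $p<q$, let $L$ be a real $q\times p$ matrix with linearly independent columns, let $b=L^T\beta_0$, and let $v\in\mathbb R^q$. Let $\hat\beta_N$ and $\tilde\beta_N$ be (measurable) minimizers of $Q_N$ over $\mathcal B$ and over $\{\beta\in\mathcal B: L^T\beta=b\}$, respectively, and put $T_N=Q_N(\tilde\beta_N)-Q_N(\hat\beta_N)$. *Conclusion.* If, for each $N$, the sample consists of $N$ independent observations with the law $F_{\beta_N}$, where $\beta_N=\beta_0+N^{-1/2}v$, then, as $N\to\infty$, $T_N$ converges in distribution to the noncentral chi-squared distribution with $p$ degrees of freedom and noncentrality parameter $$\delta^2=v^TL\{L^TJ^{-1}(\beta_0)L\}^{-1}L^Tv,$$ that is, to the law of $(\xi_1+\delta)^2+\xi_2^2+\cdots+\xi_p^2$ for independent standard normal $\xi_1,\dots,\xi_p$. -/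

import Mathlib

open MeasureTheory ProbabilityTheory Filter Topology Matrix
open scoped ENNReal NNReal

noncomputable section

namespace QIF

/-- The observation on one subject: the response vector `Y = (Y₁, …, Yₙ)` and the covariate vectors
`X₁, …, Xₙ ∈ ℝ^q`, where `z.2 t` is `X_t`. -/
abbrev Subject (n q : ℕ) : Type := (Fin n → ℝ) × (Fin n → Fin q → ℝ)

/-- The known ingredients of the extended scores: the inverse link `h`, the variance function `v`
(as a function of the linear predictor), the dispersion `φ`, and the basis matrices
`M₁, …, M_s`. -/
structure Spec (n s : ℕ) where
  h : ℝ → ℝ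
  v : ℝ → ℝ
  φ : ℝ
  M : Fin s → Matrix (Fin n) (Fin n) ℝ

/-- The matrix `(∂f_a / ∂β_k)_{a,k}` of first-order partial derivatives of `f` at `β`. -/
def jacobian {q : ℕ} {ι : Type*} [Fintype ι] (f : (Fin q → ℝ) → ι → ℝ) (β : Fin q → ℝ) :
    Matrix ι (Fin q) ℝ :=
  Matrix.of fun a k => fderiv ℝ f β (Pi.single k 1) a

/-- The Moore-Penrose inverse of a real symmetric matrix: the eigenvectors are kept, nonzero
eigenvalues are inverted, and zero eigenvalues stay zero (`0⁻¹ = 0`). It is the inverse of `A` if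
`A` is nonsingular. -/
def pinv {ι : Type*} [Fintype ι] [DecidableEq ι] (A : Matrix ι ι ℝ) : Matrix ι ι ℝ :=
  cfc (fun x : ℝ => x⁻¹) A

section Score

variable {n q s : ℕ} (S : Spec n s)

/-- The mean vector `(h(X_tᵀ β))_t`. -/
def meanVec (x : Fin n → Fin q → ℝ) (β : Fin q → ℝ) : Fin n → ℝ :=
  fun t => S.h (x t ⬝ᵥ β)

/-- The diagonal matrix `A^{-1/2}`, where `A` has the diagonal entries `φ v(X_tᵀ β)`. -/
def invSqrtA (x : Fin n → Fin q → ℝ) (β : Fin q → ℝ) : Matrix (Fin n) (Fin n) ℝ :=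
  Matrix.diagonal fun t => (√(S.φ * S.v (x t ⬝ᵥ β)))⁻¹

/-- The extended score of one subject: the vector of dimension `s q` with the blocks
`∇hᵀ A^{-1/2} M_j A^{-1/2} (Y - h)`, `j = 1, …, s`. -/
def score (β : Fin q → ℝ) (z : Subject n q) : Fin s × Fin q → ℝ :=
  fun a => (((jacobian (meanVec S z.2) β)ᵀ * invSqrtA S z.2 β * S.M a.1 * invSqrtA S z.2 β) *ᵥ
    (z.1 - meanVec S z.2 β)) a.2

/-- The averaged extended score. -/
def gbar {N : ℕ} (z : Fin N → Subject n q) (β : Fin q → ℝ) : Fin s × Fin q → ℝ :=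
  (N : ℝ)⁻¹ • ∑ i, score S β (z i)

/-- The empirical second moment matrix of the extended scores. -/
def Chat {N : ℕ} (z : Fin N → Subject n q) (β : Fin q → ℝ) :
    Matrix (Fin s × Fin q) (Fin s × Fin q) ℝ :=
  (N : ℝ)⁻¹ • ∑ i, Matrix.vecMulVec (score S β (z i)) (score S β (z i))

/-- The quadratic inference function of a sample of size `N`. -/
def Q {N : ℕ} (z : Fin N → Subject n q) (β : Fin q → ℝ) : ℝ :=
  N * (gbar S z β ⬝ᵥ (pinv (Chat S z β) *ᵥ gbar S z β))

/-- The matrix `Σ_P(β)` of second moments of the extended score at `β` under the law `P`. -/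
def secondMoment (P : Measure (Subject n q)) (β : Fin q → ℝ) :
    Matrix (Fin s × Fin q) (Fin s × Fin q) ℝ :=
  Matrix.of fun a b => ∫ z, score S β z a * score S β z b ∂P

/-- The expected Jacobian `D_P(β)` of the extended score at `β` under the law `P`. -/
def expJacobian (P : Measure (Subject n q)) (β : Fin q → ℝ) : Matrix (Fin s × Fin q) (Fin q) ℝ :=
  Matrix.of fun a k => ∫ z, jacobian (fun b => score S b z) β a k ∂P

/-- The information matrix `J = Dᵀ Σ⁻¹ D`. -/
def infoMatrix (P : Measure (Subject n q)) (β : Fin q → ℝ) : Matrix (Fin q) (Fin q) ℝ :=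
  (expJacobian S P β)ᵀ * (secondMoment S P β)⁻¹ * expJacobian S P β

/-- Under `P`, the marginal mean model `E(Y_t | X) = h(X_tᵀ θ)` holds with the parameter `θ`. -/
def MeanModel (P : Measure (Subject n q)) (θ : Fin q → ℝ) : Prop :=
  ∀ t : Fin n, Integrable (fun z : Subject n q => z.1 t) P ∧
    P[fun z : Subject n q => z.1 t | MeasurableSpace.comap Prod.snd inferInstance]
      =ᵐ[P] fun z => S.h (z.2 t ⬝ᵥ θ)

end Score

/-- `G ≥ 0` is uniformly integrable with respect to the laws `F θ`, as `θ → θ₀`. -/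
def UnifIntegrableNear {Θ Z : Type*} [TopologicalSpace Θ] [MeasurableSpace Z]
    (F : Θ → ProbabilityMeasure Z) (θ₀ : Θ) (G : Z → ℝ≥0∞) : Prop :=
  ∀ ε : ℝ≥0∞, 0 < ε → ∃ K : ℝ≥0, ∀ᶠ θ in 𝓝 θ₀,
    ∫⁻ z in {z | (K : ℝ≥0∞) < G z}, G z ∂(F θ : Measure Z) ≤ ε

/-- The local alternative `β₀ + N^{-1/2} v`. -/
def localAlt {q : ℕ} (β₀ v : Fin q → ℝ) (N : ℕ) : Fin q → ℝ :=
  β₀ + (√(N : ℝ))⁻¹ • v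

/-- The law of an independent sample of size `N` from `P`. -/
abbrev sampleLaw {Z : Type*} [MeasurableSpace Z] (P : ProbabilityMeasure Z) (N : ℕ) :
    Measure (Fin N → Z) :=
  Measure.pi fun _ => (P : Measure Z)

/-- `(ξ₁ + δ)² + ξ₂² + ⋯ + ξ_p²` has the noncentral chi-squared distribution with `p` degrees of
freedom and noncentrality parameter `δ²`, for independent standard normal `ξ₁, …, ξ_p`. The
second argument is `δ²`. -/
def noncentralChiSquared (p : ℕ) (δsq : ℝ) : Measure ℝ :=
  (Measure.pi fun i : Fin p => gaussianReal (if (i : ℕ) = 0 then √δsq else 0) 1).map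
    fun x => ∑ i, x i ^ 2

instance (p : ℕ) (δsq : ℝ) : IsProbabilityMeasure (noncentralChiSquared p δsq) :=
  Measure.isProbabilityMeasure_map (by
    have : Measurable fun x : Fin p → ℝ => ∑ i, x i ^ 2 := by fun_prop
    exact this.aemeasurable)

/-- The minimizers of `f` on the set `A`. -/
def argmin {α : Type*} (f : α → ℝ) (A : Set α) : Set α :=
  {a | a ∈ A ∧ ∀ b ∈ A, f a ≤ f b}

end QIF

end

/-! The statistic is, up to an error that vanishes in probability, a fixed quadratic function of one
random vector, the rescaled score `y = √N ḡ_N(β_N)` at the parameter `β_N` that generates the data.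

Write `Σ` and `D` for the second moment matrix and the expected Jacobian at `β₀`, and `J = Dᵀ Σ⁻¹
D`. In the marginal mean model the score has mean zero under the law `F_{β_N}` when evaluated at
`β_N`. A central limit theorem for triangular arrays (`tendstoInDistribution_triangular`) therefore
gives any image `A y` with `A Σ Aᵀ = 1` a standard normal limit. No likelihood ratios or contiguity
enter: weak continuity of the laws together with uniformly integrable envelopes yields this limit
theorem and also a uniform law of large numbers (`tendsto_measure_uniform_average`) for the scores,
their products and their derivatives.

At scale `N^{-1/2}` around `β₀` the score is nearly affine, `√N ḡ_N(β₀ + N^{-1/2} u) ≈ y - D v + D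
u`, and the weight is nearly `Σ⁻¹`. Consistency and a rate argument confine both minimizers to this
scale, so both minima of `Q_N` are close to minima of `|y - D v + D u|²` in the `Σ⁻¹` metric, over
all `u` and over `Lᵀ u = 0` (`LocalAsymptotics.tendsto_min`). Completing the square, their
difference is exactly `|A y + δ e₁|²` with `A Σ Aᵀ = 1` (`exists_standardization`); the shift `δ e₁`
is what remains of `D v`.

The expansion is proved for deterministic sequences only. A compactness argument
(`exists_uniformlyClose_imp_approx`) makes it uniform over all samples whose empirical means are
close to the expectations and whose rescaled score is bounded. Such samples have probability as
close to one as desired, and a Slutsky argument concludes. -/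

noncomputable section

namespace QIF

/-! ### Continuity and measurability of the Moore–Penrose inverse -/

section PseudoInverse

variable {ι : Type*} [Fintype ι] [DecidableEq ι]

lemma pinv_eq_inv {A : Matrix ι ι ℝ} (hA : A.IsHermitian) (hu : IsUnit A) : pinv A = A⁻¹ := by
  obtain ⟨u, rfl⟩ := hu
  have h : IsSelfAdjoint (u : Matrix ι ι ℝ) := hA
  rw [pinv, cfc_inv_id u h, Matrix.coe_units_inv]

/-- The pseudoinverse is discontinuous in general, but not at a nonsingular limit: the determinant
is eventually nonzero, and there `pinv` is the inverse, given by the adjugate formula. -/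
lemma tendsto_pinv {κ : Type*} {l : Filter κ} {C : κ → Matrix ι ι ℝ} {S : Matrix ι ι ℝ}
    (hC : Tendsto C l (𝓝 S)) (hsymm : ∀ k, (C k).IsHermitian) (hS : S.PosDef) :
    Tendsto (fun k => pinv (C k)) l (𝓝 S⁻¹) := by
  have hdet : IsUnit S.det := (Matrix.isUnit_iff_isUnit_det _).1 hS.isUnit
  have hdet' : Tendsto (fun k => (C k).det) l (𝓝 S.det) :=
    ((continuous_id.matrix_det).tendsto S).comp hC
  have hne : ∀ᶠ k in l, (C k).det ≠ 0 := hdet'.eventually_ne hdet.ne_zero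
  have hinv : Tendsto (fun k => (C k)⁻¹) l (𝓝 S⁻¹) := by
    simp only [Matrix.inv_def, Ring.inverse_eq_inv']
    exact (hdet'.inv₀ hdet.ne_zero).smul (((continuous_id.matrix_adjugate).tendsto S).comp hC)
  refine hinv.congr' ?_
  filter_upwards [hne] with k hk
  exact (pinv_eq_inv (hsymm k) ((Matrix.isUnit_iff_isUnit_det _).2 (isUnit_iff_ne_zero.2 hk))).symm

/-- As `ε → 0`, `x / (x ^ 2 + ε)` tends to `x⁻¹` for every real `x`, also at `0` with `0⁻¹ = 0`.
This regularization exhibits the discontinuous map `pinv` as a pointwise limit of continuous maps,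
which is how its measurability is obtained. -/
lemma cfc_regularized_inv {A : Matrix ι ι ℝ} (hA : A.IsHermitian) {ε : ℝ} (hε : 0 < ε) :
    cfc (fun x : ℝ => x / (x ^ 2 + ε)) A = (A * A + ε • (1 : Matrix ι ι ℝ))⁻¹ * A := by
  have hA' : IsSelfAdjoint A := hA
  have hne : ∀ x : ℝ, x ^ 2 + ε ≠ 0 := fun x => by positivity
  have hc : Continuous fun x : ℝ => (x ^ 2 + ε)⁻¹ :=
    (by fun_prop : Continuous fun x : ℝ => x ^ 2 + ε).inv₀ hne
  have h1 : cfc (fun x : ℝ => x ^ 2 + ε) A = A * A + ε • (1 : Matrix ι ι ℝ) := by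
    rw [cfc_add A (fun x : ℝ => x ^ 2) (fun _ => ε) (by fun_prop) (by fun_prop),
      cfc_pow_id A 2, cfc_const ε A, sq, Algebra.algebraMap_eq_smul_one]
  have h2 : cfc (fun x : ℝ => (x ^ 2 + ε)⁻¹) A * (A * A + ε • (1 : Matrix ι ι ℝ)) = 1 := by
    rw [← h1, ← cfc_mul _ _ A hc.continuousOn (by fun_prop)]
    simp only [inv_mul_cancel₀ (hne _)]
    exact cfc_const_one ℝ A
  rw [Matrix.inv_eq_left_inv h2]
  have h3 := cfc_mul (fun x : ℝ => (x ^ 2 + ε)⁻¹) (fun x : ℝ => x) A hc.continuousOn (by fun_prop)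
  rw [cfc_id' ℝ A] at h3
  rw [← h3]
  congr 1
  ext x
  rw [div_eq_inv_mul]

lemma tendsto_regularized_inv {A : Matrix ι ι ℝ} (hA : A.IsHermitian) :
    Tendsto (fun n : ℕ => (A * A + ((n : ℝ) + 1)⁻¹ • (1 : Matrix ι ι ℝ))⁻¹ * A) atTop
      (𝓝 (pinv A)) := by
  have h0 : Tendsto (fun n : ℕ => ((n : ℝ) + 1)⁻¹) atTop (𝓝 0) := by
    simpa using tendsto_one_div_add_atTop_nhds_zero_nat (𝕜 := ℝ)
  have key : ∀ x : ℝ, Tendsto (fun n : ℕ => x / (x ^ 2 + ((n : ℝ) + 1)⁻¹)) atTop (𝓝 x⁻¹) := by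
    intro x
    rcases eq_or_ne x 0 with rfl | hx
    · simp
    · have : Tendsto (fun n : ℕ => x / (x ^ 2 + ((n : ℝ) + 1)⁻¹)) atTop (𝓝 (x / (x ^ 2 + 0))) :=
        tendsto_const_nhds.div (tendsto_const_nhds.add h0) (by simpa using hx)
      convert this using 2
      field_simp
      ring
  -- The eigenvectors do not depend on `n`, so it suffices that the functional calculus is
  -- continuous in the diagonal of transformed eigenvalues.
  have hcont : Continuous fun d : ι → ℝ =>
      (Unitary.conjStarAlgAut ℝ (Matrix ι ι ℝ)) hA.eigenvectorUnitary (diagonal d) := by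
    simp only [Unitary.conjStarAlgAut_apply]
    fun_prop
  have h := (hcont.tendsto (fun i => (hA.eigenvalues i)⁻¹)).comp
    (tendsto_pi_nhds.2 fun i => key (hA.eigenvalues i))
  rw [pinv, hA.cfc_eq]
  refine h.congr fun n => ?_
  rw [← cfc_regularized_inv hA (by positivity : (0 : ℝ) < ((n : ℝ) + 1)⁻¹), hA.cfc_eq]
  rfl

lemma measurable_pinv_apply {Ω : Type*} [MeasurableSpace Ω] {C : Ω → Matrix ι ι ℝ}
    (hC : ∀ i j, Measurable fun ω => C ω i j) (hsymm : ∀ ω, (C ω).IsHermitian) (i j : ι) :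
    Measurable fun ω => pinv (C ω) i j := by
  have hC' : Measurable fun ω => (fun i j => C ω i j : ι → ι → ℝ) :=
    measurable_pi_iff.2 fun i => measurable_pi_iff.2 fun j => hC i j
  refine measurable_of_tendsto_metrizable (f := fun (n : ℕ) ω =>
    ((C ω * C ω + ((n : ℝ) + 1)⁻¹ • (1 : Matrix ι ι ℝ))⁻¹ * C ω) i j) (fun n => ?_) ?_
  · have hid : Continuous fun c : ι → ι → ℝ => (Matrix.of c : Matrix ι ι ℝ) := continuous_id
    have hB : Continuous fun c : ι → ι → ℝ =>
        (Matrix.of c * Matrix.of c + ((n : ℝ) + 1)⁻¹ • (1 : Matrix ι ι ℝ)) := by fun_prop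
    have h1 : Measurable fun c : ι → ι → ℝ =>
        ((Matrix.of c * Matrix.of c + ((n : ℝ) + 1)⁻¹ • (1 : Matrix ι ι ℝ))⁻¹ *
          Matrix.of c : Matrix ι ι ℝ) i j := by
      simp only [Matrix.inv_def, Ring.inverse_eq_inv', Matrix.smul_mul, Matrix.smul_apply,
        smul_eq_mul]
      refine hB.matrix_det.measurable.inv.mul ?_
      exact ((hB.matrix_adjugate.matrix_mul hid).matrix_elem i j).measurable
    exact h1.comp hC'
  · refine tendsto_pi_nhds.2 fun ω => ?_
    exact ((continuous_id.matrix_elem i j).tendsto _).comp (tendsto_regularized_inv (hsymm ω))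

end PseudoInverse

/-! ### Deterministic asymptotics of constrained minima -/

lemma tendsto_of_tendstoUniformlyOn {α κ : Type*} [TopologicalSpace α] {l : Filter κ}
    {F : κ → α → ℝ} {f : α → ℝ} {B : Set α} (h : TendstoUniformlyOn F f l B)
    {x : κ → α} {y : α} (hf : ContinuousWithinAt f B y) (hx : ∀ᶠ k in l, x k ∈ B)
    (hlim : Tendsto x l (𝓝 y)) : Tendsto (fun k => F k (x k)) l (𝓝 (f y)) := by
  refine tendsto_comp_of_locally_uniform_limit_within hf
    (tendsto_nhdsWithin_iff.2 ⟨hlim, hx⟩) fun u hu => ⟨B, self_mem_nhdsWithin, ?_⟩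
  exact h u hu

/-- Turns entrywise closeness of Jacobians into closeness in operator norm, as the mean value
inequality requires. -/
lemma norm_le_sum_entries {q : ℕ} {ι : Type*} [Fintype ι] (T : (Fin q → ℝ) →L[ℝ] ι → ℝ) :
    ‖T‖ ≤ ∑ a, ∑ k, |T (Pi.single k 1) a| := by
  refine T.opNorm_le_bound (by positivity) fun x => ?_
  refine (pi_norm_le_iff_of_nonneg (by positivity)).2 fun a => ?_
  have hx : T x a = ∑ k, x k * T (Pi.single k 1) a := by
    conv_lhs => rw [pi_eq_sum_univ' x]
    simp [map_sum, Finset.sum_apply]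
  calc ‖T x a‖ ≤ ∑ k, ‖x k * T (Pi.single k 1) a‖ := by rw [hx]; exact norm_sum_le _ _
    _ ≤ ∑ k, ‖x‖ * |T (Pi.single k 1) a| := by
        refine Finset.sum_le_sum fun k _ => ?_
        rw [norm_mul]
        exact mul_le_mul_of_nonneg_right (norm_le_pi_norm x k) (norm_nonneg _)
    _ = (∑ k, |T (Pi.single k 1) a|) * ‖x‖ := by rw [← Finset.mul_sum, mul_comm]
    _ ≤ _ := by
        refine mul_le_mul_of_nonneg_right ?_ (norm_nonneg _)
        exact Finset.single_le_sum (f := fun a => ∑ k, |T (Pi.single k 1) a|)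
          (fun _ _ => by positivity) (Finset.mem_univ a)

lemma tendsto_quadForm {ι κ : Type*} [Fintype ι] {l : Filter κ} {A : κ → Matrix ι ι ℝ} {A₀ : Matrix ι ι ℝ}
    {x : κ → ι → ℝ} {x₀ : ι → ℝ} (hA : Tendsto A l (𝓝 A₀)) (hx : Tendsto x l (𝓝 x₀)) :
    Tendsto (fun k => x k ⬝ᵥ (A k *ᵥ x k)) l (𝓝 (x₀ ⬝ᵥ (A₀ *ᵥ x₀))) := by
  have : Continuous fun p : Matrix ι ι ℝ × (ι → ℝ) => p.2 ⬝ᵥ (p.1 *ᵥ p.2) := by fun_prop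
  exact (this.tendsto (A₀, x₀)).comp (hA.prodMk_nhds hx)

/-- Deterministic sequences of estimating functions `g k`, weight matrices `C k` and rates `r k`
that converge uniformly on `B`, together with the derivatives of `g k`. -/
structure LocalAsymptotics {q : ℕ} {ι : Type*} [Fintype ι] [DecidableEq ι]
    (B : Set (Fin q → ℝ)) (β₀ : Fin q → ℝ) (m : (Fin q → ℝ) → ι → ℝ)
    (S : (Fin q → ℝ) → Matrix ι ι ℝ) (D : (Fin q → ℝ) → Matrix ι (Fin q) ℝ)
    (r : ℕ → ℝ) (g : ℕ → (Fin q → ℝ) → ι → ℝ) (C : ℕ → (Fin q → ℝ) → Matrix ι ι ℝ) : Prop where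
  isCompact : IsCompact B
  mem_interior : β₀ ∈ interior B
  tendsto_rate : Tendsto r atTop atTop
  differentiable : ∀ k, Differentiable ℝ (g k)
  isHermitian : ∀ k β, (C k β).IsHermitian
  unif_mean : ∀ a, TendstoUniformlyOn (fun k β => g k β a) (fun β => m β a) atTop B
  unif_weight : ∀ a b, TendstoUniformlyOn (fun k β => C k β a b) (fun β => S β a b) atTop B
  unif_deriv : ∀ a j, TendstoUniformlyOn (fun k β => jacobian (g k) β a j) (fun β => D β a j) atTop B
  cont_mean : ∀ a, ContinuousOn (fun β => m β a) B
  cont_weight : ∀ a b, ContinuousOn (fun β => S β a b) B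
  cont_deriv : ∀ a j, ContinuousWithinAt (fun β => D β a j) B β₀
  posDef : ∀ β ∈ B, (S β).PosDef
  ident : ∀ β ∈ B, m β = 0 ↔ β = β₀
  inj : ∀ u, D β₀ *ᵥ u = 0 → u = 0

namespace LocalAsymptotics

variable {q : ℕ} {ι : Type*} [Fintype ι] [DecidableEq ι]
    {B : Set (Fin q → ℝ)} {β₀ : Fin q → ℝ} {m : (Fin q → ℝ) → ι → ℝ}
    {S : (Fin q → ℝ) → Matrix ι ι ℝ} {D : (Fin q → ℝ) → Matrix ι (Fin q) ℝ} {z : ι → ℝ}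
    {r : ℕ → ℝ} {g : ℕ → (Fin q → ℝ) → ι → ℝ} {C : ℕ → (Fin q → ℝ) → Matrix ι ι ℝ}

lemma comp (h : LocalAsymptotics B β₀ m S D r g C) {φ : ℕ → ℕ} (hφ : Tendsto φ atTop atTop) :
    LocalAsymptotics B β₀ m S D (r ∘ φ) (g ∘ φ) (C ∘ φ) :=
  { h with
    tendsto_rate := h.tendsto_rate.comp hφ
    differentiable := fun _ => h.differentiable _
    isHermitian := fun _ => h.isHermitian _
    unif_mean := fun a u hu => hφ.eventually (h.unif_mean a u hu)
    unif_weight := fun a b u hu => hφ.eventually (h.unif_weight a b u hu)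
    unif_deriv := fun a j u hu => hφ.eventually (h.unif_deriv a j u hu) }

/-- The objective function `r² gᵀ C⁺ g`. -/
def objective (r : ℕ → ℝ) (g : ℕ → (Fin q → ℝ) → ι → ℝ) (C : ℕ → (Fin q → ℝ) → Matrix ι ι ℝ)
    (k : ℕ) (β : Fin q → ℝ) : ℝ :=
  r k ^ 2 * (g k β ⬝ᵥ (pinv (C k β) *ᵥ g k β))

lemma objective_eq (k : ℕ) (β : Fin q → ℝ) :
    objective r g C k β = (r k • g k β) ⬝ᵥ (pinv (C k β) *ᵥ (r k • g k β)) := by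
  simp [objective, Matrix.mulVec_smul]
  ring

lemma tendsto_pinv_weight (h : LocalAsymptotics B β₀ m S D r g C) {x : ℕ → Fin q → ℝ}
    {y : Fin q → ℝ} (hx : ∀ᶠ k in atTop, x k ∈ B) (hlim : Tendsto x atTop (𝓝 y)) :
    Tendsto (fun k => pinv (C k (x k))) atTop (𝓝 (S y)⁻¹) := by
  have hy : y ∈ B := h.isCompact.isClosed.mem_of_tendsto hlim hx
  refine tendsto_pinv ?_ (fun k => h.isHermitian _ _) (h.posDef y hy)
  refine tendsto_pi_nhds.2 fun a => tendsto_pi_nhds.2 fun b => ?_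
  exact tendsto_of_tendstoUniformlyOn (h.unif_weight a b) (h.cont_weight a b y hy) hx hlim

lemma mem (h : LocalAsymptotics B β₀ m S D r g C) : β₀ ∈ B := interior_subset h.mem_interior

lemma tendsto_objective_true (h : LocalAsymptotics B β₀ m S D r g C)
    (hz : Tendsto (fun k => r k • g k β₀) atTop (𝓝 z)) :
    Tendsto (fun k => objective r g C k β₀) atTop (𝓝 (z ⬝ᵥ ((S β₀)⁻¹ *ᵥ z))) := by
  simp only [objective_eq]
  exact tendsto_quadForm (h.tendsto_pinv_weight (.of_forall fun _ => h.mem) tendsto_const_nhds) hz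

/-- After division by `r²` the objective at `β₀` tends to `0`, while at `x k` it tends to the `(S
y)⁻¹`-norm of `m y`. Minimality makes this norm vanish, and identifiability gives `y = β₀`. -/
lemma consistent_of_tendsto (h : LocalAsymptotics B β₀ m S D r g C)
    (hz : Tendsto (fun k => r k • g k β₀) atTop (𝓝 z)) {x : ℕ → Fin q → ℝ}
    {y : Fin q → ℝ} (hx : ∀ᶠ k in atTop, x k ∈ B) (hlim : Tendsto x atTop (𝓝 y))
    (hle : ∀ k, objective r g C k (x k) ≤ objective r g C k β₀) : y = β₀ := by
  have hy : y ∈ B := h.isCompact.isClosed.mem_of_tendsto hlim hx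
  have hg : Tendsto (fun k => g k (x k)) atTop (𝓝 (m y)) := tendsto_pi_nhds.2 fun a =>
    tendsto_of_tendstoUniformlyOn (h.unif_mean a) (h.cont_mean a y hy) hx hlim
  have h1 := tendsto_quadForm (h.tendsto_pinv_weight hx hlim) hg
  have h2 : Tendsto (fun k => (r k ^ 2)⁻¹ * objective r g C k β₀) atTop (𝓝 0) := by
    have : Tendsto (fun k => (r k ^ 2)⁻¹) atTop (𝓝 0) :=
      ((tendsto_pow_atTop two_ne_zero).comp h.tendsto_rate).inv_tendsto_atTop
    simpa using this.mul (h.tendsto_objective_true hz)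
  have h3 : m y ⬝ᵥ ((S y)⁻¹ *ᵥ m y) ≤ 0 := by
    refine le_of_tendsto_of_tendsto h1 h2 ?_
    filter_upwards [h.tendsto_rate.eventually_gt_atTop 0] with k hk
    have := mul_le_mul_of_nonneg_left (hle k) (by positivity : 0 ≤ (r k ^ 2)⁻¹)
    refine le_trans (le_of_eq ?_) this
    rw [objective, ← mul_assoc, inv_mul_cancel₀ (by positivity), one_mul]
  rw [← h.ident y hy]
  by_contra hne
  have := (h.posDef y hy).inv.dotProduct_mulVec_pos hne
  simp only [star_trivial] at this
  linarith

lemma consistent (h : LocalAsymptotics B β₀ m S D r g C)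
    (hz : Tendsto (fun k => r k • g k β₀) atTop (𝓝 z)) {x : ℕ → Fin q → ℝ}
    (hx : ∀ k, x k ∈ B) (hle : ∀ k, objective r g C k (x k) ≤ objective r g C k β₀) :
    Tendsto x atTop (𝓝 β₀) := by
  refine tendsto_of_subseq_tendsto fun φ hφ => ?_
  obtain ⟨y, hy, ψ, hψ, hlim⟩ := h.isCompact.tendsto_subseq fun k => hx (φ k)
  refine ⟨ψ, ?_⟩
  have := (h.comp (hφ.comp hψ.tendsto_atTop)).consistent_of_tendsto
    (hz.comp (hφ.comp hψ.tendsto_atTop)) (x := fun k => x (φ (ψ k)))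
    (.of_forall fun _ => hx _) hlim (fun _ => hle _)
  rw [← this]
  exact hlim

/-- Near `β₀` the Jacobian of `g k` is uniformly close to `D β₀`, first through the uniform limit
`D` and then through its continuity at `β₀`; the mean value inequality applies to `g k` minus its
linear part. Both points may move, which is needed to pass from the local alternative to `β₀`. -/
lemma eventually_taylor (h : LocalAsymptotics B β₀ m S D r g C) {x y : ℕ → Fin q → ℝ}
    (hx : Tendsto x atTop (𝓝 β₀)) (hy : Tendsto y atTop (𝓝 β₀)) {ε : ℝ} (hε : 0 < ε) :
    ∀ᶠ k in atTop, ‖g k (x k) - g k (y k) - D β₀ *ᵥ (x k - y k)‖ ≤ ε * ‖x k - y k‖ := by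
  -- Each of the `card ι * q` entries of the Jacobian is off by at most `2 * c`, so the total stays
  -- below `ε`; the `+ 1` avoids division by zero.
  set c : ℝ := ε / (2 * (Fintype.card ι * q + 1)) with hc
  have hcpos : 0 < c := by positivity
  have hcont : ∀ᶠ β in 𝓝 β₀, ∀ a j, |D β a j - D β₀ a j| < c := by
    refine eventually_all.2 fun a => eventually_all.2 fun j => ?_
    have h1 : ContinuousAt (fun β => D β a j) β₀ :=
      (h.cont_deriv a j).continuousAt (mem_interior_iff_mem_nhds.1 h.mem_interior)
    simpa [Real.dist_eq] using Metric.tendsto_nhds.1 h1 c hcpos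
  obtain ⟨ρ, hρ, hball⟩ := Metric.eventually_nhds_iff_ball.1
    (hcont.and (mem_interior_iff_mem_nhds.1 h.mem_interior))
  have hunif : ∀ᶠ k in atTop, ∀ a j, ∀ β ∈ B, |D β a j - jacobian (g k) β a j| < c :=
    eventually_all.2 fun a => eventually_all.2 fun j => by
      simpa [Real.dist_eq] using Metric.tendstoUniformlyOn_iff.1 (h.unif_deriv a j) c hcpos
  filter_upwards [hunif, hx (Metric.ball_mem_nhds _ hρ), hy (Metric.ball_mem_nhds _ hρ)]
    with k hk hxk hyk
  have := Convex.norm_image_sub_le_of_norm_fderiv_le' (𝕜 := ℝ) (f := g k) (C := ε)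
    (s := Metric.ball β₀ ρ) (x := y k) (y := x k)
    (φ := (Matrix.toLin' (D β₀)).toContinuousLinearMap)
    (fun β _ => h.differentiable k β) (fun β hβ => ?_) (convex_ball _ _) hyk hxk
  · simpa using this
  · refine (norm_le_sum_entries _).trans ?_
    calc _ ≤ ∑ _a : ι, ∑ _k : Fin q, 2 * c := by
          refine Finset.sum_le_sum fun a _ => Finset.sum_le_sum fun j _ => ?_
          have h1 := hk a j β (hball β hβ).2
          have h2 := (hball β hβ).1 a j
          have h3 : (fderiv ℝ (g k) β - (Matrix.toLin' (D β₀)).toContinuousLinearMap)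
              (Pi.single j 1) a = jacobian (g k) β a j - D β₀ a j := by
            simp [jacobian]
          rw [h3]
          rw [abs_lt] at h1 h2
          rw [abs_le]
          constructor <;> linarith
      _ = (Fintype.card ι * q) * (2 * c) := by simp [mul_assoc]
      _ ≤ ε := by
          rw [hc]
          have hn : (0 : ℝ) ≤ Fintype.card ι * q := by positivity
          rw [show (Fintype.card ι * q : ℝ) * (2 * (ε / (2 * (Fintype.card ι * q + 1)))) =
            (Fintype.card ι * q) * ε / (Fintype.card ι * q + 1) by field_simp]
          rw [div_le_iff₀ (by positivity)]
          nlinarith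

lemma tendsto_scaled_sub (h : LocalAsymptotics B β₀ m S D r g C) {x y : ℕ → Fin q → ℝ}
    (hx : Tendsto x atTop (𝓝 β₀)) (hy : Tendsto y atTop (𝓝 β₀)) {u : Fin q → ℝ}
    (hu : Tendsto (fun k => r k • (x k - y k)) atTop (𝓝 u)) :
    Tendsto (fun k => r k • g k (x k) - r k • g k (y k)) atTop (𝓝 (D β₀ *ᵥ u)) := by
  have hrem : Tendsto (fun k => r k • (g k (x k) - g k (y k) - D β₀ *ᵥ (x k - y k))) atTop (𝓝 0) := by
    refine Metric.tendsto_nhds.2 fun ε hε => ?_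
    have hb : ∀ᶠ k in atTop, ‖r k • (x k - y k)‖ < ‖u‖ + 1 :=
      hu.norm.eventually_lt_const (by linarith)
    filter_upwards [hb, h.eventually_taylor hx hy (ε := ε / (‖u‖ + 1)) (by positivity),
      h.tendsto_rate.eventually_gt_atTop 0] with k h1 h2 h3
    rw [dist_zero_right, norm_smul, Real.norm_of_nonneg h3.le]
    rw [norm_smul, Real.norm_of_nonneg h3.le] at h1
    calc _ ≤ r k * (ε / (‖u‖ + 1) * ‖x k - y k‖) := mul_le_mul_of_nonneg_left h2 h3.le
      _ = ε / (‖u‖ + 1) * (r k * ‖x k - y k‖) := by ring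
      _ < ε / (‖u‖ + 1) * (‖u‖ + 1) := mul_lt_mul_of_pos_left h1 (by positivity)
      _ = ε := by field_simp
  have hlin : Tendsto (fun k => D β₀ *ᵥ (r k • (x k - y k))) atTop (𝓝 (D β₀ *ᵥ u)) :=
    (((continuous_const.matrix_mulVec continuous_id).tendsto u)).comp hu
  have := hrem.add hlin
  rw [zero_add] at this
  refine this.congr fun k => ?_
  rw [Matrix.mulVec_smul, smul_sub, sub_add_cancel, smul_sub]

lemma tendsto_of_tendsto_scaled (h : LocalAsymptotics B β₀ m S D r g C) {x : ℕ → Fin q → ℝ}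
    {u : Fin q → ℝ} (hu : Tendsto (fun k => r k • (x k - β₀)) atTop (𝓝 u)) :
    Tendsto x atTop (𝓝 β₀) := by
  have h1 : Tendsto (fun k => (r k)⁻¹) atTop (𝓝 0) := h.tendsto_rate.inv_tendsto_atTop
  have h2 := h1.smul hu
  rw [zero_smul] at h2
  rw [← tendsto_sub_nhds_zero_iff]
  refine h2.congr' ?_
  filter_upwards [h.tendsto_rate.eventually_gt_atTop 0] with k hk
  rw [smul_smul, inv_mul_cancel₀ hk.ne', one_smul]

/-- At scale `1 / r` the score is asymptotically affine, `r g(β₀ + u / r) ≈ z + D u`, and the weight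
is frozen at `(S β₀)⁻¹`. -/
lemma tendsto_objective (h : LocalAsymptotics B β₀ m S D r g C)
    (hz : Tendsto (fun k => r k • g k β₀) atTop (𝓝 z)) {x : ℕ → Fin q → ℝ}
    {u : Fin q → ℝ} (hxB : ∀ᶠ k in atTop, x k ∈ B)
    (hu : Tendsto (fun k => r k • (x k - β₀)) atTop (𝓝 u)) :
    Tendsto (fun k => objective r g C k (x k)) atTop
      (𝓝 ((z + D β₀ *ᵥ u) ⬝ᵥ ((S β₀)⁻¹ *ᵥ (z + D β₀ *ᵥ u)))) := by
  have hx := h.tendsto_of_tendsto_scaled hu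
  simp only [objective_eq]
  refine tendsto_quadForm (h.tendsto_pinv_weight hxB hx) ?_
  have := hz.add (h.tendsto_scaled_sub hx tendsto_const_nhds hu)
  refine this.congr fun k => ?_
  abel

/-- Only the divergence of the rate enters the structure, so a slower rate is equally admissible.
This freedom is used in `bounded_scaled`. -/
lemma rescale (h : LocalAsymptotics B β₀ m S D r g C) {c : ℕ → ℝ}
    (hc : Tendsto (fun k => c k * r k) atTop atTop) :
    LocalAsymptotics B β₀ m S D (fun k => c k * r k) g C :=
  { h with tendsto_rate := hc }

/-- If `u = r (x - β₀)` were unbounded along a subsequence, the slower rate `r / ‖u‖` would send the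
rescaled score at `β₀` to `0` while the rescaled error keeps norm one and has a limit `w`.
Minimality then forces `D w = 0` with `‖w‖ = 1`, against injectivity of `D`. -/
lemma bounded_scaled (h : LocalAsymptotics B β₀ m S D r g C)
    (hz : Tendsto (fun k => r k • g k β₀) atTop (𝓝 z)) {x : ℕ → Fin q → ℝ}
    (hx : ∀ k, x k ∈ B) (hle : ∀ k, objective r g C k (x k) ≤ objective r g C k β₀) :
    ∃ M : ℝ, ∀ᶠ k in atTop, ‖r k • (x k - β₀)‖ ≤ M := by
  by_contra! hcon
  obtain ⟨φ, hφ, hlt⟩ := extraction_forall_of_frequently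
    (P := fun n k => (n : ℝ) < ‖r k • (x k - β₀)‖) fun n => hcon n
  set u : ℕ → Fin q → ℝ := fun n => r (φ n) • (x (φ n) - β₀) with hu
  have hupos : ∀ n, 0 < ‖u n‖ := fun n => lt_of_le_of_lt (Nat.cast_nonneg n) (hlt n)
  have hutop : Tendsto (fun n => ‖u n‖) atTop atTop :=
    tendsto_atTop_mono (fun n => (hlt n).le) tendsto_natCast_atTop_atTop
  obtain ⟨w, hw, ψ, hψ, hlim⟩ := (isCompact_sphere (0 : Fin q → ℝ) 1).tendsto_subseq
    (x := fun n => ‖u n‖⁻¹ • u n) fun n => by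
      rw [mem_sphere_zero_iff_norm, norm_smul, norm_inv, norm_norm, inv_mul_cancel₀ (hupos n).ne']
  have hφψ : Tendsto (φ ∘ ψ) atTop atTop := hφ.tendsto_atTop.comp hψ.tendsto_atTop
  have hcons := (h.consistent hz hx hle).comp hφψ
  have h' := h.comp hφψ
  have hc0 : Tendsto (fun n => ‖u (ψ n)‖⁻¹) atTop (𝓝 0) :=
    (hutop.comp hψ.tendsto_atTop).inv_tendsto_atTop
  -- The slowed rate equals `1 / ‖x - β₀‖`, so it still diverges, by consistency.
  have hrate : Tendsto (fun n => ‖u (ψ n)‖⁻¹ * (r ∘ φ ∘ ψ) n) atTop atTop := by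
    have h0 : Tendsto (fun n => ‖x (φ (ψ n)) - β₀‖) atTop (𝓝 0) := by
      simpa using ((tendsto_sub_nhds_zero_iff.2 hcons).norm)
    have h1 : Tendsto (fun n => ‖x (φ (ψ n)) - β₀‖) atTop (𝓝[>] 0) := by
      refine tendsto_nhdsWithin_iff.2 ⟨h0, .of_forall fun n => ?_⟩
      have := hupos (ψ n)
      rw [hu] at this
      simp only [norm_smul] at this
      exact pos_of_mul_pos_right this (norm_nonneg _)
    refine h1.inv_tendsto_nhdsGT_zero.congr' ?_
    filter_upwards [h'.tendsto_rate.eventually_gt_atTop 0, h1.eventually self_mem_nhdsWithin]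
      with n hn hn'
    have hn2 : 0 < r (φ (ψ n)) := hn
    have hn3 : 0 < ‖x (φ (ψ n)) - β₀‖ := hn'
    simp only [hu, norm_smul, Real.norm_of_nonneg hn2.le, Pi.inv_apply, Function.comp]
    field_simp
  have hs := h'.rescale (c := fun n => ‖u (ψ n)‖⁻¹) hrate
  have hz' : Tendsto (fun n => (‖u (ψ n)‖⁻¹ * (r ∘ φ ∘ ψ) n) • (g ∘ φ ∘ ψ) n β₀) atTop (𝓝 0) := by
    have := hc0.smul (hz.comp hφψ)
    rw [zero_smul] at this
    exact this.congr fun n => by simp [smul_smul]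
  have hlow := hs.tendsto_objective hz' (x := fun n => x (φ (ψ n))) (u := w)
    (.of_forall fun _ => hx _) (by
      refine hlim.congr fun n => ?_
      simp [hu, smul_smul])
  have hle2 := le_of_tendsto_of_tendsto hlow (hs.tendsto_objective_true hz') (.of_forall fun n => by
    have := mul_le_mul_of_nonneg_left (hle (φ (ψ n))) (sq_nonneg ‖u (ψ n)‖⁻¹)
    simpa only [objective, mul_pow, mul_assoc, Function.comp] using this)
  rw [zero_add, zero_dotProduct] at hle2
  have hDw : D β₀ *ᵥ w = 0 := by
    by_contra hne
    have := (h.posDef β₀ h.mem).inv.dotProduct_mulVec_pos hne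
    simp only [star_trivial] at this
    linarith
  have := h.inj w hDw
  rw [mem_sphere_zero_iff_norm, this, norm_zero] at hw
  exact zero_ne_one hw

/-- The constrained minimum of the objective function converges to the constrained minimum of the
limiting quadratic function. -/
theorem tendsto_min (h : LocalAsymptotics B β₀ m S D r g C)
    (hz : Tendsto (fun k => r k • g k β₀) atTop (𝓝 z)) (K : Submodule ℝ (Fin q → ℝ))
    {x : ℕ → Fin q → ℝ} (hx : ∀ k, x k ∈ B) (hxK : ∀ k, x k - β₀ ∈ K)
    (hmin : ∀ k, ∀ β ∈ B, β - β₀ ∈ K → objective r g C k (x k) ≤ objective r g C k β)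
    {u : Fin q → ℝ} (hu : u ∈ K)
    (humin : ∀ w ∈ K, (z + D β₀ *ᵥ u) ⬝ᵥ ((S β₀)⁻¹ *ᵥ (z + D β₀ *ᵥ u)) ≤
      (z + D β₀ *ᵥ w) ⬝ᵥ ((S β₀)⁻¹ *ᵥ (z + D β₀ *ᵥ w))) :
    Tendsto (fun k => objective r g C k (x k)) atTop
      (𝓝 ((z + D β₀ *ᵥ u) ⬝ᵥ ((S β₀)⁻¹ *ᵥ (z + D β₀ *ᵥ u)))) := by
  have hle : ∀ k, objective r g C k (x k) ≤ objective r g C k β₀ := fun k =>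
    hmin k β₀ h.mem (by simp)
  obtain ⟨M, hM⟩ := h.bounded_scaled hz hx hle
  refine tendsto_of_subseq_tendsto fun φ hφ => ?_
  obtain ⟨w, -, ψ, hψ, hlim⟩ := (isCompact_closedBall (0 : Fin q → ℝ) M).tendsto_subseq'
    (x := fun n => r (φ n) • (x (φ n) - β₀)) ((hφ.eventually hM).mono fun n hn => by
      simpa using hn).frequently
  refine ⟨ψ, ?_⟩
  have hφψ : Tendsto (φ ∘ ψ) atTop atTop := hφ.comp hψ.tendsto_atTop
  have h' := h.comp hφψ
  have hwK : w ∈ K := K.closed_of_finiteDimensional.mem_of_tendsto hlim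
    (.of_forall fun n => K.smul_mem _ (hxK _))
  have h1 := h'.tendsto_objective (hz.comp hφψ) (x := fun n => x (φ (ψ n))) (.of_forall fun _ => hx _) hlim
  -- A competitor that realizes the limiting minimizer `u`: it stays in `β₀ + K`, and in `B`
  -- eventually because `β₀` is interior. Comparison with it bounds the subsequential limit from
  -- above, `humin` from below.
  set y : ℕ → Fin q → ℝ := fun n => β₀ + (r (φ (ψ n)))⁻¹ • u with hy
  have hyu : Tendsto (fun n => (r ∘ φ ∘ ψ) n • (y n - β₀)) atTop (𝓝 u) := by
    refine tendsto_const_nhds.congr' ?_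
    filter_upwards [h'.tendsto_rate.eventually_gt_atTop 0] with n hn
    have hn' : 0 < r (φ (ψ n)) := hn
    simp [hy, smul_smul, mul_inv_cancel₀ hn'.ne']
  have hyB : ∀ᶠ n in atTop, y n ∈ B :=
    h'.tendsto_of_tendsto_scaled hyu (mem_interior_iff_mem_nhds.1 h.mem_interior)
  have h2 := h'.tendsto_objective (hz.comp hφψ) hyB hyu
  have h3 := le_of_tendsto_of_tendsto h1 h2 (hyB.mono fun n hn => hmin _ _ hn (by
    simpa [hy] using K.smul_mem _ hu))
  rwa [le_antisymm h3 (humin w hwK)] at h1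

end LocalAsymptotics

/-! ### The limiting quadratic problem and its standardization -/

section LinearAlgebra

lemma mulVec_dotProduct {ι κ : Type*} [Fintype ι] [Fintype κ] (A : Matrix ι κ ℝ)
    (x : κ → ℝ) (y : ι → ℝ) : (A *ᵥ x) ⬝ᵥ y = x ⬝ᵥ (Aᵀ *ᵥ y) := by
  rw [Matrix.dotProduct_mulVec, Matrix.vecMul_transpose]

/-- A Householder reflection: vectors of equal length are related by an orthogonal matrix. -/
lemma exists_orthogonal_mulVec_eq {ι : Type*} [Fintype ι] [DecidableEq ι] {a w : ι → ℝ}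
    (h : a ⬝ᵥ a = w ⬝ᵥ w) : ∃ O : Matrix ι ι ℝ, Oᵀ * O = 1 ∧ O *ᵥ a = w := by
  rcases eq_or_ne a w with rfl | hne
  · exact ⟨1, by simp, by simp⟩
  set n := a - w with hn
  have hn0 : n ⬝ᵥ n ≠ 0 := fun h0 => hne (sub_eq_zero.1 (dotProduct_self_eq_zero.1 h0))
  set c : ℝ := 2 / (n ⬝ᵥ n) with hc
  refine ⟨1 - c • vecMulVec n n, ?_, ?_⟩
  · have hT : (1 - c • vecMulVec n n)ᵀ = 1 - c • vecMulVec n n := by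
      simp [transpose_vecMulVec]
    rw [hT, Matrix.sub_mul, Matrix.mul_sub, Matrix.mul_sub]
    simp only [Matrix.one_mul, Matrix.mul_one, Matrix.smul_mul, Matrix.mul_smul,
      vecMulVec_mul_vecMulVec, smul_smul]
    have : c * c * (n ⬝ᵥ n) = 2 * c := by rw [hc]; field_simp
    rw [vecMulVec_smul, smul_smul, this, two_mul, add_smul]
    abel
  · have hna : n ⬝ᵥ n = 2 * (n ⬝ᵥ a) := by
      rw [hn]
      simp only [sub_dotProduct, dotProduct_sub]
      rw [dotProduct_comm w a, ← h]
      ring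
    have hca : c * (n ⬝ᵥ a) = 1 := by
      rw [hc, hna]
      have : n ⬝ᵥ a ≠ 0 := fun h0 => hn0 (by rw [hna, h0, mul_zero])
      field_simp
    rw [Matrix.sub_mulVec, Matrix.one_mulVec, Matrix.smul_mulVec, vecMulVec_mulVec]
    simp only [op_smul_eq_smul, smul_smul, hca, one_smul]
    simp [hn]

/-- A square root of a positive definite matrix that maps a given vector to a multiple of the
first unit vector. -/
lemma exists_sqrt_mulVec_eq {p : ℕ} {K : Matrix (Fin p) (Fin p) ℝ} (hK : K.PosDef)
    (x : Fin p → ℝ) : ∃ R : Matrix (Fin p) (Fin p) ℝ, Rᵀ * R = K ∧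
      R *ᵥ x = fun i : Fin p => if (i : ℕ) = 0 then √(x ⬝ᵥ (K *ᵥ x)) else 0 := by
  obtain ⟨M, hM⟩ : ∃ M : Matrix (Fin p) (Fin p) ℝ, K = Mᴴ * M := by
    open scoped MatrixOrder in
    exact CStarAlgebra.nonneg_iff_eq_star_mul_self.1 hK.posSemidef.nonneg
  rw [conjTranspose_eq_transpose_of_trivial] at hM
  have hx : (M *ᵥ x) ⬝ᵥ (M *ᵥ x) = x ⬝ᵥ (K *ᵥ x) := by
    rw [mulVec_dotProduct, hM, Matrix.mulVec_mulVec]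
  have hnn : 0 ≤ x ⬝ᵥ (K *ᵥ x) := hx ▸ dotProduct_self_star_nonneg (M *ᵥ x)
  obtain ⟨O, hO, hOa⟩ := exists_orthogonal_mulVec_eq (a := M *ᵥ x)
    (w := fun i : Fin p => if (i : ℕ) = 0 then √(x ⬝ᵥ (K *ᵥ x)) else 0) (by
      rw [hx]
      rcases p with _ | p
      · simp [dotProduct]
      · generalize x ⬝ᵥ (K *ᵥ x) = c at hnn ⊢
        rw [dotProduct, Fin.sum_univ_succ]
        simp [Real.mul_self_sqrt hnn])
  refine ⟨O * M, ?_, ?_⟩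
  · rw [Matrix.transpose_mul, Matrix.mul_assoc, ← Matrix.mul_assoc Oᵀ, hO, Matrix.one_mul, hM]
  · rw [← Matrix.mulVec_mulVec, hOa]

lemma quadForm_add {ι κ : Type*} [Fintype ι] [Fintype κ] {M : Matrix ι ι ℝ} (hM : Mᵀ = M)
    (D : Matrix ι κ ℝ) (y : ι → ℝ) (w : κ → ℝ) :
    (y + D *ᵥ w) ⬝ᵥ (M *ᵥ (y + D *ᵥ w)) = y ⬝ᵥ (M *ᵥ y) + 2 * (w ⬝ᵥ ((Dᵀ * M) *ᵥ y)) +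
      w ⬝ᵥ ((Dᵀ * M * D) *ᵥ w) := by
  simp only [Matrix.mulVec_add, add_dotProduct, dotProduct_add]
  have h1 : (D *ᵥ w) ⬝ᵥ (M *ᵥ y) = w ⬝ᵥ ((Dᵀ * M) *ᵥ y) := by
    rw [mulVec_dotProduct, Matrix.mulVec_mulVec]
  have h2 : y ⬝ᵥ (M *ᵥ (D *ᵥ w)) = w ⬝ᵥ ((Dᵀ * M) *ᵥ y) := by
    rw [← h1, dotProduct_comm, mulVec_dotProduct, hM]
  have h3 : (D *ᵥ w) ⬝ᵥ (M *ᵥ (D *ᵥ w)) = w ⬝ᵥ ((Dᵀ * M * D) *ᵥ w) := by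
    rw [mulVec_dotProduct, Matrix.mulVec_mulVec, Matrix.mulVec_mulVec, Matrix.mul_assoc]
  rw [h1, h2, h3]
  ring

lemma mulVec_injective_of_isUnit_info {ι κ : Type*} [Fintype ι] [Fintype κ] [DecidableEq κ]
    {M : Matrix ι ι ℝ} {D : Matrix ι κ ℝ} (hJ : IsUnit (Dᵀ * M * D)) :
    Function.Injective D.mulVec := by
  intro x y hxy
  apply Matrix.mulVec_injective_of_isUnit hJ
  simp only [← Matrix.mulVec_mulVec]
  exact congrArg (fun w => Dᵀ *ᵥ (M *ᵥ w)) hxy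

/-- The difference of the constrained and the unconstrained minimum of the limiting quadratic
function is the squared length of an affine function of the score, whose linear part is standardized
by the covariance matrix `S`. -/
theorem exists_standardization {ι : Type*} [Fintype ι] [DecidableEq ι] {q p : ℕ}
    {S : Matrix ι ι ℝ} (hS : S.PosDef) (D : Matrix ι (Fin q) ℝ)
    (hJ : IsUnit (Dᵀ * S⁻¹ * D)) (L : Matrix (Fin q) (Fin p) ℝ) (hL : LinearIndependent ℝ L.col)
    (v : Fin q → ℝ) :
    ∃ A : Matrix (Fin p) ι ℝ, A * S * Aᵀ = 1 ∧ ∀ y : ι → ℝ, ∃ u w : Fin q → ℝ,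
      (∀ x, ((y - D *ᵥ v) + D *ᵥ u) ⬝ᵥ (S⁻¹ *ᵥ ((y - D *ᵥ v) + D *ᵥ u)) ≤
        ((y - D *ᵥ v) + D *ᵥ x) ⬝ᵥ (S⁻¹ *ᵥ ((y - D *ᵥ v) + D *ᵥ x))) ∧
      Lᵀ *ᵥ w = 0 ∧
      (∀ x, Lᵀ *ᵥ x = 0 → ((y - D *ᵥ v) + D *ᵥ w) ⬝ᵥ (S⁻¹ *ᵥ ((y - D *ᵥ v) + D *ᵥ w)) ≤
        ((y - D *ᵥ v) + D *ᵥ x) ⬝ᵥ (S⁻¹ *ᵥ ((y - D *ᵥ v) + D *ᵥ x))) ∧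
      ((y - D *ᵥ v) + D *ᵥ w) ⬝ᵥ (S⁻¹ *ᵥ ((y - D *ᵥ v) + D *ᵥ w)) -
        ((y - D *ᵥ v) + D *ᵥ u) ⬝ᵥ (S⁻¹ *ᵥ ((y - D *ᵥ v) + D *ᵥ u)) =
      ∑ i : Fin p, ((A *ᵥ y) i + if (i : ℕ) = 0 then
        √(v ⬝ᵥ ((L * (Lᵀ * (Dᵀ * S⁻¹ * D)⁻¹ * L)⁻¹ * Lᵀ) *ᵥ v)) else 0) ^ 2 := by
  set J := Dᵀ * S⁻¹ * D with hJdef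
  have hMT : (S⁻¹)ᵀ = S⁻¹ := by
    have := hS.inv.isHermitian
    rwa [IsHermitian, conjTranspose_eq_transpose_of_trivial] at this
  have hJpos : J.PosDef := by
    have := hS.inv.conjTranspose_mul_mul_same (mulVec_injective_of_isUnit_info hJ)
    rwa [conjTranspose_eq_transpose_of_trivial] at this
  have hGpos : (Lᵀ * J⁻¹ * L).PosDef := by
    have := hJpos.inv.conjTranspose_mul_mul_same (Matrix.mulVec_injective_iff.2 hL)
    rwa [conjTranspose_eq_transpose_of_trivial] at this
  set G := Lᵀ * J⁻¹ * L with hG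
  have hJT : (J⁻¹)ᵀ = J⁻¹ := by
    have := hJpos.inv.isHermitian
    rwa [IsHermitian, conjTranspose_eq_transpose_of_trivial] at this
  have hJJ : J * J⁻¹ = 1 := Matrix.mul_nonsing_inv _ ((Matrix.isUnit_iff_isUnit_det _).1 hJ)
  have hGG : G * G⁻¹ = 1 :=
    Matrix.mul_nonsing_inv _ ((Matrix.isUnit_iff_isUnit_det _).1 hGpos.isUnit)
  have hSS : S⁻¹ * S = 1 :=
    Matrix.nonsing_inv_mul _ ((Matrix.isUnit_iff_isUnit_det _).1 hS.isUnit)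
  -- Among the square roots of `G⁻¹`, which differ by orthogonal factors, one is chosen that puts
  -- the whole shift `Lᵀ v` on the first coordinate.
  obtain ⟨R, hR, hRx⟩ := exists_sqrt_mulVec_eq hGpos.inv (Lᵀ *ᵥ v)
  have hδ : (Lᵀ *ᵥ v) ⬝ᵥ (G⁻¹ *ᵥ (Lᵀ *ᵥ v)) = v ⬝ᵥ ((L * G⁻¹ * Lᵀ) *ᵥ v) := by
    rw [mulVec_dotProduct, transpose_transpose, Matrix.mulVec_mulVec, Matrix.mulVec_mulVec,
      Matrix.mul_assoc]
  rw [hδ] at hRx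
  have hRGR : R * G * Rᵀ = 1 := by
    have h1 : (G * Rᵀ) * R = 1 := by rw [Matrix.mul_assoc, hR, hGG]
    have h2 : R * (G * Rᵀ) = 1 := mul_eq_one_comm.1 h1
    rwa [Matrix.mul_assoc]
  -- The excess of the constrained over the free minimum is `|R Lᵀ u|²`, where `u = -J⁻¹ Dᵀ S⁻¹ y +
  -- v` is the free minimizer. This `A` is the part of `R Lᵀ u` that is linear in `y`, and `R Lᵀ v`
  -- is the constant part.
  refine ⟨-(R * Lᵀ * J⁻¹ * Dᵀ * S⁻¹), ?_, fun y => ?_⟩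
  · have hT : (-(R * Lᵀ * J⁻¹ * Dᵀ * S⁻¹))ᵀ = -(S⁻¹ * D * J⁻¹ * L * Rᵀ) := by
      simp only [transpose_neg, transpose_mul, transpose_transpose, hJT, hMT, Matrix.mul_assoc]
    rw [hT, Matrix.neg_mul, Matrix.neg_mul, Matrix.mul_neg, neg_neg]
    calc _ = R * Lᵀ * J⁻¹ * Dᵀ * (S⁻¹ * S) * S⁻¹ * D * J⁻¹ * L * Rᵀ := by
          simp only [Matrix.mul_assoc]
      _ = R * (Lᵀ * (J⁻¹ * (Dᵀ * S⁻¹ * D)) * J⁻¹ * L) * Rᵀ := by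
          rw [hSS]; simp only [Matrix.mul_assoc, Matrix.one_mul]
      _ = R * (Lᵀ * J⁻¹ * L) * Rᵀ := by
          rw [← hJdef, mul_eq_one_comm.1 hJJ, Matrix.mul_one]
      _ = 1 := by rw [← hG, hRGR]
  set z := y - D *ᵥ v with hz
  set u : Fin q → ℝ := -((J⁻¹ * Dᵀ * S⁻¹) *ᵥ z) with hu
  -- The component of `u` that is `J`-orthogonal to the kernel of `Lᵀ`; the constrained minimizer is
  -- therefore `u - t`.
  set t : Fin q → ℝ := (J⁻¹ * L * G⁻¹ * Lᵀ) *ᵥ u with ht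
  have hJu : (Dᵀ * S⁻¹) *ᵥ (z + D *ᵥ u) = 0 := by
    rw [Matrix.mulVec_add, Matrix.mulVec_mulVec, ← hJdef, hu, Matrix.mulVec_neg,
      Matrix.mulVec_mulVec, Matrix.mul_assoc J⁻¹, ← Matrix.mul_assoc J, hJJ, Matrix.one_mul]
    abel
  -- Completing the square: the cross term vanishes by the normal equations `hJu`.
  have hquad : ∀ x, (z + D *ᵥ x) ⬝ᵥ (S⁻¹ *ᵥ (z + D *ᵥ x)) =
      (z + D *ᵥ u) ⬝ᵥ (S⁻¹ *ᵥ (z + D *ᵥ u)) + (x - u) ⬝ᵥ (J *ᵥ (x - u)) := fun x => by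
    have := quadForm_add hMT D (z + D *ᵥ u) (x - u)
    rw [hJu, dotProduct_zero, mul_zero, add_zero, ← hJdef] at this
    rw [← this, show z + D *ᵥ u + D *ᵥ (x - u) = z + D *ᵥ x by rw [Matrix.mulVec_sub]; abel]
  have hnonneg : ∀ x : Fin q → ℝ, 0 ≤ x ⬝ᵥ (J *ᵥ x) := fun x => by
    simpa using hJpos.posSemidef.dotProduct_mulVec_nonneg x
  have hLt : Lᵀ *ᵥ t = Lᵀ *ᵥ u := by
    rw [ht, Matrix.mulVec_mulVec, show Lᵀ * (J⁻¹ * L * G⁻¹ * Lᵀ) = (Lᵀ * J⁻¹ * L) * G⁻¹ * Lᵀ by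
      simp only [Matrix.mul_assoc], ← hG, hGG, Matrix.one_mul]
  have hJt : J *ᵥ t = L *ᵥ (G⁻¹ *ᵥ (Lᵀ *ᵥ u)) := by
    rw [ht, Matrix.mulVec_mulVec, show J * (J⁻¹ * L * G⁻¹ * Lᵀ) = (J * J⁻¹) * L * G⁻¹ * Lᵀ by
      simp only [Matrix.mul_assoc], hJJ, Matrix.one_mul, Matrix.mulVec_mulVec,
      Matrix.mulVec_mulVec, Matrix.mul_assoc]
  have horth : ∀ x, x ⬝ᵥ (J *ᵥ t) = (Lᵀ *ᵥ x) ⬝ᵥ (G⁻¹ *ᵥ (Lᵀ *ᵥ u)) := fun x => by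
    rw [hJt, mulVec_dotProduct, transpose_transpose]
  have hJT' : Jᵀ = J := by
    have := hJpos.isHermitian
    rwa [IsHermitian, conjTranspose_eq_transpose_of_trivial] at this
  refine ⟨u, u - t, fun x => ?_, ?_, fun x hx => ?_, ?_⟩
  · rw [hquad x]
    linarith [hnonneg (x - u)]
  · rw [Matrix.mulVec_sub, hLt, sub_self]
  · rw [hquad x, hquad (u - t)]
    -- Pythagoras in the `J` inner product: `x - u + t` lies in the kernel of `Lᵀ`, hence is
    -- orthogonal to `t`.
    have h1 := quadForm_add hJT' (1 : Matrix (Fin q) (Fin q) ℝ) (-t) (x - u + t)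
    simp only [Matrix.one_mulVec, Matrix.transpose_one, Matrix.one_mul, Matrix.mul_one] at h1
    have h2 : (x - u + t) ⬝ᵥ (J *ᵥ -t) = 0 := by
      rw [Matrix.mulVec_neg, dotProduct_neg, horth, Matrix.mulVec_add, Matrix.mulVec_sub, hx, hLt]
      simp
    rw [h2, show -t + (x - u + t) = x - u by abel] at h1
    rw [h1, show u - t - u = -t by abel]
    linarith [hnonneg (x - u + t)]
  · have hval : (-(R * Lᵀ * J⁻¹ * Dᵀ * S⁻¹)) *ᵥ y + (R *ᵥ (Lᵀ *ᵥ v)) = R *ᵥ (Lᵀ *ᵥ u) := by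
      have huv : u = -((J⁻¹ * Dᵀ * S⁻¹) *ᵥ y) + v := by
        rw [hu, hz, Matrix.mulVec_sub, Matrix.mulVec_mulVec, Matrix.mul_assoc J⁻¹,
          Matrix.mul_assoc J⁻¹, ← hJdef, mul_eq_one_comm.1 hJJ, Matrix.one_mulVec]
        abel
      rw [huv, Matrix.mulVec_add, Matrix.mulVec_add, Matrix.neg_mulVec, Matrix.mulVec_neg,
        Matrix.mulVec_neg]
      simp only [Matrix.mulVec_mulVec, Matrix.mul_assoc]
    rw [hquad (u - t), show u - t - u = -t by abel, add_sub_cancel_left, Matrix.mulVec_neg,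
      neg_dotProduct_neg, horth, hLt]
    have hfin : (Lᵀ *ᵥ u) ⬝ᵥ (G⁻¹ *ᵥ (Lᵀ *ᵥ u)) = (R *ᵥ (Lᵀ *ᵥ u)) ⬝ᵥ (R *ᵥ (Lᵀ *ᵥ u)) := by
      rw [← hR, ← Matrix.mulVec_mulVec, ← mulVec_dotProduct]
    rw [hfin, ← hval, hRx]
    simp only [dotProduct, sq, Pi.add_apply]

end LinearAlgebra

/-! ### Truncation, and passage to the limit under uniform integrability -/

section Cutoff

variable {Z : Type*} [NormedAddCommGroup Z]

/-- A continuous function that is `1` on the ball of radius `R` and `0` outside the ball of radius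
`R + 1`. -/
def cutoff (R : ℝ) (z : Z) : ℝ := max 0 (min 1 (R + 1 - ‖z‖))

lemma continuous_cutoff (R : ℝ) : Continuous (cutoff R : Z → ℝ) := by
  unfold cutoff; fun_prop

lemma cutoff_nonneg (R : ℝ) (z : Z) : 0 ≤ cutoff R z := le_max_left _ _

lemma cutoff_le_one (R : ℝ) (z : Z) : cutoff R z ≤ 1 := max_le zero_le_one (min_le_left _ _)

lemma cutoff_eq_one {R : ℝ} {z : Z} (h : ‖z‖ ≤ R) : cutoff R z = 1 := by
  rw [cutoff, min_eq_left (by linarith), max_eq_right zero_le_one]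

lemma cutoff_eq_zero {R : ℝ} {z : Z} (h : R + 1 ≤ ‖z‖) : cutoff R z = 0 := by
  rw [cutoff, max_eq_left]
  exact (min_le_right _ _).trans (by linarith)

lemma norm_cutoff_smul_le {𝕜 : Type*} [RCLike 𝕜] {f : Z → 𝕜} {R C : ℝ} (hC : 0 ≤ C)
    (hf : ∀ z, ‖z‖ ≤ R + 1 → ‖f z‖ ≤ C) (z : Z) : ‖(cutoff R z : 𝕜) * f z‖ ≤ C := by
  rw [norm_mul, RCLike.norm_ofReal, abs_of_nonneg (cutoff_nonneg R z)]
  rcases le_total ‖z‖ (R + 1) with h | h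
  · calc _ ≤ 1 * C := mul_le_mul (cutoff_le_one R z) (hf z h) (norm_nonneg _) zero_le_one
      _ = C := one_mul C
  · rw [cutoff_eq_zero h, zero_mul]
    exact hC

end Cutoff

section UniformIntegrability

variable {Z : Type*} [NormedAddCommGroup Z] [MeasurableSpace Z] [BorelSpace Z]
  {Θ : Type*} [TopologicalSpace Θ] {F : Θ → ProbabilityMeasure Z} {θ₀ : Θ} {G : Z → ℝ≥0∞}

lemma UnifIntegrableNear.eventually_lintegral_ne_top (hUI : UnifIntegrableNear F θ₀ G)
    (hG : Measurable G) : ∀ᶠ θ in 𝓝 θ₀, ∫⁻ z, G z ∂(F θ : Measure Z) ≠ ∞ := by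
  obtain ⟨K, hK⟩ := hUI 1 one_pos
  filter_upwards [hK] with θ hθ
  have hm : MeasurableSet {z | (K : ℝ≥0∞) < G z} := measurableSet_lt measurable_const hG
  rw [← lintegral_add_compl _ hm]
  refine ENNReal.add_ne_top.2 ⟨(hθ.trans_lt ENNReal.one_lt_top).ne, ?_⟩
  refine ne_of_lt (lt_of_le_of_lt (setLIntegral_mono measurable_const
    (g := fun _ => (K : ℝ≥0∞)) fun z hz => not_lt.1 hz) ?_)
  rw [setLIntegral_const]
  exact ENNReal.mul_lt_top ENNReal.coe_lt_top (measure_lt_top _ _)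

/-- Split at level `K`: the part with `G > K` is small by uniform integrability, and elsewhere the
integrand is at most `K (1 - cutoff R)`. The latter is made small under `F θ₀` by the choice of `R`,
and weak convergence transfers this to nearby `θ`, since `1 - cutoff R` is bounded and continuous.
No continuity of `G` is needed. -/
lemma UnifIntegrableNear.exists_cutoff (hF : ContinuousAt F θ₀) (hG : Measurable G)
    (hUI : UnifIntegrableNear F θ₀ G) {ε : ℝ} (hε : 0 < ε) :
    ∃ R : ℝ, ∀ᶠ θ in 𝓝 θ₀,
      ∫⁻ z, G z * ENNReal.ofReal (1 - cutoff R z) ∂(F θ : Measure Z) ≤ ENNReal.ofReal ε := by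
  obtain ⟨K, hK⟩ := hUI (ENNReal.ofReal (ε / 2)) (ENNReal.ofReal_pos.2 (by positivity))
  have hmeas : ∀ R : ℝ, Measurable fun z : Z => ENNReal.ofReal (1 - cutoff R z) := fun R =>
    (ENNReal.continuous_ofReal.comp (continuous_const.sub (continuous_cutoff R))).measurable
  have hlim : Tendsto (fun n : ℕ => ∫⁻ z, ENNReal.ofReal (1 - cutoff n z) ∂(F θ₀ : Measure Z))
      atTop (𝓝 0) := by
    have := tendsto_lintegral_of_dominated_convergence (μ := (F θ₀ : Measure Z))
      (F := fun (n : ℕ) z => ENNReal.ofReal (1 - cutoff (n : ℝ) z)) (f := fun _ => 0)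
      (fun _ => 1) (fun n => hmeas n) (fun n => .of_forall fun z => ?_) (by simp)
      (.of_forall fun z => ?_)
    · simpa using this
    · exact ENNReal.ofReal_le_one.2 (by linarith [cutoff_nonneg (n : ℝ) z])
    · refine tendsto_const_nhds.congr' ?_
      filter_upwards [eventually_ge_atTop ⌈‖z‖⌉₊] with n hn
      rw [cutoff_eq_one ((Nat.le_ceil _).trans (by exact_mod_cast hn))]
      simp
  set η : ℝ := ε / (2 * (K + 1)) with hη
  have hηpos : 0 < η := by positivity
  obtain ⟨n, hn⟩ := (hlim.eventually_lt_const (ENNReal.ofReal_pos.2 hηpos)).exists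
  refine ⟨n, ?_⟩
  have hweak : Tendsto (fun θ => ∫⁻ z, ENNReal.ofReal (1 - cutoff (n : ℝ) z) ∂(F θ : Measure Z))
      (𝓝 θ₀) (𝓝 (∫⁻ z, ENNReal.ofReal (1 - cutoff (n : ℝ) z) ∂(F θ₀ : Measure Z))) := by
    have hc : Continuous fun z : Z => Real.toNNReal (1 - cutoff (n : ℝ) z) :=
      continuous_real_toNNReal.comp (continuous_const.sub (continuous_cutoff _))
    exact ProbabilityMeasure.tendsto_iff_forall_lintegral_tendsto.1 hF
      (BoundedContinuousFunction.mkOfBound ⟨_, hc⟩ 1 fun x y => by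
        have hb : ∀ z : Z, Real.toNNReal (1 - cutoff (n : ℝ) z) ≤ 1 := fun z =>
          Real.toNNReal_le_one.2 (by linarith [cutoff_nonneg (n : ℝ) z])
        have hx : ((Real.toNNReal (1 - cutoff (n : ℝ) x) : ℝ≥0) : ℝ) ≤ 1 := by
          exact_mod_cast hb x
        have hy : ((Real.toNNReal (1 - cutoff (n : ℝ) y) : ℝ≥0) : ℝ) ≤ 1 := by
          exact_mod_cast hb y
        rw [NNReal.dist_eq, abs_le]
        simp only [ContinuousMap.coe_mk]
        constructor
        · linarith [NNReal.coe_nonneg (Real.toNNReal (1 - cutoff (n : ℝ) x)), hy]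
        · linarith [NNReal.coe_nonneg (Real.toNNReal (1 - cutoff (n : ℝ) y)), hx])
  filter_upwards [hK, hweak.eventually_lt_const hn] with θ h1 h2
  have hm : MeasurableSet {z | (K : ℝ≥0∞) < G z} := measurableSet_lt measurable_const hG
  calc ∫⁻ z, G z * ENNReal.ofReal (1 - cutoff (n : ℝ) z) ∂(F θ : Measure Z)
      ≤ ∫⁻ z, ({z | (K : ℝ≥0∞) < G z}.indicator G z +
          K * ENNReal.ofReal (1 - cutoff (n : ℝ) z)) ∂(F θ : Measure Z) := by
        refine lintegral_mono fun z => ?_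
        by_cases hz : (K : ℝ≥0∞) < G z
        · rw [Set.indicator_of_mem (by exact hz)]
          refine le_add_right ?_
          calc _ ≤ G z * 1 := by
                gcongr
                exact ENNReal.ofReal_le_one.2 (by linarith [cutoff_nonneg (n : ℝ) z])
            _ = G z := mul_one _
        · rw [Set.indicator_of_notMem (by exact hz), zero_add]
          gcongr
          exact not_lt.1 hz
    _ = ∫⁻ z in {z | (K : ℝ≥0∞) < G z}, G z ∂(F θ : Measure Z) +
          K * ∫⁻ z, ENNReal.ofReal (1 - cutoff (n : ℝ) z) ∂(F θ : Measure Z) := by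
        rw [lintegral_add_left (hG.indicator hm), lintegral_indicator hm,
          lintegral_const_mul _ (hmeas _)]
    _ ≤ ENNReal.ofReal (ε / 2) + ENNReal.ofReal (K * η) := by
        rw [ENNReal.ofReal_mul K.coe_nonneg, ENNReal.ofReal_coe_nnreal]
        gcongr
    _ ≤ ENNReal.ofReal ε := by
        rw [← ENNReal.ofReal_add (by positivity) (by positivity)]
        refine ENNReal.ofReal_le_ofReal ?_
        have : K * η ≤ ε / 2 := by
          rw [hη, mul_div_assoc', div_le_div_iff₀ (by positivity) (by positivity)]
          nlinarith [K.coe_nonneg]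
        linarith

lemma integrable_of_enorm_le {𝕜 : Type*} [RCLike 𝕜] {μ : Measure Z} {f : Z → 𝕜}
    (hf : Continuous f) (hfG : ∀ z, ‖f z‖ₑ ≤ G z) (hG : ∫⁻ z, G z ∂μ ≠ ∞) : Integrable f μ := by
  have : SecondCountableTopologyEither Z 𝕜 := inferInstance
  exact ⟨hf.aestronglyMeasurable, lt_of_le_of_lt (lintegral_mono hfG) hG.lt_top⟩

lemma norm_integral_sub_cutoff_le {𝕜 : Type*} [RCLike 𝕜] {μ : Measure Z} {f : Z → 𝕜} {R ε : ℝ}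
    (hε : 0 ≤ ε) (hf : Continuous f) (hfG : ∀ z, ‖f z‖ₑ ≤ G z) (hG : ∫⁻ z, G z ∂μ ≠ ∞)
    (hcut : ∫⁻ z, G z * ENNReal.ofReal (1 - cutoff R z) ∂μ ≤ ENNReal.ofReal ε) :
    ‖∫ z, f z ∂μ - ∫ z, (cutoff R z : 𝕜) * f z ∂μ‖ ≤ ε := by
  have hc : Continuous fun z : Z => (cutoff R z : 𝕜) :=
    RCLike.continuous_ofReal.comp (continuous_cutoff R)
  have hInt : Integrable f μ := integrable_of_enorm_le hf hfG hG
  have hint_cut : Integrable (fun z => (cutoff R z : 𝕜) * f z) μ := by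
    refine integrable_of_enorm_le (hc.mul hf) (fun z => ?_) hG
    refine le_trans ?_ (hfG z)
    rw [enorm_mul]
    refine mul_le_of_le_one_left zero_le ?_
    rw [← ofReal_norm, RCLike.norm_ofReal, abs_of_nonneg (cutoff_nonneg R z)]
    exact ENNReal.ofReal_le_one.2 (cutoff_le_one R z)
  rw [← integral_sub hInt hint_cut, ← ENNReal.ofReal_le_ofReal_iff hε, ofReal_norm]
  refine (enorm_integral_le_lintegral_enorm _).trans ((lintegral_mono fun z => ?_).trans hcut)
  have : f z - (cutoff R z : 𝕜) * f z = ((1 - cutoff R z : ℝ) : 𝕜) * f z := by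
    push_cast; ring
  rw [this, enorm_mul, mul_comm, ← ofReal_norm ((1 - cutoff R z : ℝ) : 𝕜), RCLike.norm_ofReal,
    abs_of_nonneg (by linarith [cutoff_le_one R z])]
  gcongr
  exact hfG z

variable [ProperSpace Z]

lemma exists_bound_on_ball {𝕜 : Type*} [RCLike 𝕜] {f : Z → 𝕜} (hf : Continuous f) (R : ℝ) :
    ∃ C : ℝ, 0 ≤ C ∧ ∀ z, ‖z‖ ≤ R → ‖f z‖ ≤ C := by
  obtain ⟨C, hC⟩ := (isCompact_closedBall (0 : Z) R).exists_bound_of_continuousOn hf.continuousOn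
  exact ⟨max C 0, le_max_right _ _, fun z hz => (hC z (by simpa using hz)).trans (le_max_left _ _)⟩

/-- By compactness of the ball, joint continuity gives closeness in the parameter that is uniform in
`z`; the cutoff confines all estimates to such a ball. -/
lemma eventually_ball_dist_lt {𝕜 T : Type*} [RCLike 𝕜] [TopologicalSpace T] {f : T → Z → 𝕜}
    (hf : Continuous (Function.uncurry f)) (τ₀ : T) (R : ℝ) {ε : ℝ} (hε : 0 < ε) :
    ∀ᶠ τ in 𝓝 τ₀, ∀ z, ‖z‖ ≤ R → ‖f τ z - f τ₀ z‖ < ε := by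
  have := (isCompact_closedBall (0 : Z) R).eventually_forall_of_forall_eventually (x₀ := τ₀)
    (P := fun τ z => ‖f τ z - f τ₀ z‖ < ε) fun z _ => by
      have hc : Continuous fun p : T × Z => ‖f p.1 p.2 - f τ₀ p.2‖ :=
        (hf.sub (hf.comp (continuous_const.prodMk continuous_snd))).norm
      have := hc.tendsto (τ₀, z)
      simp only [sub_self, norm_zero] at this
      exact this.eventually_lt_const hε
  filter_upwards [this] with τ hτ z hz using hτ z (by simpa using hz)

lemma tendsto_integral_cutoff {𝕜 : Type*} [RCLike 𝕜] (hF : ContinuousAt F θ₀) {f : Z → 𝕜}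
    (hf : Continuous f) (R : ℝ) :
    Tendsto (fun θ => ∫ z, (cutoff R z : 𝕜) * f z ∂(F θ : Measure Z)) (𝓝 θ₀)
      (𝓝 (∫ z, (cutoff R z : 𝕜) * f z ∂(F θ₀ : Measure Z))) := by
  obtain ⟨C, hC0, hC⟩ := exists_bound_on_ball hf (R + 1)
  exact (ProbabilityMeasure.tendsto_iff_forall_integral_rclike_tendsto 𝕜).1 hF
    (BoundedContinuousFunction.ofNormedAddCommGroup _
      ((RCLike.continuous_ofReal.comp (continuous_cutoff R)).mul hf) C
      (norm_cutoff_smul_le hC0 hC))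

/-- Integrals of a jointly continuous function are jointly continuous in the parameter and in the
law, if there is a uniformly integrable envelope. -/
theorem continuousAt_integral_of_unifIntegrableNear {𝕜 T : Type*} [RCLike 𝕜] [TopologicalSpace T]
    (hF : ContinuousAt F θ₀) (hG : Measurable G) (hUI : UnifIntegrableNear F θ₀ G)
    {f : T → Z → 𝕜} (hf : Continuous (Function.uncurry f)) {τ₀ : T}
    (hfG : ∀ᶠ τ in 𝓝 τ₀, ∀ z, ‖f τ z‖ₑ ≤ G z) :
    Tendsto (fun x : T × Θ => ∫ z, f x.1 z ∂(F x.2 : Measure Z)) (𝓝 (τ₀, θ₀))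
      (𝓝 (∫ z, f τ₀ z ∂(F θ₀ : Measure Z))) := by
  have hfτ : ∀ τ, Continuous (f τ) := fun τ => hf.comp (by fun_prop : Continuous fun z => (τ, z))
  refine Metric.tendsto_nhds.2 fun ε hε => ?_
  obtain ⟨R, hR⟩ := hUI.exists_cutoff hF hG (by positivity : 0 < ε / 5)
  have hfin := hUI.eventually_lintegral_ne_top hG
  have hweak := Metric.tendsto_nhds.1 (tendsto_integral_cutoff hF (hfτ τ₀) R) (ε / 5)
    (by positivity)
  rw [nhds_prod_eq]
  filter_upwards [(hfG.and (eventually_ball_dist_lt hf τ₀ (R + 1) (by positivity : 0 < ε / 5))).prod_mk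
    ((hR.and hfin).and hweak)] with x hx
  obtain ⟨⟨h1, h2⟩, ⟨h3, h4⟩, h5⟩ := hx
  have e1 := norm_integral_sub_cutoff_le (by positivity) (hfτ x.1) h1 h4 h3
  have e4 := norm_integral_sub_cutoff_le (by positivity) (hfτ τ₀) hfG.self_of_nhds
    hfin.self_of_nhds hR.self_of_nhds
  have e2 : ‖∫ z, (cutoff R z : 𝕜) * f x.1 z ∂(F x.2 : Measure Z) -
      ∫ z, (cutoff R z : 𝕜) * f τ₀ z ∂(F x.2 : Measure Z)‖ ≤ ε / 5 := by
    have hi : ∀ τ, Integrable (fun z => (cutoff R z : 𝕜) * f τ z) (F x.2 : Measure Z) := fun τ => by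
      obtain ⟨C, hC0, hC⟩ := exists_bound_on_ball (hfτ τ) (R + 1)
      exact (integrable_const C).mono' ((RCLike.continuous_ofReal.comp
        (continuous_cutoff R)).mul (hfτ τ)).aestronglyMeasurable
        (.of_forall (norm_cutoff_smul_le hC0 hC))
    rw [← integral_sub (hi _) (hi _)]
    have := norm_integral_le_of_norm_le_const (μ := (F x.2 : Measure Z)) (C := ε / 5)
      (f := fun z => (cutoff R z : 𝕜) * f x.1 z - (cutoff R z : 𝕜) * f τ₀ z) (.of_forall fun z => by
        rw [← mul_sub]
        exact norm_cutoff_smul_le (f := fun z => f x.1 z - f τ₀ z) (by positivity)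
          (fun z hz => (h2 z hz).le) z)
    simpa using this
  rw [dist_eq_norm] at h5 ⊢
  -- Four errors of at most `ε / 5`: truncation at the moving pair, change of the parameter, change
  -- of the law, truncation at the limit.
  have hsum : ∫ z, f x.1 z ∂(F x.2 : Measure Z) - ∫ z, f τ₀ z ∂(F θ₀ : Measure Z) =
      (∫ z, f x.1 z ∂(F x.2 : Measure Z) -
        ∫ z, (cutoff R z : 𝕜) * f x.1 z ∂(F x.2 : Measure Z)) +
      (∫ z, (cutoff R z : 𝕜) * f x.1 z ∂(F x.2 : Measure Z) -
        ∫ z, (cutoff R z : 𝕜) * f τ₀ z ∂(F x.2 : Measure Z)) +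
      (∫ z, (cutoff R z : 𝕜) * f τ₀ z ∂(F x.2 : Measure Z) -
        ∫ z, (cutoff R z : 𝕜) * f τ₀ z ∂(F θ₀ : Measure Z)) -
      (∫ z, f τ₀ z ∂(F θ₀ : Measure Z) -
        ∫ z, (cutoff R z : 𝕜) * f τ₀ z ∂(F θ₀ : Measure Z)) := by ring
  rw [hsum]
  refine (norm_sub_le _ _).trans_lt ?_
  refine (add_le_add_left (norm_add₃_le) _).trans_lt ?_
  linarith

end UniformIntegrability

/-! ### Laws of large numbers for samples whose law changes with `N` -/

section LawOfLargeNumbers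

variable {Z : Type*} [MeasurableSpace Z]

lemma variance_sum_sample (P : ProbabilityMeasure Z) (N : ℕ) {φ : Z → ℝ}
    (hφ : MemLp φ 2 (P : Measure Z)) :
    Var[fun z : Fin N → Z => ∑ i, φ (z i); sampleLaw P N] = N * Var[φ; (P : Measure Z)] := by
  have := variance_sum_pi (ι := Fin N) (μ := fun _ => (P : Measure Z)) (X := fun _ => φ)
    fun _ => hφ
  rw [Finset.sum_const, Finset.card_univ, Fintype.card_fin, nsmul_eq_mul] at this
  rw [← this]
  congr 1
  ext z
  simp

lemma integral_sum_sample (P : ProbabilityMeasure Z) (N : ℕ) {φ : Z → ℝ}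
    (hφ : Integrable φ (P : Measure Z)) :
    ∫ z, ∑ i, φ (z i) ∂(sampleLaw P N) = N * ∫ z, φ z ∂(P : Measure Z) := by
  rw [integral_finsetSum _ fun i _ => integrable_comp_eval (μ := fun _ : Fin N => (P : Measure Z)) hφ]
  have : ∀ i : Fin N, ∫ z, φ (z i) ∂(sampleLaw P N) = ∫ z, φ z ∂(P : Measure Z) := fun i =>
    integral_comp_eval (μ := fun _ : Fin N => (P : Measure Z)) hφ.aestronglyMeasurable
  simp [this]

lemma memLp_sum_sample (P : ProbabilityMeasure Z) (N : ℕ) {φ : Z → ℝ}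
    (hφ : MemLp φ 2 (P : Measure Z)) :
    MemLp (fun z : Fin N → Z => ∑ i, φ (z i)) 2 (sampleLaw P N) :=
  memLp_finsetSum _ fun i _ => hφ.comp_measurePreserving (measurePreserving_eval _ i)

/-- Chebyshev's inequality for a sum over an independent sample. -/
lemma measure_sum_sample_ge_le (P : ProbabilityMeasure Z) (N : ℕ) {φ : Z → ℝ}
    (hφ : MemLp φ 2 (P : Measure Z)) {c : ℝ} (hc : 0 < c) :
    sampleLaw P N {z | c ≤ |∑ i, φ (z i) - N * ∫ z, φ z ∂(P : Measure Z)|} ≤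
      ENNReal.ofReal (N * (∫ z, φ z ^ 2 ∂(P : Measure Z)) / c ^ 2) := by
  have h := meas_ge_le_variance_div_sq (memLp_sum_sample P N hφ) hc
  rw [integral_sum_sample P N (hφ.integrable one_le_two), variance_sum_sample P N hφ] at h
  refine h.trans (ENNReal.ofReal_le_ofReal ?_)
  gcongr
  exact variance_le_expectation_sq hφ.1

/-- Chebyshev's bound depends on the law only through the second moment, which is at most `C ^ 2`;
hence the law may vary arbitrarily with `N`. -/
lemma tendsto_measure_average_bounded (P : ℕ → ProbabilityMeasure Z) {φ : Z → ℝ}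
    (hφ : Measurable φ) {C : ℝ} (hC : ∀ z, ‖φ z‖ ≤ C) {ε : ℝ} (hε : 0 < ε) :
    Tendsto (fun N => sampleLaw (P N) N
      {z | N * ε ≤ |∑ i, φ (z i) - N * ∫ z, φ z ∂(P N : Measure Z)|}) atTop (𝓝 0) := by
  have hlim : Tendsto (fun N : ℕ => ENNReal.ofReal (C ^ 2 / ε ^ 2 * ((N : ℝ))⁻¹)) atTop (𝓝 0) := by
    have := (tendsto_inv_atTop_nhds_zero_nat (𝕜 := ℝ)).const_mul (C ^ 2 / ε ^ 2)
    rw [mul_zero] at this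
    simpa using ENNReal.tendsto_ofReal this
  refine tendsto_of_tendsto_of_tendsto_of_le_of_le' tendsto_const_nhds hlim
    (.of_forall fun _ => zero_le) ?_
  filter_upwards [eventually_gt_atTop 0] with N hN
  have hN' : (0 : ℝ) < N := by exact_mod_cast hN
  have hmem : MemLp φ 2 (P N : Measure Z) :=
    MemLp.of_bound hφ.aestronglyMeasurable C (.of_forall hC)
  refine (measure_sum_sample_ge_le (P N) N hmem (by positivity : 0 < N * ε)).trans
    (ENNReal.ofReal_le_ofReal ?_)
  have hsq : ∫ z, φ z ^ 2 ∂(P N : Measure Z) ≤ C ^ 2 := by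
    calc _ ≤ ∫ _, C ^ 2 ∂(P N : Measure Z) := by
          refine integral_mono hmem.integrable_sq (integrable_const _) fun z => ?_
          exact sq_le_sq' (by linarith [(abs_le.1 (hC z)).1]) (abs_le.1 (hC z)).2
      _ = C ^ 2 := by simp
  calc N * (∫ z, φ z ^ 2 ∂(P N : Measure Z)) / (N * ε) ^ 2 ≤ N * C ^ 2 / (N * ε) ^ 2 := by
        gcongr
    _ = C ^ 2 / ε ^ 2 * ((N : ℝ))⁻¹ := by field_simp

/-- Markov's inequality. It controls the truncated-off part of the envelope, which has only a first
moment. -/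
lemma measure_sum_sample_lintegral_le (P : ProbabilityMeasure Z) (N : ℕ) {H : Z → ℝ≥0∞}
    (hH : Measurable H) {c : ℝ≥0∞} (hc : c ≠ 0) (hc' : c ≠ ∞) (hN : N ≠ 0) :
    sampleLaw P N {z | N * c ≤ ∑ i, H (z i)} ≤ (∫⁻ z, H z ∂(P : Measure Z)) / c := by
  have hInt : ∫⁻ z, ∑ i, H (z i) ∂(sampleLaw P N) = N * ∫⁻ z, H z ∂(P : Measure Z) := by
    rw [lintegral_finsetSum (f := fun i (z : Fin N → Z) => H (z i)) _
      fun i _ => hH.comp (measurable_pi_apply i)]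
    have : ∀ i : Fin N, ∫⁻ z, H (z i) ∂(sampleLaw P N) = ∫⁻ z, H z ∂(P : Measure Z) := fun i =>
      (measurePreserving_eval (fun _ : Fin N => (P : Measure Z)) i).lintegral_comp hH
    simp [this]
  have hm : Measurable fun z : Fin N → Z => ∑ i, H (z i) :=
    Finset.measurable_sum _ fun i _ => hH.comp (measurable_pi_apply i)
  have h := meas_ge_le_lintegral_div (μ := sampleLaw P N) hm.aemeasurable (ε := N * c)
    (mul_ne_zero (by exact_mod_cast hN) hc) (ENNReal.mul_ne_top (by simp) hc')
  rwa [hInt, ENNReal.mul_div_mul_left _ _ (by exact_mod_cast hN) (by simp)] at h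

end LawOfLargeNumbers

section UniformLaw

variable {Z : Type*} [NormedAddCommGroup Z] [MeasurableSpace Z] [BorelSpace Z] [ProperSpace Z]
  {Θ : Type*} [TopologicalSpace Θ] {F : Θ → ProbabilityMeasure Z} {θ₀ : Θ} {G : Z → ℝ≥0∞}

/-- The uniform law of large numbers for independent samples from laws `F (θ N)`, where
`θ N → θ₀`. -/
theorem tendsto_measure_uniform_average {T : Type*} [TopologicalSpace T]
    (hF : ContinuousAt F θ₀) (hG : Measurable G) (hUI : UnifIntegrableNear F θ₀ G)
    {f : T → Z → ℝ} (hf : Continuous (Function.uncurry f)) {B : Set T} (hB : IsCompact B)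
    (hfG : ∀ τ ∈ B, ∀ z, ‖f τ z‖ₑ ≤ G z) {θ : ℕ → Θ} (hθ : Tendsto θ atTop (𝓝 θ₀))
    {ε : ℝ} (hε : 0 < ε) :
    Tendsto (fun N => sampleLaw (F (θ N)) N {z | ∃ τ ∈ B,
      ε < |(N : ℝ)⁻¹ * ∑ i, f τ (z i) - ∫ z, f τ z ∂(F θ₀ : Measure Z)|}) atTop (𝓝 0) := by
  have hfτ : ∀ τ, Continuous (f τ) := fun τ => hf.comp (by fun_prop : Continuous fun z => (τ, z))
  refine ENNReal.tendsto_nhds_zero.2 fun δ hδ => ?_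
  obtain ⟨δ', hδ'0, hδ'⟩ : ∃ d : ℝ, 0 < d ∧ ENNReal.ofReal d ≤ δ := by
    rcases eq_or_ne δ ∞ with rfl | hne
    · exact ⟨1, one_pos, le_top⟩
    · exact ⟨δ.toReal, ENNReal.toReal_pos hδ.ne' hne, ENNReal.ofReal_toReal_le⟩
  -- On the good event six errors of size at most `e` add up: truncation of the sample mean, passage
  -- to a net point, fluctuation, change of the law, passage back from the net point, truncation of
  -- the expectation.
  set e : ℝ := ε / 8 with he
  have he0 : 0 < e := by positivity
  -- The bound `e` controls the truncation error of the expectation; `e * (δ' / 2)` makes Markov's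
  -- bound `η / e` at most `δ' / 2`.
  set η : ℝ := min e (e * (δ' / 2)) with hη
  have hη0 : 0 < η := by positivity
  obtain ⟨R, hR⟩ := hUI.exists_cutoff hF hG hη0
  have hfin := hUI.eventually_lintegral_ne_top hG
  obtain ⟨t, htB, hcover⟩ := hB.elim_nhds_subcover
    (fun x => {τ | ∀ z, ‖z‖ ≤ R + 1 → ‖f τ z - f x z‖ < e})
    (fun x _ => eventually_ball_dist_lt hf x (R + 1) he0)
  set φ : T → Z → ℝ := fun τ z => cutoff R z * f τ z with hφ
  have hφc : ∀ τ, Continuous (φ τ) := fun τ => (continuous_cutoff R).mul (hfτ τ)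
  have hφb : ∀ τ, ∃ C, ∀ z, ‖φ τ z‖ ≤ C := fun τ => by
    obtain ⟨C, hC0, hC⟩ := exists_bound_on_ball (hfτ τ) (R + 1)
    exact ⟨C, norm_cutoff_smul_le (𝕜 := ℝ) hC0 hC⟩
  have hφi : ∀ τ (μ : Measure Z) [IsFiniteMeasure μ], Integrable (φ τ) μ := fun τ μ _ => by
    obtain ⟨C, hC⟩ := hφb τ
    exact (integrable_const C).mono' (hφc τ).aestronglyMeasurable (.of_forall hC)
  set H : Z → ℝ≥0∞ := fun z => G z * ENNReal.ofReal (1 - cutoff R z) with hH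
  have hHm : Measurable H := hG.mul
    (ENNReal.continuous_ofReal.comp (continuous_const.sub (continuous_cutoff R))).measurable
  have hE1 : Tendsto (fun N => ∑ x ∈ t, sampleLaw (F (θ N)) N
      {z | N * e ≤ |∑ i, φ x (z i) - N * ∫ z, φ x z ∂(F (θ N) : Measure Z)|}) atTop (𝓝 0) := by
    rw [← Finset.sum_const_zero (s := t)]
    refine tendsto_finsetSum _ fun x _ => ?_
    obtain ⟨C, hC⟩ := hφb x
    exact tendsto_measure_average_bounded (fun N => F (θ N)) (hφc x).measurable hC he0
  have hmean : ∀ᶠ N in atTop, ∀ x ∈ t, |∫ z, φ x z ∂(F (θ N) : Measure Z) -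
      ∫ z, φ x z ∂(F θ₀ : Measure Z)| < e :=
    (eventually_all_finset t).2 fun x _ => by
      simpa [Real.dist_eq] using hθ.eventually
        (Metric.tendsto_nhds.1 (tendsto_integral_cutoff (𝕜 := ℝ) hF (hfτ x) R) e he0)
  filter_upwards [hmean, hθ.eventually hR, eventually_ne_atTop 0,
    ENNReal.tendsto_nhds_zero.1 hE1 (ENNReal.ofReal (δ' / 2)) (ENNReal.ofReal_pos.2 (by positivity))]
    with N hN1 hN2 hN0 hN3
  have hNpos : (0 : ℝ) < N := by exact_mod_cast Nat.pos_of_ne_zero hN0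
  -- Only two kinds of bad event remain: a large sample mean of the envelope beyond the cutoff,
  -- which serves all parameters at once, and a large fluctuation at one of the finitely many net
  -- points.
  have hsub : {z : Fin N → Z | ∃ τ ∈ B,
      ε < |(N : ℝ)⁻¹ * ∑ i, f τ (z i) - ∫ z, f τ z ∂(F θ₀ : Measure Z)|} ⊆
      {z | N * ENNReal.ofReal e ≤ ∑ i, H (z i)} ∪
      ⋃ x ∈ t, {z | N * e ≤ |∑ i, φ x (z i) - N * ∫ z, φ x z ∂(F (θ N) : Measure Z)|} := by
    rintro z ⟨τ, hτ, hlt⟩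
    by_contra hcon
    simp only [Set.mem_union, Set.mem_ofPred_eq, Set.mem_iUnion, not_or, not_exists, not_le] at hcon
    obtain ⟨hc1, hc2⟩ := hcon
    obtain ⟨x, hxt, hxτ⟩ := Set.mem_iUnion₂.1 (hcover hτ)
    have b1 : |∑ i, f τ (z i) - ∑ i, φ τ (z i)| ≤ N * e := by
      rw [← ENNReal.ofReal_le_ofReal_iff (by positivity), ENNReal.ofReal_mul hNpos.le,
        ENNReal.ofReal_natCast, ← Finset.sum_sub_distrib, ← Real.norm_eq_abs, ofReal_norm]
      refine ((enorm_sum_le _ _).trans (Finset.sum_le_sum fun i _ => ?_)).trans hc1.le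
      rw [show f τ (z i) - φ τ (z i) = f τ (z i) * (1 - cutoff R (z i)) by simp only [hφ]; ring,
        enorm_mul, ← ofReal_norm (1 - cutoff R (z i)), Real.norm_of_nonneg
        (by linarith [cutoff_le_one R (z i)])]
      exact mul_le_mul_left (hfG τ hτ (z i)) _
    have hclose : ∀ y, |φ τ y - φ x y| ≤ e := fun y => by
      have := norm_cutoff_smul_le (𝕜 := ℝ) (f := fun y => f τ y - f x y) he0.le
        (fun y hy => (hxτ y hy).le) y
      simpa [hφ, mul_sub] using this
    have b2 : |∑ i, φ τ (z i) - ∑ i, φ x (z i)| ≤ N * e := by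
      rw [← Finset.sum_sub_distrib]
      refine (Finset.abs_sum_le_sum_abs _ _).trans ((Finset.sum_le_sum fun i _ =>
        hclose (z i)).trans ?_)
      simp
    have b3 := hc2 x hxt
    have b4 := hN1 x hxt
    have b5 : |∫ z, φ x z ∂(F θ₀ : Measure Z) - ∫ z, φ τ z ∂(F θ₀ : Measure Z)| ≤ e := by
      rw [← integral_sub (hφi _ _) (hφi _ _)]
      have := norm_integral_le_of_norm_le_const (μ := (F θ₀ : Measure Z)) (C := e)
        (f := fun z => φ x z - φ τ z) (.of_forall fun y => by
          rw [norm_sub_rev]; exact hclose y)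
      simpa using this
    have b6 : |∫ z, f τ z ∂(F θ₀ : Measure Z) - ∫ z, φ τ z ∂(F θ₀ : Measure Z)| ≤ e :=
      (norm_integral_sub_cutoff_le (𝕜 := ℝ) hη0.le (hfτ τ) (hfG τ hτ) hfin.self_of_nhds
        hR.self_of_nhds).trans (min_le_left _ _)
    have b7 : |∑ i, f τ (z i) - N * ∫ z, φ x z ∂(F (θ N) : Measure Z)| ≤ N * (3 * e) := by
      rw [abs_le] at b1 b2 ⊢
      rw [abs_lt] at b3
      constructor <;> linarith
    have b8 : |(N : ℝ)⁻¹ * ∑ i, f τ (z i) - ∫ z, φ x z ∂(F (θ N) : Measure Z)| ≤ 3 * e := by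
      rw [show (N : ℝ)⁻¹ * ∑ i, f τ (z i) - ∫ z, φ x z ∂(F (θ N) : Measure Z) =
        (N : ℝ)⁻¹ * (∑ i, f τ (z i) - N * ∫ z, φ x z ∂(F (θ N) : Measure Z)) by field_simp,
        abs_mul, abs_of_pos (by positivity), inv_mul_le_iff₀ hNpos]
      exact b7
    rw [abs_le] at b5 b6 b8
    rw [abs_lt] at b4
    refine absurd hlt (not_lt.2 (abs_le.2 ⟨?_, ?_⟩)) <;> linarith
  calc _ ≤ _ := measure_mono hsub
    _ ≤ _ := measure_union_le _ _
    _ ≤ ENNReal.ofReal (δ' / 2) + ENNReal.ofReal (δ' / 2) := by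
        refine add_le_add ?_ ((measure_biUnion_finset_le _ _).trans hN3)
        refine (measure_sum_sample_lintegral_le (F (θ N)) N hHm (ENNReal.ofReal_pos.2 he0).ne'
          ENNReal.ofReal_ne_top hN0).trans ?_
        refine ENNReal.div_le_of_le_mul (hN2.trans ?_)
        rw [mul_comm, ← ENNReal.ofReal_mul he0.le]
        exact ENNReal.ofReal_le_ofReal (min_le_right _ _)
    _ ≤ δ := by
        rw [← ENNReal.ofReal_add (by positivity) (by positivity), add_halves]
        exact hδ'

end UniformLaw

/-! ### Smoothness of the extended scores and measurability of their envelopes -/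

section Regularity

variable {n q s : ℕ} (S : Spec n s)

/-- The weights of the residuals in the extended score. -/
def scoreWeight (β : Fin q → ℝ) (x : Fin n → Fin q → ℝ) (a : Fin s × Fin q) (t : Fin n) : ℝ :=
  (∑ r, deriv S.h (x r ⬝ᵥ β) * x r a.2 * (√(S.φ * S.v (x r ⬝ᵥ β)))⁻¹ * S.M a.1 r t) *
    (√(S.φ * S.v (x t ⬝ᵥ β)))⁻¹

variable {S}

lemma jacobian_meanVec (hh : Differentiable ℝ S.h) (x : Fin n → Fin q → ℝ) (β : Fin q → ℝ)
    (t : Fin n) (k : Fin q) :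
    jacobian (meanVec S x) β t k = deriv S.h (x t ⬝ᵥ β) * x t k := by
  have hlin : ∀ t, HasFDerivAt (fun b : Fin q → ℝ => x t ⬝ᵥ b)
      ((dotProductBilin ℝ ℝ (x t)).toContinuousLinearMap) β := fun t =>
    ((dotProductBilin ℝ ℝ (x t)).toContinuousLinearMap).hasFDerivAt
  have h : HasFDerivAt (meanVec S x) (ContinuousLinearMap.pi fun t =>
      deriv S.h (x t ⬝ᵥ β) • (dotProductBilin ℝ ℝ (x t)).toContinuousLinearMap) β :=
    hasFDerivAt_pi.2 fun t => (hh (x t ⬝ᵥ β)).hasDerivAt.comp_hasFDerivAt β (hlin t)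
  simp [jacobian, h.fderiv]

lemma score_apply (hh : Differentiable ℝ S.h) (β : Fin q → ℝ) (z : Subject n q)
    (a : Fin s × Fin q) :
    score S β z a = ∑ t, scoreWeight S β z.2 a t * (z.1 t - S.h (z.2 t ⬝ᵥ β)) := by
  simp only [score, Matrix.mulVec, dotProduct, Pi.sub_apply, meanVec]
  refine Finset.sum_congr rfl fun t _ => ?_
  congr 1
  rw [invSqrtA, Matrix.mul_diagonal, scoreWeight, Matrix.mul_apply]
  congr 1
  refine Finset.sum_congr rfl fun r _ => ?_
  rw [Matrix.mul_diagonal, Matrix.transpose_apply, jacobian_meanVec hh]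

/-- Regularity of the inverse link and of the variance function. -/
structure Spec.Regular (S : Spec n s) : Prop where
  contDiff_h : ContDiff ℝ 2 S.h
  contDiff_v : ContDiff ℝ 1 S.v
  v_pos : ∀ u, 0 < S.v u
  φ_pos : 0 < S.φ

lemma Spec.Regular.differentiable_h (hS : S.Regular) : Differentiable ℝ S.h :=
  hS.contDiff_h.differentiable two_ne_zero

/-- One derivative of `h` is spent on `∇h`, which leaves `C¹`; positivity of `φ v` keeps the square
root smooth and invertible. -/
lemma contDiff_scoreWeight (hS : S.Regular) (a : Fin s × Fin q) (t : Fin n) :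
    ContDiff ℝ 1 fun p : (Fin q → ℝ) × (Fin n → Fin q → ℝ) => scoreWeight S p.1 p.2 a t := by
  have hlin : ∀ r, ContDiff ℝ 1 fun p : (Fin q → ℝ) × (Fin n → Fin q → ℝ) => p.2 r ⬝ᵥ p.1 := by
    intro r
    unfold dotProduct
    fun_prop
  have hd : ContDiff ℝ 1 (deriv S.h) :=
    (contDiff_succ_iff_deriv (n := 1) |>.1 (by rw [one_add_one_eq_two]; exact hS.contDiff_h)).2.2
  have hw : ContDiff ℝ 1 fun u => (√(S.φ * S.v u))⁻¹ := by
    have hpos : ∀ u, S.φ * S.v u ≠ 0 := fun u => (mul_pos hS.φ_pos (hS.v_pos u)).ne'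
    refine ((contDiff_const.mul hS.contDiff_v).sqrt hpos).inv fun u => ?_
    exact (Real.sqrt_pos.2 (mul_pos hS.φ_pos (hS.v_pos u))).ne'
  unfold scoreWeight
  refine ContDiff.mul (ContDiff.sum fun r _ => ?_) (hw.comp (hlin t))
  refine (((hd.comp (hlin r)).mul ?_).mul (hw.comp (hlin r))).mul contDiff_const
  fun_prop

lemma contDiff_score (hS : S.Regular) :
    ContDiff ℝ 1 fun p : (Fin q → ℝ) × Subject n q => score S p.1 p.2 := by
  refine contDiff_pi.2 fun a => ?_
  simp only [score_apply hS.differentiable_h]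
  refine ContDiff.sum fun t _ => ?_
  have hlin : ContDiff ℝ 1 fun p : (Fin q → ℝ) × Subject n q => p.2.2 t ⬝ᵥ p.1 := by
    unfold dotProduct
    fun_prop
  have hpair : ContDiff ℝ 1 fun p : (Fin q → ℝ) × Subject n q => (p.1, p.2.2) := by fun_prop
  have hw := (contDiff_scoreWeight hS a t).comp hpair
  have hy : ContDiff ℝ 1 fun p : (Fin q → ℝ) × Subject n q => p.2.1 t := by fun_prop
  have hm := (hS.contDiff_h.of_le one_le_two).comp hlin
  have := hw.mul (hy.sub hm)
  exact this

lemma continuous_score (hS : S.Regular) :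
    Continuous fun p : (Fin q → ℝ) × Subject n q => score S p.1 p.2 :=
  (contDiff_score hS).continuous

lemma continuous_score_right (hS : S.Regular) (β : Fin q → ℝ) :
    Continuous fun z : Subject n q => score S β z := by
  have := (continuous_score (n := n) (q := q) hS).comp (Continuous.prodMk_right β)
  exact this

lemma differentiable_score (hS : S.Regular) (z : Subject n q) :
    Differentiable ℝ fun β => score S β z := by
  have hz : ContDiff ℝ 1 fun β : Fin q → ℝ => (β, z) := by fun_prop
  have := (contDiff_score hS).comp hz
  exact this.differentiable one_ne_zero

lemma continuous_fderiv_score (hS : S.Regular) : Continuous fun p : (Fin q → ℝ) × Subject n q =>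
    fderiv ℝ (fun b => score S b p.2) p.1 := by
  have hswap : ContDiff ℝ 1 fun r : ((Fin q → ℝ) × Subject n q) × (Fin q → ℝ) =>
      (r.2, r.1.2) := by fun_prop
  have hsc := (contDiff_score hS).comp hswap
  have hfst : ContDiff ℝ 0 fun p : (Fin q → ℝ) × Subject n q => p.1 := contDiff_fst
  have := ContDiff.fderiv (𝕜 := ℝ) (n := 0) (m := 1)
    (f := fun (p : (Fin q → ℝ) × Subject n q) b => score S b p.2) (g := fun p => p.1)
    hsc hfst (by simp)
  exact this.continuous

lemma continuous_jacobian_score (hS : S.Regular) (a : Fin s × Fin q) (k : Fin q) :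
    Continuous fun p : (Fin q → ℝ) × Subject n q => jacobian (fun b => score S b p.2) p.1 a k := by
  have h := (continuous_fderiv_score (n := n) (q := q) hS).clm_apply
    (continuous_const (y := (Pi.single k 1 : Fin q → ℝ)))
  have := (continuous_apply a).comp h
  exact this

/-- The supremum runs over a possibly uncountable set, but a supremum of continuous functions is
lower semicontinuous, hence measurable. -/
lemma measurable_biSup_enorm_score (hS : S.Regular) (B : Set (Fin q → ℝ)) :
    Measurable fun z : Subject n q => ⨆ β ∈ B, ‖score S β z‖ₑ ^ 2 := by
  have hc : ∀ β ∈ B, LowerSemicontinuous fun z : Subject n q => ‖score S β z‖ₑ ^ 2 :=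
    fun β _ => by
      have := (ENNReal.continuous_pow 2).comp (continuous_score_right (n := n) hS β).enorm
      exact this.lowerSemicontinuous
  have := lowerSemicontinuous_biSup hc
  exact this.measurable

lemma measurable_biSup_enorm_fderiv_score (hS : S.Regular) (B : Set (Fin q → ℝ)) :
    Measurable fun z : Subject n q => ⨆ β ∈ B, ‖fderiv ℝ (fun b => score S b z) β‖ₑ := by
  have hc : ∀ β ∈ B, LowerSemicontinuous fun z : Subject n q =>
      ‖fderiv ℝ (fun b => score S b z) β‖ₑ := fun β _ => by
    have := (continuous_fderiv_score (n := n) (q := q) hS).comp (Continuous.prodMk_right β)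
    exact this.enorm.lowerSemicontinuous
  have := lowerSemicontinuous_biSup hc
  exact this.measurable

end Regularity

/-! ### Unbiasedness of the score in the marginal mean model -/

section Unbiased

lemma integral_mul_sub_condExp_eq_zero {Ω : Type*} {m mΩ : MeasurableSpace Ω} {P : Measure Ω}
    [IsFiniteMeasure P] (hm : m ≤ mΩ) {Y g u : Ω → ℝ} (hY : Integrable Y P) (hg : P[Y|m] =ᵐ[P] g)
    (hu : StronglyMeasurable[m] u) {C : ℝ} (hC : ∀ ω, ‖u ω‖ ≤ C) :
    Integrable (fun ω => u ω * (Y ω - g ω)) P ∧ ∫ ω, u ω * (Y ω - g ω) ∂P = 0 := by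
  have hgi : Integrable g P := integrable_condExp.congr hg
  have hus : AEStronglyMeasurable u P := (hu.mono hm).aestronglyMeasurable
  have h1 : Integrable (u * Y) P := hY.bdd_mul hus (.of_forall hC)
  have h2 : Integrable (u * g) P := hgi.bdd_mul hus (.of_forall hC)
  have h3 : ∫ ω, (u * Y) ω ∂P = ∫ ω, (u * g) ω ∂P := by
    rw [← integral_condExp hm]
    refine integral_congr_ae ((condExp_mul_of_stronglyMeasurable_left hu h1 hY).trans ?_)
    filter_upwards [hg] with ω hω
    simp [hω]
  simp only [mul_sub]
  refine ⟨h1.sub h2, ?_⟩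
  exact (integral_sub h1 h2).trans (sub_eq_zero.2 h3)

variable {n q s : ℕ} {S : Spec n s}

/-- In the marginal mean model the extended score is unbiased. -/
lemma integral_score_eq_zero (hS : S.Regular) {P : Measure (Subject n q)} [IsFiniteMeasure P]
    {θ : Fin q → ℝ} (hP : MeanModel S P θ) (a : Fin s × Fin q)
    (hInt : Integrable (fun z => score S θ z a) P) : ∫ z, score S θ z a ∂P = 0 := by
  set W : Fin n → (Fin n → Fin q → ℝ) → ℝ := fun t x => scoreWeight S θ x a t with hW
  have hWm : ∀ t, Measurable (W t) := fun t =>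
    ((contDiff_scoreWeight hS a t).continuous.comp
      (Continuous.prodMk_right θ)).measurable
  -- The weights are unbounded and `Y` is merely integrable, so conditioning cannot be applied term
  -- by term. Restriction to this event, which depends on the covariates only, makes the weights
  -- bounded; dominated convergence with the integrable score removes it.
  set A : ℕ → Set (Fin n → Fin q → ℝ) := fun k => {x | ∀ t, |W t x| ≤ k} with hA
  have hAm : ∀ k, MeasurableSet (A k) := fun k => by
    simp only [hA, Set.ofPred_forall]
    exact MeasurableSet.iInter fun t => measurableSet_le (hWm t).abs measurable_const
  have hscore : ∀ z, score S θ z a = ∑ t, W t z.2 * (z.1 t - S.h (z.2 t ⬝ᵥ θ)) := fun z =>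
    score_apply hS.differentiable_h θ z a
  have hzero : ∀ k, ∫ z, (A k).indicator (fun _ => (1 : ℝ)) z.2 * score S θ z a ∂P = 0 := by
    intro k
    have hterm : ∀ t, Integrable (fun z : Subject n q => ((A k).indicator (W t) z.2) *
        (z.1 t - S.h (z.2 t ⬝ᵥ θ))) P ∧ ∫ z : Subject n q, ((A k).indicator (W t) z.2) *
        (z.1 t - S.h (z.2 t ⬝ᵥ θ)) ∂P = 0 := fun t => by
      refine integral_mul_sub_condExp_eq_zero (m := MeasurableSpace.comap Prod.snd inferInstance)
        measurable_snd.comap_le (hP t).1 (hP t).2 (C := k) ?_ fun z => ?_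
      · exact (((hWm t).indicator (hAm k)).comp (comap_measurable _)).stronglyMeasurable
      · by_cases hz : z.2 ∈ A k
        · rw [Set.indicator_of_mem hz]
          exact hz t
        · rw [Set.indicator_of_notMem hz]
          simp
    have : ∀ z : Subject n q, (A k).indicator (fun _ => (1 : ℝ)) z.2 * score S θ z a =
        ∑ t, ((A k).indicator (W t) z.2) * (z.1 t - S.h (z.2 t ⬝ᵥ θ)) := fun z => by
      rw [hscore, Finset.mul_sum]
      refine Finset.sum_congr rfl fun t _ => ?_
      by_cases hz : z.2 ∈ A k <;> simp [hz]
    simp only [this]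
    rw [integral_finsetSum _ fun t _ => (hterm t).1]
    exact Finset.sum_eq_zero fun t _ => (hterm t).2
  have hlim := tendsto_integral_of_dominated_convergence (μ := P)
    (F := fun (k : ℕ) (z : Subject n q) => (A k).indicator (fun _ => (1 : ℝ)) z.2 * score S θ z a)
    (f := fun z => score S θ z a) (fun z => ‖score S θ z a‖)
    (fun k => ((measurable_const.indicator (hAm k)).comp
      measurable_snd).aestronglyMeasurable.mul hInt.1) hInt.norm
    (fun k => .of_forall fun z => ?_) (.of_forall fun z => ?_)
  · simp only [hzero] at hlim
    exact (tendsto_nhds_unique hlim tendsto_const_nhds)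
  · by_cases hz : z.2 ∈ A k <;> simp [hz]
  · refine tendsto_const_nhds.congr' ?_
    filter_upwards [eventually_ge_atTop ⌈∑ t, |W t z.2|⌉₊] with k hk
    have hz : z.2 ∈ A k := fun t => by
      calc |W t z.2| ≤ ∑ t, |W t z.2| :=
            Finset.single_le_sum (f := fun t => |W t z.2|) (fun _ _ => abs_nonneg _)
              (Finset.mem_univ t)
        _ ≤ ⌈∑ t, |W t z.2|⌉₊ := Nat.le_ceil _
        _ ≤ k := by exact_mod_cast hk
    simp [hz]

end Unbiased

/-! ### Characteristic functions and the central limit theorem for triangular arrays -/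

section ExpRemainder

open Complex in
/-- The function `(1 + i y - exp (i y)) / y²`, extended by continuity. -/
def expRemainder (y : ℝ) : ℂ := if y = 0 then 1 / 2 else (1 + y * I - exp (y * I)) / (y : ℂ) ^ 2

/-- An exact second-order expansion whose remainder factor is bounded and continuous, so that second
moments suffice. -/
lemma exp_mul_I_eq (y : ℝ) :
    Complex.exp (y * Complex.I) = 1 + y * Complex.I - (y : ℂ) ^ 2 * expRemainder y := by
  rcases eq_or_ne y 0 with rfl | hy
  · simp
  · have : (y : ℂ) ≠ 0 := by exact_mod_cast hy
    rw [expRemainder, if_neg hy]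
    field_simp
    ring

lemma norm_expRemainder_sub_le {y : ℝ} (hy : |y| ≤ 1) : ‖expRemainder y - 1 / 2‖ ≤ |y| := by
  rcases eq_or_ne y 0 with rfl | h0
  · simp [expRemainder]
  have hyC : (y : ℂ) ≠ 0 := by exact_mod_cast h0
  have hn : ‖(y : ℂ) * Complex.I‖ = |y| := by simp
  have hb := Complex.exp_bound (x := y * Complex.I) (by rw [hn]; exact hy) (n := 3) (by norm_num)
  rw [hn] at hb
  have heq : expRemainder y - 1 / 2 =
      -(Complex.exp (y * Complex.I) - ∑ m ∈ Finset.range 3, (y * Complex.I) ^ m / (m.factorial : ℂ)) /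
        (y : ℂ) ^ 2 := by
    rw [expRemainder, if_neg h0]
    simp only [Finset.sum_range_succ, Finset.sum_range_zero]
    simp only [Nat.factorial, mul_pow, Complex.I_sq]
    field_simp
    push_cast
    ring
  rw [heq, norm_div, norm_neg, norm_pow, Complex.norm_real, Real.norm_eq_abs,
    div_le_iff₀ (by positivity)]
  refine hb.trans ?_
  have h3 : |y| * |y| ^ 2 = |y| ^ 3 := by ring
  rw [h3]
  refine mul_le_of_le_one_right (by positivity) ?_
  norm_num [Nat.factorial]

lemma norm_expRemainder_le (y : ℝ) : ‖expRemainder y‖ ≤ 3 := by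
  rcases le_total |y| 1 with hy | hy
  · have h1 := norm_expRemainder_sub_le hy
    have h2 : ‖expRemainder y‖ ≤ ‖expRemainder y - 1 / 2‖ + ‖(1 / 2 : ℂ)‖ := by
      simpa using norm_add_le (expRemainder y - 1 / 2) (1 / 2)
    have h3 : ‖(1 / 2 : ℂ)‖ = 1 / 2 := by norm_num
    linarith
  · have h0 : y ≠ 0 := fun h => by rw [h, abs_zero] at hy; linarith
    rw [expRemainder, if_neg h0, norm_div, norm_pow, Complex.norm_real, Real.norm_eq_abs,
      div_le_iff₀ (by positivity)]
    have h1 : ‖1 + (y : ℂ) * Complex.I - Complex.exp (y * Complex.I)‖ ≤ 1 + |y| + 1 := by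
      refine (norm_sub_le _ _).trans (add_le_add ((norm_add_le _ _).trans ?_) ?_)
      · simp
      · rw [Complex.norm_exp_ofReal_mul_I]
    nlinarith

lemma continuous_expRemainder : Continuous expRemainder := by
  refine continuous_iff_continuousAt.2 fun y => ?_
  rcases eq_or_ne y 0 with rfl | hy
  · have h0 : expRemainder 0 = 1 / 2 := by simp [expRemainder]
    rw [ContinuousAt, h0, tendsto_iff_norm_sub_tendsto_zero]
    refine squeeze_zero' (.of_forall fun _ => norm_nonneg _) ?_
      (by simpa using (continuous_abs (G := ℝ)).tendsto 0 : Tendsto (fun y : ℝ => |y|) (𝓝 0) (𝓝 0))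
    filter_upwards [Metric.ball_mem_nhds (0 : ℝ) one_pos] with x hx
    exact norm_expRemainder_sub_le (by simpa using (mem_ball_zero_iff.1 hx).le)
  · have : ContinuousAt (fun y : ℝ => (1 + y * Complex.I - Complex.exp (y * Complex.I)) /
        (y : ℂ) ^ 2) y := by
      refine ContinuousAt.div (by fun_prop) (by fun_prop) ?_
      exact pow_ne_zero 2 (by exact_mod_cast hy)
    refine this.congr ?_
    filter_upwards [isOpen_ne.mem_nhds hy] with x hx
    rw [expRemainder, if_neg hx]

end ExpRemainder

lemma UnifIntegrableNear.const_mul_one_add {Θ Z : Type*} [TopologicalSpace Θ] [MeasurableSpace Z]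
    {F : Θ → ProbabilityMeasure Z} {θ₀ : Θ} {G : Z → ℝ≥0∞} (h : UnifIntegrableNear F θ₀ G)
    (hG : Measurable G) {c : ℝ≥0} (hc : c ≠ 0) : UnifIntegrableNear F θ₀ fun z => c * (1 + G z) := by
  intro ε hε
  have hc' : (c : ℝ≥0∞) ≠ 0 := by exact_mod_cast hc
  obtain ⟨K, hK⟩ := h (ε / (2 * c)) (ENNReal.div_pos hε.ne'
    (ENNReal.mul_ne_top (by simp) ENNReal.coe_ne_top))
  -- Above this threshold `G > max K 1 ≥ 1`, so that `c * (1 + G) ≤ 2 * c * G`.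
  refine ⟨c * (1 + max K 1), hK.mono fun θ hθ => ?_⟩
  have hsub : {z | ((c * (1 + max K 1) : ℝ≥0) : ℝ≥0∞) < c * (1 + G z)} ⊆
      {z | ((max K 1 : ℝ≥0) : ℝ≥0∞) < G z} := by
    intro z hz
    simp only [Set.mem_ofPred_eq] at hz ⊢
    by_contra hcon
    refine absurd hz (not_lt.2 ?_)
    push_cast at hcon ⊢
    gcongr
    exact not_lt.1 hcon
  calc ∫⁻ z in {z | ((c * (1 + max K 1) : ℝ≥0) : ℝ≥0∞) < c * (1 + G z)}, c * (1 + G z) ∂(F θ : Measure Z)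
      ≤ ∫⁻ z in {z | ((max K 1 : ℝ≥0) : ℝ≥0∞) < G z}, c * (1 + G z) ∂(F θ : Measure Z) :=
        lintegral_mono_set hsub
    _ ≤ ∫⁻ z in {z | ((max K 1 : ℝ≥0) : ℝ≥0∞) < G z}, (2 * c) * G z ∂(F θ : Measure Z) := by
        refine setLIntegral_mono' (measurableSet_lt measurable_const hG) fun z hz => ?_
        have h1 : (1 : ℝ≥0∞) ≤ G z := by
          refine le_trans ?_ (le_of_lt hz)
          exact_mod_cast le_max_right K 1
        calc (c : ℝ≥0∞) * (1 + G z) ≤ c * (G z + G z) := by gcongr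
          _ = 2 * c * G z := by ring
    _ = (2 * c) * ∫⁻ z in {z | ((max K 1 : ℝ≥0) : ℝ≥0∞) < G z}, G z ∂(F θ : Measure Z) :=
        lintegral_const_mul' _ _ (ENNReal.mul_ne_top (by simp) ENNReal.coe_ne_top)
    _ ≤ (2 * c) * ∫⁻ z in {z | (K : ℝ≥0∞) < G z}, G z ∂(F θ : Measure Z) := by
        gcongr
        exact le_max_left _ _
    _ ≤ (2 * c) * (ε / (2 * c)) := by gcongr
    _ ≤ ε := ENNReal.mul_div_le

section CentralLimit

variable {Z : Type*} [NormedAddCommGroup Z] [MeasurableSpace Z] [BorelSpace Z] [ProperSpace Z]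
  {Θ T : Type*} [TopologicalSpace Θ] [TopologicalSpace T] {F : Θ → ProbabilityMeasure Z} {θ₀ : Θ}
  {G : Z → ℝ≥0∞}

lemma enorm_le_one_add_sq (x : ℝ) : ‖x‖ₑ ≤ 1 + ‖x‖ₑ ^ 2 := by
  rcases le_total ‖x‖ₑ 1 with h | h
  · exact le_add_right h
  · refine le_add_left ?_
    calc ‖x‖ₑ = ‖x‖ₑ * 1 := (mul_one _).symm
      _ ≤ ‖x‖ₑ * ‖x‖ₑ := by gcongr
      _ = ‖x‖ₑ ^ 2 := (sq _).symm

lemma tendsto_inv_sqrt_natCast : Tendsto (fun N : ℕ => (√(N : ℝ))⁻¹) atTop (𝓝 0) := by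
  have := (Real.tendsto_sqrt_atTop.comp (tendsto_natCast_atTop_atTop (R := ℝ))).inv_tendsto_atTop
  exact this

/-- Characteristic functions of standardized sums of a triangular array. -/
lemma tendsto_integral_exp_pow (hF : ContinuousAt F θ₀) (hG : Measurable G)
    (hUI : UnifIntegrableNear F θ₀ G) {y : T → Z → ℝ} (hy : Continuous (Function.uncurry y))
    {τ₀ : T} (hyG : ∀ᶠ τ in 𝓝 τ₀, ∀ z, ‖y τ z‖ₑ ^ 2 ≤ G z) {θ : ℕ → Θ}
    (hθ : Tendsto θ atTop (𝓝 θ₀)) {τ : ℕ → T} (hτ : Tendsto τ atTop (𝓝 τ₀))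
    (hmean : ∀ᶠ N in atTop, ∫ z, y (τ N) z ∂(F (θ N) : Measure Z) = 0) :
    Tendsto (fun N : ℕ => (∫ z, Complex.exp (((√(N : ℝ))⁻¹ * y (τ N) z : ℝ) * Complex.I)
      ∂(F (θ N) : Measure Z)) ^ N) atTop
      (𝓝 (Complex.exp (-(∫ z, y τ₀ z ^ 2 ∂(F θ₀ : Measure Z) : ℝ) / 2))) := by
  -- The factor `3` is the bound from `norm_expRemainder_le`.
  set G' : Z → ℝ≥0∞ := fun z => (3 : ℝ≥0) * (1 + G z) with hG'
  have hUI' : UnifIntegrableNear F θ₀ G' := hUI.const_mul_one_add hG three_ne_zero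
  have hG'm : Measurable G' := measurable_const.mul (measurable_const.add hG)
  have hGG' : ∀ z, 1 + G z ≤ G' z := fun z => by
    calc 1 + G z = 1 * (1 + G z) := (one_mul _).symm
      _ ≤ (3 : ℝ≥0) * (1 + G z) := by gcongr; norm_num
  -- The scale `N^{-1/2}` is treated as a further parameter tending to `0`. Joint continuity of
  -- integrals at `(τ₀, 0)` then gives the limit of the second-order term; uniform integrability
  -- takes the place of a Lindeberg condition.
  set k : T × ℝ → Z → ℂ := fun p z => ((y p.1 z : ℝ) : ℂ) ^ 2 * expRemainder (p.2 * y p.1 z) with hk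
  have hkc : Continuous (Function.uncurry k) := by
    have h0 : Continuous fun p : (T × ℝ) × Z => (p.1.1, p.2) := by fun_prop
    have h0' : Continuous fun p : (T × ℝ) × Z => p.1.2 := by fun_prop
    have h1 := hy.comp h0
    have h2 := continuous_expRemainder.comp (h0'.mul h1)
    have h3 := ((Complex.continuous_ofReal.comp h1).pow 2).mul h2
    exact h3
  have hkG : ∀ᶠ p in 𝓝 (τ₀, (0 : ℝ)), ∀ z, ‖k p z‖ₑ ≤ G' z := by
    have := (continuous_fst (X := T) (Y := ℝ)).tendsto (τ₀, (0 : ℝ))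
    filter_upwards [this.eventually hyG] with p hp z
    have h3 : ‖expRemainder (p.2 * y p.1 z)‖ₑ ≤ (3 : ℝ≥0) :=
      enorm_le_coe.2 (norm_expRemainder_le _)
    have h4 : ‖((y p.1 z : ℝ) : ℂ)‖ₑ = ‖y p.1 z‖ₑ := by
      rw [← ofReal_norm, Complex.norm_real, ofReal_norm]
    calc ‖k p z‖ₑ = ‖y p.1 z‖ₑ ^ 2 * ‖expRemainder (p.2 * y p.1 z)‖ₑ := by
          rw [hk, enorm_mul, enorm_pow, h4]
      _ ≤ (1 + G z) * (3 : ℝ≥0) := by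
          gcongr
          exact (hp z).trans le_add_self
      _ = G' z := mul_comm _ _
  have hr := tendsto_inv_sqrt_natCast
  have hlim : Tendsto (fun N : ℕ => ∫ z, k (τ N, (√(N : ℝ))⁻¹) z ∂(F (θ N) : Measure Z)) atTop
      (𝓝 (∫ z, k (τ₀, 0) z ∂(F θ₀ : Measure Z))) := by
    have h1 := continuousAt_integral_of_unifIntegrableNear hF hG'm hUI' hkc hkG
    have h2 := (hτ.prodMk_nhds hr).prodMk_nhds hθ
    have h3 := h1.comp h2
    exact h3
  have hlim0 : ∫ z, k (τ₀, 0) z ∂(F θ₀ : Measure Z) =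
      ((∫ z, y τ₀ z ^ 2 ∂(F θ₀ : Measure Z) : ℝ) : ℂ) / 2 := by
    have h0 : expRemainder 0 = 1 / 2 := by simp [expRemainder]
    simp only [hk, zero_mul, h0]
    rw [integral_mul_const, ← integral_complex_ofReal]
    push_cast
    ring
  rw [hlim0] at hlim
  -- The mean is zero, so one summand has characteristic function `1 - N⁻¹ ∫ k`, and `(1 + t_N /
  -- N)^N → exp t` when `t_N → t`.
  have hpow := Complex.tendsto_one_add_pow_exp_of_tendsto
    (g := fun N : ℕ => -((N : ℂ))⁻¹ * ∫ z, k (τ N, (√(N : ℝ))⁻¹) z ∂(F (θ N) : Measure Z))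
    (t := -((∫ z, y τ₀ z ^ 2 ∂(F θ₀ : Measure Z) : ℝ) : ℂ) / 2) (by
      rw [neg_div]
      refine hlim.neg.congr' ?_
      filter_upwards [eventually_ne_atTop 0] with N hN
      have : (N : ℂ) ≠ 0 := by exact_mod_cast hN
      field_simp)
  refine hpow.congr' ?_
  filter_upwards [eventually_ne_atTop 0, hmean, hτ.eventually hyG,
    hθ.eventually (hUI'.eventually_lintegral_ne_top hG'm),
    (hτ.prodMk_nhds hr).eventually hkG] with N hN h0 hyN hfin hkN
  congr 1
  have hyc : Continuous (y (τ N)) := hy.comp (by fun_prop : Continuous fun z => (τ N, z))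
  have hyi : Integrable (y (τ N)) (F (θ N) : Measure Z) :=
    integrable_of_enorm_le hyc (fun z => (enorm_le_one_add_sq _).trans
      ((add_le_add_right (hyN z) 1).trans (hGG' z))) hfin
  have hkcN := hkc.comp (Continuous.prodMk_right (τ N, (√(N : ℝ))⁻¹))
  have hki : Integrable (k (τ N, (√(N : ℝ))⁻¹)) (F (θ N) : Measure Z) :=
    integrable_of_enorm_le hkcN hkN hfin
  have hsq : (((√(N : ℝ))⁻¹ : ℝ) : ℂ) ^ 2 = ((N : ℂ))⁻¹ := by
    rw [← Complex.ofReal_pow, inv_pow, Real.sq_sqrt (Nat.cast_nonneg N)]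
    push_cast
    rfl
  have hexp : ∀ z, Complex.exp (((√(N : ℝ))⁻¹ * y (τ N) z : ℝ) * Complex.I) =
      (1 + ((√(N : ℝ))⁻¹ : ℝ) * Complex.I * ((y (τ N) z : ℝ) : ℂ)) -
        ((N : ℂ))⁻¹ * k (τ N, (√(N : ℝ))⁻¹) z := fun z => by
    rw [exp_mul_I_eq, ← hsq, hk]
    push_cast
    ring
  simp only [hexp]
  have hA : Integrable (fun z => ((√(N : ℝ))⁻¹ : ℝ) * Complex.I * ((y (τ N) z : ℝ) : ℂ))
      (F (θ N) : Measure Z) := hyi.ofReal.const_mul _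
  have hB : Integrable (fun z => 1 + ((√(N : ℝ))⁻¹ : ℝ) * Complex.I * ((y (τ N) z : ℝ) : ℂ))
      (F (θ N) : Measure Z) := (integrable_const _).add hA
  rw [integral_sub hB (hki.const_mul _), integral_add (integrable_const _) hA, integral_const_mul,
    integral_const_mul, integral_complex_ofReal, h0]
  simp
  ring

/-- The central limit theorem for a triangular array of row-wise independent vectors
`f (τ N) z₁, …, f (τ N) z_N` with `zᵢ` distributed according to `F (θ N)`. -/
theorem tendstoInDistribution_triangular {p : ℕ} (hF : ContinuousAt F θ₀) (hG : Measurable G)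
    (hUI : UnifIntegrableNear F θ₀ G) {f : T → Z → Fin p → ℝ}
    (hf : Continuous (Function.uncurry f)) {τ₀ : T} {c : ℝ≥0} (hc : c ≠ 0)
    (hfG : ∀ᶠ τ in 𝓝 τ₀, ∀ z, ‖f τ z‖ₑ ^ 2 ≤ c * (1 + G z)) {θ : ℕ → Θ}
    (hθ : Tendsto θ atTop (𝓝 θ₀)) {τ : ℕ → T} (hτ : Tendsto τ atTop (𝓝 τ₀))
    (hmean : ∀ᶠ N in atTop, ∀ i, ∫ z, f (τ N) z i ∂(F (θ N) : Measure Z) = 0)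
    (hcov : ∀ i j, ∫ z, f τ₀ z i * f τ₀ z j ∂(F θ₀ : Measure Z) = if i = j then 1 else 0) :
    TendstoInDistribution
      (fun N (z : Fin N → Z) => (√(N : ℝ))⁻¹ • ∑ i, f (τ N) (z i)) atTop id
      (fun N => sampleLaw (F (θ N)) N) (Measure.pi fun _ : Fin p => gaussianReal 0 1) := by
  have hfτ : ∀ τ, Continuous (f τ) := fun τ => hf.comp (by fun_prop : Continuous fun z => (τ, z))
  have hXm : ∀ N, Measurable fun z : Fin N → Z => (√(N : ℝ))⁻¹ • ∑ i, f (τ N) (z i) := fun N => by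
    have hm : Measurable fun z : Fin N → Z => ∑ i, f (τ N) (z i) := Finset.measurable_sum _
      fun i _ => (hfτ (τ N)).measurable.comp (measurable_pi_apply i)
    exact hm.const_smul (√(N : ℝ))⁻¹
  have hlp : Measurable (WithLp.toLp 2 : (Fin p → ℝ) → EuclideanSpace ℝ (Fin p)) :=
    (PiLp.continuous_toLp 2 _).measurable
  -- Characteristic functions need an inner product, so the statement is moved to the Euclidean
  -- norm.
  suffices h : TendstoInDistribution
      (fun N (z : Fin N → Z) => WithLp.toLp 2 ((√(N : ℝ))⁻¹ • ∑ i, f (τ N) (z i))) atTop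
      (WithLp.toLp 2 : (Fin p → ℝ) → EuclideanSpace ℝ (Fin p))
      (fun N => sampleLaw (F (θ N)) N) (Measure.pi fun _ : Fin p => gaussianReal 0 1) by
    exact h.continuous_comp (PiLp.continuous_ofLp 2 fun _ : Fin p => ℝ)
  refine ⟨fun N => (hlp.comp (hXm N)).aemeasurable, hlp.aemeasurable, ?_⟩
  refine ProbabilityMeasure.tendsto_iff_tendsto_charFun.2 fun t => ?_
  set y : T → Z → ℝ := fun τ z => ∑ i, t i * f τ z i with hy
  have hyc : Continuous (Function.uncurry y) := by
    have : ∀ i, Continuous fun x : T × Z => f x.1 x.2 i := fun i => (continuous_apply i).comp hf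
    simp only [hy, Function.uncurry_def]
    fun_prop
  -- The `+ 1` keeps the constant nonzero for `t = 0`.
  set d : ℝ≥0 := c * ((∑ i, ‖t i‖₊) ^ 2 + 1) with hd
  have hd0 : d ≠ 0 := mul_ne_zero hc (by positivity)
  have hyG : ∀ᶠ τ in 𝓝 τ₀, ∀ z, ‖y τ z‖ₑ ^ 2 ≤ d * (1 + G z) := by
    filter_upwards [hfG] with τ hτ z
    have h1 : ‖y τ z‖ₑ ≤ ((∑ i, ‖t i‖₊ : ℝ≥0) : ℝ≥0∞) * ‖f τ z‖ₑ := by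
      rw [enorm_eq_nnnorm, enorm_eq_nnnorm, ← ENNReal.coe_mul, ENNReal.coe_le_coe, Finset.sum_mul]
      refine (nnnorm_sum_le _ _).trans (Finset.sum_le_sum fun i _ => ?_)
      rw [nnnorm_mul]
      gcongr
      exact nnnorm_le_pi_nnnorm _ i
    calc ‖y τ z‖ₑ ^ 2 ≤ (((∑ i, ‖t i‖₊ : ℝ≥0) : ℝ≥0∞) * ‖f τ z‖ₑ) ^ 2 := by gcongr
      _ = ((∑ i, ‖t i‖₊ : ℝ≥0) : ℝ≥0∞) ^ 2 * ‖f τ z‖ₑ ^ 2 := mul_pow _ _ _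
      _ ≤ (((∑ i, ‖t i‖₊ : ℝ≥0) : ℝ≥0∞) ^ 2 + 1) * (c * (1 + G z)) := by
          gcongr
          · exact le_self_add
          · exact hτ z
      _ = d * (1 + G z) := by
          rw [hd]
          push_cast
          ring
  have hGm : Measurable fun z => 1 + G z := measurable_const.add hG
  have hInt : ∀ τ θ, (∀ z, ‖f τ z‖ₑ ^ 2 ≤ c * (1 + G z)) → ∫⁻ z, G z ∂(F θ : Measure Z) ≠ ∞ →
      MemLp (f τ) 2 (F θ : Measure Z) := fun τ θ h1 h2 => by
    refine ⟨(hfτ τ).aestronglyMeasurable, ?_⟩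
    rw [eLpNorm_lt_top_iff_lintegral_rpow_enorm_lt_top two_ne_zero ENNReal.ofNat_ne_top]
    refine lt_of_le_of_lt (lintegral_mono (g := fun z => (c : ℝ≥0∞) * (1 + G z)) fun z => ?_) ?_
    · simpa using h1 z
    · rw [lintegral_const_mul _ hGm, lintegral_add_left measurable_const]
      exact ENNReal.mul_lt_top ENNReal.coe_lt_top (by simpa using h2.lt_top)
  have hfin := hUI.eventually_lintegral_ne_top hG
  have hmem0 := hInt τ₀ θ₀ hfG.self_of_nhds hfin.self_of_nhds
  have hmem0i : ∀ i, MemLp (fun z => f τ₀ z i) 2 (F θ₀ : Measure Z) := fun i =>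
    memLp_pi_iff.1 hmem0 i
  have hmeany : ∀ᶠ N in atTop, ∫ z, y (τ N) z ∂(F (θ N) : Measure Z) = 0 := by
    filter_upwards [hmean, hτ.eventually hfG, hθ.eventually hfin] with N h1 h2 h3
    have hi : ∀ i, Integrable (fun z => f (τ N) z i) (F (θ N) : Measure Z) := fun i =>
      (memLp_pi_iff.1 (hInt _ _ h2 h3) i).integrable one_le_two
    simp only [hy]
    rw [integral_finsetSum _ fun i _ => (hi i).const_mul _]
    simp [integral_const_mul, h1]
  have hvar : ∫ z, y τ₀ z ^ 2 ∂(F θ₀ : Measure Z) = ∑ i, t i ^ 2 := by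
    have hprod : ∀ i j, Integrable (fun z => f τ₀ z i * f τ₀ z j) (F θ₀ : Measure Z) := fun i j =>
      (hmem0i i).integrable_mul (hmem0i j)
    have : ∀ z, y τ₀ z ^ 2 = ∑ i, ∑ j, (t i * t j) * (f τ₀ z i * f τ₀ z j) := fun z => by
      rw [sq, hy, Finset.sum_mul_sum]
      refine Finset.sum_congr rfl fun i _ => Finset.sum_congr rfl fun j _ => ?_
      ring
    simp only [this]
    rw [integral_finsetSum _ fun i _ => integrable_finsetSum _ fun j _ =>
      (hprod i j).const_mul _]
    refine Finset.sum_congr rfl fun i _ => ?_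
    rw [integral_finsetSum _ fun j _ => (hprod i j).const_mul _]
    simp [integral_const_mul, hcov, sq]
  have key := tendsto_integral_exp_pow hF (measurable_const.mul hGm)
    (hUI.const_mul_one_add hG hd0) hyc hyG hθ hτ hmeany
  rw [hvar] at key
  convert key using 1
  · ext N
    change charFun ((sampleLaw (F (θ N)) N).map _) t = _
    have hcm : AEMeasurable (fun z : Fin N → Z =>
        (WithLp.toLp 2 ((√(N : ℝ))⁻¹ • ∑ i, f (τ N) (z i)) : EuclideanSpace ℝ (Fin p)))
        (sampleLaw (F (θ N)) N) := (hlp.comp (hXm N)).aemeasurable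
    rw [charFun_apply, integral_map hcm
      (by fun_prop : Continuous fun x : EuclideanSpace ℝ (Fin p) =>
        Complex.exp (inner ℝ x t * Complex.I)).aestronglyMeasurable]
    have hpow := integral_fintype_prod_eq_pow (ι := Fin N) (μ := (F (θ N) : Measure Z))
      fun z => Complex.exp (((√(N : ℝ))⁻¹ * y (τ N) z : ℝ) * Complex.I)
    rw [Fintype.card_fin] at hpow
    rw [← hpow]
    refine integral_congr_ae (.of_forall fun z => ?_)
    simp only
    rw [← Complex.exp_sum, ← Finset.sum_mul, ← Complex.ofReal_sum]
    congr 3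
    simp only [PiLp.inner_apply, hy, Pi.smul_apply, Finset.sum_apply, smul_eq_mul, RCLike.inner_apply,
      conj_trivial, Finset.mul_sum]
    rw [Finset.sum_comm]
    refine Finset.sum_congr rfl fun i _ => Finset.sum_congr rfl fun k _ => ?_
    ring
  · change 𝓝 (charFun ((Measure.pi fun _ : Fin p => gaussianReal 0 1).map (WithLp.toLp 2)) t) = _
    rw [charFun_pi]
    simp only [charFun_gaussianReal]
    rw [← Complex.exp_sum]
    congr 2
    push_cast
    simp [Finset.sum_div, neg_div]

end CentralLimit

/-! ### Slutsky's lemma on varying probability spaces -/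

section Slutsky

/-- Random variables that differ by a term converging to zero in probability have the same limit
in distribution. -/
theorem tendstoInDistribution_of_sub_tendsto_zero {Ω : ℕ → Type*} {Ω' : Type*}
    [∀ N, MeasurableSpace (Ω N)] [MeasurableSpace Ω'] {μ : (N : ℕ) → Measure (Ω N)}
    [∀ N, IsProbabilityMeasure (μ N)] {μ' : Measure Ω'} [IsProbabilityMeasure μ']
    {X Y : (N : ℕ) → Ω N → ℝ} {W : Ω' → ℝ} (hX : TendstoInDistribution X atTop W μ μ')
    (hY : ∀ N, AEMeasurable (Y N) (μ N))
    (hXY : ∀ ε > 0, Tendsto (fun N => μ N {ω | ε < |Y N ω - X N ω|}) atTop (𝓝 0)) :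
    TendstoInDistribution Y atTop W μ μ' := by
  refine ⟨hY, hX.aemeasurable_limit, ?_⟩
  refine tendsto_iff_forall_lipschitz_integral_tendsto.2 ?_
  rintro f ⟨C, hC⟩ ⟨K, hK⟩
  have h0 := tendsto_iff_forall_lipschitz_integral_tendsto.1 hX.tendsto f ⟨C, hC⟩ ⟨K, hK⟩
  have hC0 : 0 ≤ C := dist_nonneg.trans (hC 0 0)
  have hfb : ∀ x, ‖f x‖ ≤ ‖f 0‖ + C := fun x => by
    have := hC x 0
    rw [dist_eq_norm] at this
    linarith [norm_sub_norm_le (f x) (f 0)]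
  have hInt : ∀ N (V : Ω N → ℝ), AEMeasurable V (μ N) → Integrable (fun ω => f (V ω)) (μ N) :=
    fun N V hV => (integrable_const (‖f 0‖ + C)).mono'
      (hK.continuous.measurable.comp_aemeasurable hV).aestronglyMeasurable
      (.of_forall fun ω => hfb _)
  suffices hdiff : Tendsto (fun N => ∫ ω, f (Y N ω) ∂(μ N) - ∫ ω, f (X N ω) ∂(μ N)) atTop (𝓝 0) by
    have hsum := hdiff.add h0
    rw [zero_add] at hsum
    refine hsum.congr fun N => ?_
    change _ + ∫ ω, f ω ∂((μ N).map (X N)) = ∫ ω, f ω ∂((μ N).map (Y N))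
    rw [integral_map (hX.forall_aemeasurable N) hK.continuous.aestronglyMeasurable,
      integral_map (hY N) hK.continuous.aestronglyMeasurable]
    ring
  refine Metric.tendsto_nhds.2 fun ε hε => ?_
  set e : ℝ := ε / (2 * (K + 1)) with he
  have he0 : 0 < e := by positivity
  have hsmall : ∀ᶠ N in atTop, C * (μ N).real {ω | e < |Y N ω - X N ω|} < ε / 2 := by
    have h1 := ((ENNReal.tendsto_toReal ENNReal.zero_ne_top).comp (hXY e he0)).const_mul C
    rw [ENNReal.toReal_zero, mul_zero] at h1
    exact h1.eventually_lt_const (by positivity)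
  filter_upwards [hsmall] with N hN
  -- The variables are only almost everywhere measurable, so the event is replaced by a measurable
  -- hull of the same measure.
  set A := toMeasurable (μ N) {ω | e < |Y N ω - X N ω|} with hA
  have hAm : MeasurableSet A := measurableSet_toMeasurable _ _
  have hle : ∀ ω, ‖f (Y N ω) - f (X N ω)‖ ≤ K * e + A.indicator (fun _ => C) ω := fun ω => by
    by_cases hω : ω ∈ A
    · rw [Set.indicator_of_mem hω, ← dist_eq_norm]
      have := hC (Y N ω) (X N ω)
      have : 0 ≤ K * e := by positivity
      linarith
    · rw [Set.indicator_of_notMem hω, add_zero, ← dist_eq_norm]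
      refine (hK.dist_le_mul _ _).trans ?_
      gcongr
      rw [Real.dist_eq]
      exact not_lt.1 fun h => hω (subset_toMeasurable _ _ h)
  rw [dist_zero_right, ← integral_sub (hInt N _ (hY N)) (hInt N _ (hX.forall_aemeasurable N))]
  calc _ ≤ ∫ ω, (K * e + A.indicator (fun _ => C) ω) ∂(μ N) :=
        norm_integral_le_of_norm_le ((integrable_const _).add ((integrable_const C).indicator hAm))
          (.of_forall hle)
    _ = K * e + C * (μ N).real {ω | e < |Y N ω - X N ω|} := by
        rw [integral_add (integrable_const _) ((integrable_const C).indicator hAm),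
          integral_indicator hAm]
        simp [hA, Measure.real, mul_comm]
    _ < K * e + ε / 2 := by linarith
    _ ≤ ε := by
        have : K * e ≤ ε / 2 := by
          rw [he, mul_div_assoc', div_le_div_iff₀ (by positivity) (by positivity)]
          nlinarith [K.coe_nonneg]
        linarith

end Slutsky

lemma map_sum_sq_pi_gaussianReal (p : ℕ) (δsq : ℝ) :
    (Measure.pi fun _ : Fin p => gaussianReal 0 1).map
      (fun x => ∑ i : Fin p, (x i + if (i : ℕ) = 0 then √δsq else 0) ^ 2) =
      noncentralChiSquared p δsq := by
  have hmap : (Measure.pi fun _ : Fin p => gaussianReal 0 1).map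
      (fun x (i : Fin p) => x i + if (i : ℕ) = 0 then √δsq else 0) =
      Measure.pi fun i : Fin p => gaussianReal (if (i : ℕ) = 0 then √δsq else 0) 1 := by
    rw [Measure.pi_map_pi (f := fun (i : Fin p) x => x + if (i : ℕ) = 0 then √δsq else 0)
      fun i => by fun_prop]
    simp [gaussianReal_map_add_const]
  rw [noncentralChiSquared, ← hmap, Measure.map_map (by fun_prop) (by fun_prop)]
  rfl

/-! ### Empirical scores and the objective function of a sample -/

section Sample

variable {n q s : ℕ} {S : Spec n s} {N : ℕ}

lemma gbar_apply (z : Fin N → Subject n q) (β : Fin q → ℝ) (a : Fin s × Fin q) :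
    gbar S z β a = (N : ℝ)⁻¹ * ∑ i, score S β (z i) a := by
  simp [gbar, Finset.sum_apply]

lemma Chat_apply (z : Fin N → Subject n q) (β : Fin q → ℝ) (a b : Fin s × Fin q) :
    Chat S z β a b = (N : ℝ)⁻¹ * ∑ i, score S β (z i) a * score S β (z i) b := by
  simp [Chat, Matrix.sum_apply, vecMulVec_apply]

lemma isHermitian_Chat (z : Fin N → Subject n q) (β : Fin q → ℝ) : (Chat S z β).IsHermitian := by
  ext a b
  simp [Chat_apply, mul_comm]

lemma differentiable_gbar (hS : S.Regular) (z : Fin N → Subject n q) :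
    Differentiable ℝ (gbar S z) := by
  have := Differentiable.fun_sum (u := Finset.univ) fun (i : Fin N) _ =>
    differentiable_score hS (z i)
  exact this.const_smul (N : ℝ)⁻¹

lemma jacobian_gbar (hS : S.Regular) (z : Fin N → Subject n q) (β : Fin q → ℝ)
    (a : Fin s × Fin q) (k : Fin q) :
    jacobian (gbar S z) β a k = (N : ℝ)⁻¹ * ∑ i, jacobian (fun b => score S b (z i)) β a k := by
  have h := HasFDerivAt.fun_sum (u := Finset.univ) fun (i : Fin N) _ =>
    (differentiable_score hS (z i) β).hasFDerivAt
  have h2 := h.const_smul (N : ℝ)⁻¹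
  have h3 : HasFDerivAt (gbar S z) _ β := h2
  simp [jacobian, h3.fderiv, Finset.sum_apply]

/-- Joint measurability in data and parameter is what allows a measurable estimator to be inserted
for the parameter. -/
lemma measurable_Q (hS : S.Regular) :
    Measurable fun x : (Fin N → Subject n q) × (Fin q → ℝ) => Q S x.1 x.2 := by
  have hscore : ∀ i a, Measurable fun x : (Fin N → Subject n q) × (Fin q → ℝ) =>
      score S x.2 (x.1 i) a := fun i a => by
    have h1 : Continuous fun x : (Fin N → Subject n q) × (Fin q → ℝ) => (x.2, x.1 i) := by fun_prop
    have h2 := (continuous_score hS).comp h1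
    have h3 := (continuous_apply a).comp h2
    exact h3.measurable
  have hg : ∀ a, Measurable fun x : (Fin N → Subject n q) × (Fin q → ℝ) => gbar S x.1 x.2 a := by
    intro a
    simp only [gbar_apply]
    exact measurable_const.mul (Finset.measurable_sum _ fun i _ => hscore i a)
  have hC : ∀ a b, Measurable fun x : (Fin N → Subject n q) × (Fin q → ℝ) =>
      Chat S x.1 x.2 a b := by
    intro a b
    simp only [Chat_apply]
    exact measurable_const.mul
      (Finset.measurable_sum _ fun i _ => (hscore i a).mul (hscore i b))
  have hp := measurable_pinv_apply hC fun x => isHermitian_Chat x.1 x.2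
  simp only [Q, dotProduct, Matrix.mulVec]
  exact measurable_const.mul (Finset.measurable_sum _ fun a _ => (hg a).mul
    (Finset.measurable_sum _ fun b _ => (hp a b).mul (hg b)))

end Sample

/-! ### Uniform quadratic approximation of the test statistic -/

section Deterministic

variable {n q s p : ℕ} {S : Spec n s}

/-- On `B` the empirical means of the extended scores, of their products and of their derivatives
differ from the expectations under `P` by at most `η`. -/
def UniformlyClose (S : Spec n s) (B : Set (Fin q → ℝ)) (P : Measure (Subject n q)) (η : ℝ)
    {N : ℕ} (z : Fin N → Subject n q) : Prop :=
  ∀ β ∈ B, (∀ a, |gbar S z β a - ∫ w, score S β w a ∂P| ≤ η) ∧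
    (∀ a b, |Chat S z β a b - secondMoment S P β a b| ≤ η) ∧
    ∀ a k, |jacobian (gbar S z) β a k - expJacobian S P β a k| ≤ η

lemma tendstoUniformlyOn_of_abs_sub_le {α : Type*} {B : Set α} {f : ℕ → α → ℝ} {f₀ : α → ℝ}
    {η : ℕ → ℝ} (hη : Tendsto η atTop (𝓝 0)) (h : ∀ k, ∀ x ∈ B, |f k x - f₀ x| ≤ η k) :
    TendstoUniformlyOn f f₀ atTop B := by
  refine Metric.tendstoUniformlyOn_iff.2 fun ε hε => ?_
  filter_upwards [hη.eventually_lt_const hε] with k hk x hx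
  rw [dist_comm, Real.dist_eq]
  exact (h k x hx).trans_lt hk

/-- If the empirical means are uniformly close to their expectations, the test statistic is close
to a quadratic function of the score at the local alternative. -/
theorem exists_uniformlyClose_imp_approx (hS : S.Regular) {B : Set (Fin q → ℝ)} (hB : IsCompact B)
    {β₀ : Fin q → ℝ} (hβ₀ : β₀ ∈ interior B) {P : Measure (Subject n q)}
    (hmc : ∀ a, ContinuousOn (fun β => ∫ w, score S β w a ∂P) B)
    (hSc : ∀ a b, ContinuousOn (fun β => secondMoment S P β a b) B)
    (hDc : ∀ a k, ContinuousOn (fun β => expJacobian S P β a k) B)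
    (hident : ∀ β ∈ B, (fun a => ∫ w, score S β w a ∂P) = 0 ↔ β = β₀)
    (hSig : ∀ β ∈ B, (secondMoment S P β).PosDef)
    (hinj : ∀ u, expJacobian S P β₀ *ᵥ u = 0 → u = 0)
    {L : Matrix (Fin q) (Fin p) ℝ} {b : Fin p → ℝ} (hb : Lᵀ *ᵥ β₀ = b) (v : Fin q → ℝ)
    {A : Matrix (Fin p) (Fin s × Fin q) ℝ} {e : Fin p → ℝ}
    (hA : ∀ y : Fin s × Fin q → ℝ, ∃ u w : Fin q → ℝ,
      (∀ x, ((y - expJacobian S P β₀ *ᵥ v) + expJacobian S P β₀ *ᵥ u) ⬝ᵥ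
          ((secondMoment S P β₀)⁻¹ *ᵥ ((y - expJacobian S P β₀ *ᵥ v) + expJacobian S P β₀ *ᵥ u)) ≤
        ((y - expJacobian S P β₀ *ᵥ v) + expJacobian S P β₀ *ᵥ x) ⬝ᵥ
          ((secondMoment S P β₀)⁻¹ *ᵥ ((y - expJacobian S P β₀ *ᵥ v) + expJacobian S P β₀ *ᵥ x))) ∧
      Lᵀ *ᵥ w = 0 ∧
      (∀ x, Lᵀ *ᵥ x = 0 → ((y - expJacobian S P β₀ *ᵥ v) + expJacobian S P β₀ *ᵥ w) ⬝ᵥ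
          ((secondMoment S P β₀)⁻¹ *ᵥ ((y - expJacobian S P β₀ *ᵥ v) + expJacobian S P β₀ *ᵥ w)) ≤
        ((y - expJacobian S P β₀ *ᵥ v) + expJacobian S P β₀ *ᵥ x) ⬝ᵥ
          ((secondMoment S P β₀)⁻¹ *ᵥ ((y - expJacobian S P β₀ *ᵥ v) + expJacobian S P β₀ *ᵥ x))) ∧
      ((y - expJacobian S P β₀ *ᵥ v) + expJacobian S P β₀ *ᵥ w) ⬝ᵥ
          ((secondMoment S P β₀)⁻¹ *ᵥ ((y - expJacobian S P β₀ *ᵥ v) + expJacobian S P β₀ *ᵥ w)) -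
        ((y - expJacobian S P β₀ *ᵥ v) + expJacobian S P β₀ *ᵥ u) ⬝ᵥ
          ((secondMoment S P β₀)⁻¹ *ᵥ ((y - expJacobian S P β₀ *ᵥ v) + expJacobian S P β₀ *ᵥ u)) =
      ∑ i : Fin p, ((A *ᵥ y) i + e i) ^ 2)
    {ε : ℝ} (hε : 0 < ε) (R : ℝ) :
    ∃ η > 0, ∃ N₀ : ℕ, ∀ N ≥ N₀, ∀ z : Fin N → Subject n q, UniformlyClose S B P η z →
      ‖√(N : ℝ) • gbar S z (localAlt β₀ v N)‖ ≤ R → ∀ β₁ ∈ argmin (Q S z) B,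
      ∀ β₂ ∈ argmin (Q S z) {β | β ∈ B ∧ Lᵀ *ᵥ β = b},
      |Q S z β₂ - Q S z β₁ -
        ∑ i : Fin p, ((A *ᵥ (√(N : ℝ) • gbar S z (localAlt β₀ v N))) i + e i) ^ 2| ≤ ε := by
  -- If no pair `(η, N₀)` worked, there would be bad samples with `η = 1 / (k + 1)` and size at
  -- least `k`. They form one deterministic sequence, and along a subsequence with convergent
  -- rescaled score `LocalAsymptotics` applies and contradicts badness.
  by_contra! hcon
  choose N hN z hclose hbound β₁ hβ₁ β₂ hβ₂ hbad using
    fun k : ℕ => hcon (1 / ((k : ℝ) + 1)) (by positivity) k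
  obtain ⟨y, -, φ, hφ, hlim⟩ := (isCompact_closedBall (0 : Fin s × Fin q → ℝ) R).tendsto_subseq
    (x := fun k => √(N k : ℝ) • gbar S (z k) (localAlt β₀ v (N k)))
    fun k => by simpa using hbound k
  set r : ℕ → ℝ := fun k => √(N (φ k) : ℝ) with hr
  set g : ℕ → (Fin q → ℝ) → Fin s × Fin q → ℝ := fun k => gbar S (z (φ k)) with hg
  set C : ℕ → (Fin q → ℝ) → Matrix (Fin s × Fin q) (Fin s × Fin q) ℝ :=
    fun k => Chat S (z (φ k)) with hC
  have hη : Tendsto (fun k => 1 / (((φ k : ℕ) : ℝ) + 1)) atTop (𝓝 0) := by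
    have := (tendsto_one_div_add_atTop_nhds_zero_nat (𝕜 := ℝ)).comp hφ.tendsto_atTop
    exact this
  have hNtop : Tendsto (fun k => N (φ k)) atTop atTop :=
    (tendsto_atTop_mono hN tendsto_id).comp hφ.tendsto_atTop
  have hrt : Tendsto r atTop atTop := by
    have := (Real.tendsto_sqrt_atTop.comp (tendsto_natCast_atTop_atTop (R := ℝ))).comp hNtop
    exact this
  have hLA : LocalAsymptotics B β₀ (fun β a => ∫ w, score S β w a ∂P) (secondMoment S P)
      (expJacobian S P) r g C :=
    { isCompact := hB
      mem_interior := hβ₀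
      tendsto_rate := hrt
      differentiable := fun k => differentiable_gbar hS _
      isHermitian := fun k β => isHermitian_Chat _ _
      unif_mean := fun a => tendstoUniformlyOn_of_abs_sub_le hη
        fun k β hβ => (hclose (φ k) β hβ).1 a
      unif_weight := fun a b => tendstoUniformlyOn_of_abs_sub_le hη
        fun k β hβ => (hclose (φ k) β hβ).2.1 a b
      unif_deriv := fun a j => tendstoUniformlyOn_of_abs_sub_le hη
        fun k β hβ => (hclose (φ k) β hβ).2.2 a j
      cont_mean := hmc
      cont_weight := hSc
      cont_deriv := fun a j => hDc a j β₀ (interior_subset hβ₀)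
      posDef := hSig
      ident := hident
      inj := hinj }
  have hobj : ∀ k β, LocalAsymptotics.objective r g C k β = Q S (z (φ k)) β := fun k β => by
    simp only [LocalAsymptotics.objective, hr, Q, Real.sq_sqrt (Nat.cast_nonneg _), hg, hC]
  have hscaled : Tendsto (fun k => r k • (localAlt β₀ v (N (φ k)) - β₀)) atTop (𝓝 v) := by
    refine tendsto_const_nhds.congr' ?_
    filter_upwards [hrt.eventually_gt_atTop 0] with k hk
    simp only [localAlt, add_sub_cancel_left, smul_smul]
    rw [mul_inv_cancel₀ hk.ne', one_smul]
  -- Moving the evaluation point from the local alternative to `β₀` costs `D v`, the source of the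
  -- noncentrality.
  have hz : Tendsto (fun k => r k • g k β₀) atTop (𝓝 (y - expJacobian S P β₀ *ᵥ v)) := by
    have h1 := hLA.tendsto_scaled_sub (hLA.tendsto_of_tendsto_scaled hscaled) tendsto_const_nhds
      hscaled
    have h2 := hlim.sub h1
    refine h2.congr fun k => ?_
    simp only [Function.comp, hr, hg]
    abel
  obtain ⟨u, w, hu, hw0, hw, hval⟩ := hA y
  have hmin1 := hLA.tendsto_min hz ⊤ (x := fun k => β₁ (φ k)) (fun k => (hβ₁ (φ k)).1)
    (fun _ => trivial) (fun k β hβ _ => by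
      rw [hobj, hobj]
      exact (hβ₁ (φ k)).2 β hβ) (u := u) trivial (fun x _ => hu x)
  have hmem : ∀ β, β - β₀ ∈ LinearMap.ker (Matrix.mulVecLin Lᵀ) ↔ Lᵀ *ᵥ β = b := fun β => by
    rw [LinearMap.mem_ker, Matrix.mulVecLin_apply, Matrix.mulVec_sub, hb, sub_eq_zero]
  have hmin2 := hLA.tendsto_min hz (LinearMap.ker (Matrix.mulVecLin Lᵀ))
    (x := fun k => β₂ (φ k)) (fun k => (hβ₂ (φ k)).1.1)
    (fun k => (hmem _).2 (hβ₂ (φ k)).1.2) (fun k β hβ hK => by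
      rw [hobj, hobj]
      exact (hβ₂ (φ k)).2 β ⟨hβ, (hmem β).1 hK⟩) (u := w) hw0 (fun x hx => hw x hx)
  have hquad : Tendsto (fun k => ∑ i : Fin p, ((A *ᵥ (√(N (φ k) : ℝ) •
      gbar S (z (φ k)) (localAlt β₀ v (N (φ k))))) i + e i) ^ 2) atTop
      (𝓝 (∑ i : Fin p, ((A *ᵥ y) i + e i) ^ 2)) := by
    have hc : Continuous fun y : Fin s × Fin q → ℝ => ∑ i : Fin p, ((A *ᵥ y) i + e i) ^ 2 := by
      have h1 : Continuous fun y : Fin s × Fin q → ℝ => A *ᵥ y :=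
        continuous_const.matrix_mulVec continuous_id
      have h2 : ∀ i, Continuous fun y : Fin s × Fin q → ℝ => (A *ᵥ y) i := fun i =>
        (continuous_apply i).comp h1
      fun_prop
    have := (hc.tendsto y).comp hlim
    exact this
  have hfinal := (hmin2.sub hmin1).sub hquad
  rw [hval, sub_self] at hfinal
  obtain ⟨k, hk⟩ := (hfinal.abs.eventually_lt_const (by simpa using hε)).exists
  rw [hobj, hobj] at hk
  exact absurd hk (not_lt.2 (hbad (φ k)).le)

end Deterministic

/-! ### Envelopes, and continuity of the limiting moments -/

section Envelopes

variable {n q s : ℕ} {S : Spec n s} {B : Set (Fin q → ℝ)} {β : Fin q → ℝ}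

lemma enorm_score_sq_le (hβ : β ∈ B) (z : Subject n q) :
    ‖score S β z‖ₑ ^ 2 ≤ ⨆ β ∈ B, ‖score S β z‖ₑ ^ 2 :=
  le_iSup₂ (f := fun β (_ : β ∈ B) => ‖score S β z‖ₑ ^ 2) β hβ

lemma enorm_apply_le {ι : Type*} [Fintype ι] (x : ι → ℝ) (a : ι) : ‖x a‖ₑ ≤ ‖x‖ₑ := by
  rw [enorm_eq_nnnorm, enorm_eq_nnnorm, ENNReal.coe_le_coe]
  exact nnnorm_le_pi_nnnorm x a

lemma enorm_score_mul_le (hβ : β ∈ B) (z : Subject n q) (a b : Fin s × Fin q) :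
    ‖score S β z a * score S β z b‖ₑ ≤ ⨆ β ∈ B, ‖score S β z‖ₑ ^ 2 := by
  refine le_trans ?_ (enorm_score_sq_le hβ z)
  rw [enorm_mul, sq]
  exact mul_le_mul' (enorm_apply_le _ a) (enorm_apply_le _ b)

lemma enorm_score_apply_le (hβ : β ∈ B) (z : Subject n q) (a : Fin s × Fin q) :
    ‖score S β z a‖ₑ ≤ (1 : ℝ≥0) * (1 + ⨆ β ∈ B, ‖score S β z‖ₑ ^ 2) := by
  rw [ENNReal.coe_one, one_mul]
  refine (enorm_le_one_add_sq _).trans (add_le_add_right ?_ 1)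
  rw [sq, ← enorm_mul]
  exact enorm_score_mul_le hβ z a a

lemma enorm_jacobian_score_le (hβ : β ∈ B) (z : Subject n q) (a : Fin s × Fin q) (k : Fin q) :
    ‖jacobian (fun b => score S b z) β a k‖ₑ ≤
      ⨆ β ∈ B, ‖fderiv ℝ (fun b => score S b z) β‖ₑ := by
  refine le_trans ?_ (le_iSup₂ (f := fun β (_ : β ∈ B) => ‖fderiv ℝ (fun b => score S b z) β‖ₑ) β hβ)
  have h1 : ‖(fderiv ℝ (fun b => score S b z) β) (Pi.single k 1)‖ ≤
      ‖fderiv ℝ (fun b => score S b z) β‖ := by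
    refine (ContinuousLinearMap.le_opNorm _ _).trans ?_
    rw [Pi.norm_single, norm_one, mul_one]
  refine (enorm_apply_le _ a).trans ?_
  rw [enorm_eq_nnnorm, enorm_eq_nnnorm, ENNReal.coe_le_coe]
  exact h1

end Envelopes

lemma continuousOn_integral_of_envelope {Z T : Type*} [NormedAddCommGroup Z] [MeasurableSpace Z]
    [BorelSpace Z] [ProperSpace Z] [TopologicalSpace T] {Θ : Type*} [TopologicalSpace Θ]
    {F : Θ → ProbabilityMeasure Z} {θ₀ : Θ} {G : Z → ℝ≥0∞}
    (hF : ContinuousAt F θ₀) (hG : Measurable G) (hUI : UnifIntegrableNear F θ₀ G)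
    {f : T → Z → ℝ} (hf : Continuous (Function.uncurry f)) {B : Set T}
    (hfG : ∀ τ ∈ B, ∀ z, ‖f τ z‖ₑ ≤ G z) :
    ContinuousOn (fun τ => ∫ z, f τ z ∂(F θ₀ : Measure Z)) B := by
  rw [continuousOn_iff_continuous_domRestrict, continuous_iff_continuousAt]
  intro τ
  -- The envelope dominates on `B` only, so the parameter space is taken to be the subtype.
  have hval : Continuous fun x : B × Z => ((x.1 : T), x.2) := by fun_prop
  have h1 := continuousAt_integral_of_unifIntegrableNear hF hG hUI
    (f := fun (τ : B) z => f τ z) (hf.comp hval) (τ₀ := τ)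
    (.of_forall fun τ z => hfG τ τ.2 z)
  have h2 : Tendsto (fun τ : B => (τ, θ₀)) (𝓝 τ) (𝓝 (τ, θ₀)) :=
    (Continuous.prodMk_left θ₀).tendsto τ
  have h3 := h1.comp h2
  exact h3

/-! ### Events of high probability under the local alternatives -/

section Events

variable {n q s : ℕ} {S : Spec n s} {B : Set (Fin q → ℝ)} {β₀ : Fin q → ℝ}
  {F : (Fin q → ℝ) → ProbabilityMeasure (Subject n q)}

lemma continuous_score_apply (hS : S.Regular) (a : Fin s × Fin q) :
    Continuous (Function.uncurry fun (β : Fin q → ℝ) (z : Subject n q) => score S β z a) := by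
  have := (continuous_apply a).comp (continuous_score (n := n) (q := q) hS)
  exact this

lemma continuous_score_mul (hS : S.Regular) (a b : Fin s × Fin q) :
    Continuous (Function.uncurry fun (β : Fin q → ℝ) (z : Subject n q) =>
      score S β z a * score S β z b) := by
  have := (continuous_score_apply (n := n) hS a).mul (continuous_score_apply (n := n) hS b)
  exact this

lemma measure_le_of_subset_iUnion {α ι : Type*} [MeasurableSpace α] [Fintype ι] (μ : Measure α)
    {A : Set α} {E : ι → Set α} (h : A ⊆ ⋃ i, E i) : μ A ≤ ∑ i, μ (E i) :=
  (measure_mono h).trans (measure_iUnion_fintype_le μ E)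

/-- With probability tending to one, the empirical means are uniformly close to the expectations. -/
lemma tendsto_measure_not_uniformlyClose (hS : S.Regular) (hB : IsCompact B)
    (hF : ContinuousAt F β₀)
    (hUI : UnifIntegrableNear F β₀ fun z => ⨆ β ∈ B, ‖score S β z‖ₑ ^ 2)
    (hUI' : UnifIntegrableNear F β₀ fun z => ⨆ β ∈ B, ‖fderiv ℝ (fun b => score S b z) β‖ₑ)
    {θ : ℕ → Fin q → ℝ} (hθ : Tendsto θ atTop (𝓝 β₀)) {η : ℝ} (hη : 0 < η) :
    Tendsto (fun N => sampleLaw (F (θ N)) N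
      {z | ¬ UniformlyClose S B (F β₀ : Measure (Subject n q)) η z}) atTop (𝓝 0) := by
  have hGm := measurable_biSup_enorm_score (n := n) hS B
  have h1 := fun a : Fin s × Fin q => tendsto_measure_uniform_average hF
    (measurable_const.mul (measurable_const.add hGm)) (hUI.const_mul_one_add hGm one_ne_zero)
    (continuous_score_apply hS a) hB (fun β hβ z => enorm_score_apply_le hβ z a) hθ hη
  have h2 := fun ab : (Fin s × Fin q) × (Fin s × Fin q) => tendsto_measure_uniform_average hF hGm hUI
    (continuous_score_mul hS ab.1 ab.2) hB
    (fun β hβ z => enorm_score_mul_le hβ z ab.1 ab.2) hθ hη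
  have h3 := fun ak : (Fin s × Fin q) × Fin q => tendsto_measure_uniform_average hF
    (measurable_biSup_enorm_fderiv_score hS B) hUI'
    (f := fun β z => jacobian (fun b => score S b z) β ak.1 ak.2)
    (continuous_jacobian_score hS ak.1 ak.2) hB
    (fun β hβ z => enorm_jacobian_score_le hβ z ak.1 ak.2) hθ hη
  have hsum := ((tendsto_finsetSum Finset.univ fun a _ => h1 a).add
    (tendsto_finsetSum Finset.univ fun ab _ => h2 ab)).add
    (tendsto_finsetSum Finset.univ fun ak _ => h3 ak)
  simp only [Finset.sum_const_zero, add_zero] at hsum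
  refine tendsto_of_tendsto_of_tendsto_of_le_of_le tendsto_const_nhds hsum (fun _ => zero_le)
    fun N => ?_
  refine le_trans (measure_mono ?_) ((measure_union_le _ _).trans (add_le_add
    ((measure_union_le _ _).trans (add_le_add (measure_le_of_subset_iUnion _ subset_rfl)
      (measure_le_of_subset_iUnion _ subset_rfl))) (measure_le_of_subset_iUnion _ subset_rfl)))
  intro z hz
  by_contra hcon
  refine hz fun β hβ => ⟨fun a => ?_, fun a b => ?_, fun a k => ?_⟩ <;> by_contra hlt <;>
    rw [not_le] at hlt <;> refine hcon ?_
  · refine Or.inl (Or.inl (Set.mem_iUnion.2 ⟨a, β, hβ, ?_⟩))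
    rwa [gbar_apply] at hlt
  · refine Or.inl (Or.inr (Set.mem_iUnion.2 ⟨(a, b), β, hβ, ?_⟩))
    rwa [Chat_apply] at hlt
  · refine Or.inr (Set.mem_iUnion.2 ⟨(a, k), β, hβ, ?_⟩)
    rwa [jacobian_gbar hS] at hlt

lemma memLp_score_apply (hS : S.Regular) {P : Measure (Subject n q)} {β : Fin q → ℝ} (hβ : β ∈ B)
    (hfin : ∫⁻ z, ⨆ β ∈ B, ‖score S β z‖ₑ ^ 2 ∂P ≠ ∞) (a : Fin s × Fin q) :
    MemLp (fun z => score S β z a) 2 P := by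
  have hc : Continuous fun z : Subject n q => score S β z a :=
    (continuous_apply a).comp (continuous_score_right hS β)
  rw [memLp_two_iff_integrable_sq hc.aestronglyMeasurable]
  refine integrable_of_enorm_le (hc.pow 2) (fun z => ?_) hfin
  rw [sq]
  exact enorm_score_mul_le hβ z a a

lemma tendsto_secondMoment (hS : S.Regular) (hβ₀ : β₀ ∈ interior B) (hF : ContinuousAt F β₀)
    (hUI : UnifIntegrableNear F β₀ fun z => ⨆ β ∈ B, ‖score S β z‖ₑ ^ 2)
    {θ : ℕ → Fin q → ℝ} (hθ : Tendsto θ atTop (𝓝 β₀)) (a b : Fin s × Fin q) :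
    Tendsto (fun N => ∫ z, score S (θ N) z a * score S (θ N) z b
      ∂(F (θ N) : Measure (Subject n q))) atTop
      (𝓝 (secondMoment S (F β₀ : Measure (Subject n q)) β₀ a b)) := by
  have h1 := continuousAt_integral_of_unifIntegrableNear hF
    (measurable_biSup_enorm_score (n := n) hS B) hUI (continuous_score_mul (n := n) hS a b)
    (τ₀ := β₀) (Filter.Eventually.mono (mem_interior_iff_mem_nhds.1 hβ₀)
      fun β hβ z => enorm_score_mul_le hβ z a b)
  have h2 := h1.comp (hθ.prodMk_nhds hθ)
  exact h2

/-- The rescaled score at the local alternatives is stochastically bounded. -/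
lemma exists_eventually_measure_norm_gt_le (hS : S.Regular) (hβ₀ : β₀ ∈ interior B)
    (hF : ContinuousAt F β₀)
    (hUI : UnifIntegrableNear F β₀ fun z => ⨆ β ∈ B, ‖score S β z‖ₑ ^ 2)
    {θ : ℕ → Fin q → ℝ} (hθ : Tendsto θ atTop (𝓝 β₀))
    (hmodel : ∀ θ ∈ B, MeanModel S (F θ : Measure (Subject n q)) θ) {δ : ℝ} (hδ : 0 < δ) :
    ∃ R : ℝ, ∀ᶠ N in atTop, sampleLaw (F (θ N)) N
      {z | R < ‖√(N : ℝ) • gbar S z (θ N)‖} ≤ ENNReal.ofReal δ := by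
  have hBn : B ∈ 𝓝 β₀ := mem_interior_iff_mem_nhds.1 hβ₀
  have hGm := measurable_biSup_enorm_score (n := n) hS B
  obtain ⟨V, hV0, hVlim⟩ : ∃ V : Fin s × Fin q → ℝ, (∀ a, 0 ≤ V a) ∧ ∀ᶠ N in atTop, ∀ a,
      ∫ z, score S (θ N) z a ^ 2 ∂(F (θ N) : Measure (Subject n q)) < V a := by
    refine ⟨fun a => secondMoment S (F β₀ : Measure (Subject n q)) β₀ a a + 1, fun a => ?_,
      eventually_all.2 fun a => ?_⟩
    · have : 0 ≤ secondMoment S (F β₀ : Measure (Subject n q)) β₀ a a :=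
        integral_nonneg fun z => mul_self_nonneg _
      linarith
    · filter_upwards [(tendsto_secondMoment hS hβ₀ hF hUI hθ a a).eventually_lt_const
        (lt_add_one _)] with N hN
      simpa only [sq] using hN
  -- Chebyshev gives the bound `(∑ a, V a) / R ^ 2`, and `∑ a, V a ≤ δ * R ≤ δ * R ^ 2` since `R ≥
  -- 1`.
  set R : ℝ := (∑ a, V a) / δ + 1 with hR
  have hsum0 : 0 ≤ ∑ a, V a := Finset.sum_nonneg fun a _ => hV0 a
  have hR1 : 1 ≤ R := by
    have : 0 ≤ (∑ a, V a) / δ := by positivity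
    linarith
  refine ⟨R, ?_⟩
  filter_upwards [hVlim, hθ.eventually hBn, eventually_gt_atTop 0,
    hθ.eventually (hUI.eventually_lintegral_ne_top hGm)] with N hN hNB hN0 hfin
  have hNpos : (0 : ℝ) < N := by exact_mod_cast hN0
  have hsq : 0 < √(N : ℝ) := Real.sqrt_pos.2 hNpos
  have hmem : ∀ a, MemLp (fun z => score S (θ N) z a) 2 (F (θ N) : Measure (Subject n q)) :=
    fun a => memLp_score_apply hS hNB hfin a
  have hmean : ∀ a, ∫ z, score S (θ N) z a ∂(F (θ N) : Measure (Subject n q)) = 0 := fun a =>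
    integral_score_eq_zero hS (hmodel _ hNB) a ((hmem a).integrable one_le_two)
  have hsub : {z : Fin N → Subject n q | R < ‖√(N : ℝ) • gbar S z (θ N)‖} ⊆
      ⋃ a, {z | √(N : ℝ) * R ≤ |∑ i, score S (θ N) (z i) a -
        N * ∫ z, score S (θ N) z a ∂(F (θ N) : Measure (Subject n q))|} := by
    intro z hz
    by_contra hcon
    simp only [Set.mem_iUnion, Set.mem_ofPred_eq, not_exists, not_le, hmean, mul_zero,
      sub_zero] at hcon
    refine absurd hz (not_lt.2 ((pi_norm_le_iff_of_nonneg (by linarith)).2 fun a => ?_))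
    rw [Pi.smul_apply, smul_eq_mul, gbar_apply, ← mul_assoc, norm_mul, Real.norm_eq_abs,
      Real.norm_eq_abs]
    have hc : √(N : ℝ) * (N : ℝ)⁻¹ = (√(N : ℝ))⁻¹ := by
      rw [← div_eq_mul_inv, Real.sqrt_div_self]
    rw [hc, abs_of_pos (inv_pos.2 hsq), inv_mul_le_iff₀ hsq]
    exact (hcon a).le
  refine (measure_le_of_subset_iUnion _ hsub).trans ?_
  calc _ ≤ ∑ a, ENNReal.ofReal (V a / R ^ 2) := by
        refine Finset.sum_le_sum fun a _ => ?_
        refine (measure_sum_sample_ge_le (F (θ N)) N (hmem a) (by positivity)).trans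
          (ENNReal.ofReal_le_ofReal ?_)
        rw [mul_pow, Real.sq_sqrt hNpos.le, mul_div_mul_left _ _ hNpos.ne']
        gcongr
        exact (hN a).le
    _ = ENNReal.ofReal ((∑ a, V a) / R ^ 2) := by
        rw [← ENNReal.ofReal_sum_of_nonneg fun a _ => div_nonneg (hV0 a) (sq_nonneg R),
          Finset.sum_div]
    _ ≤ ENNReal.ofReal δ := by
        refine ENNReal.ofReal_le_ofReal ?_
        rw [div_le_iff₀ (by positivity)]
        have h1 : ∑ a, V a ≤ δ * R := by
          rw [hR, mul_add, mul_div_cancel₀ _ hδ.ne']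
          linarith
        nlinarith

end Events

lemma tendsto_localAlt {q : ℕ} (β₀ v : Fin q → ℝ) : Tendsto (localAlt β₀ v) atTop (𝓝 β₀) := by
  have := (tendsto_inv_sqrt_natCast.smul_const v).const_add β₀
  rw [zero_smul, add_zero] at this
  exact this

lemma exists_enorm_mulVec_sq_le {ι κ : Type*} [Fintype ι] [Fintype κ] (A : Matrix κ ι ℝ) :
    ∃ c : ℝ≥0, c ≠ 0 ∧ ∀ x : ι → ℝ, ‖A *ᵥ x‖ₑ ^ 2 ≤ c * ‖x‖ₑ ^ 2 := by
  classical
  set T := LinearMap.toContinuousLinearMap (Matrix.mulVecLin A) with hT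
  refine ⟨‖T‖₊ ^ 2 + 1, by positivity, fun x => ?_⟩
  have h : ‖A *ᵥ x‖₊ ≤ ‖T‖₊ * ‖x‖₊ := T.le_opNNNorm x
  simp only [enorm_eq_nnnorm]
  norm_cast
  calc ‖A *ᵥ x‖₊ ^ 2 ≤ (‖T‖₊ * ‖x‖₊) ^ 2 := by gcongr
    _ = ‖T‖₊ ^ 2 * ‖x‖₊ ^ 2 := mul_pow _ _ _
    _ ≤ (‖T‖₊ ^ 2 + 1) * ‖x‖₊ ^ 2 := by gcongr; exact le_self_add

/-! ### Limit law of the quadratic approximation, and the approximation in probability -/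

section Limit

variable {n q s p : ℕ} {S : Spec n s} {B : Set (Fin q → ℝ)} {β₀ : Fin q → ℝ}
  {F : (Fin q → ℝ) → ProbabilityMeasure (Subject n q)}

lemma inv_sqrt_smul_sum_mulVec_score {N : ℕ} (A : Matrix (Fin p) (Fin s × Fin q) ℝ)
    (z : Fin N → Subject n q) (β : Fin q → ℝ) :
    (√(N : ℝ))⁻¹ • ∑ i, A *ᵥ score S β (z i) = A *ᵥ (√(N : ℝ) • gbar S z β) := by
  rw [gbar, smul_smul, ← div_eq_mul_inv, Real.sqrt_div_self, Matrix.mulVec_smul,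
    Matrix.mulVec_sum]

/-- Asymptotic normality of a standardized linear image of the averaged score. -/
theorem tendstoInDistribution_mulVec_gbar (hS : S.Regular) (hβ₀ : β₀ ∈ interior B)
    (hF : ContinuousAt F β₀)
    (hUI : UnifIntegrableNear F β₀ fun z => ⨆ β ∈ B, ‖score S β z‖ₑ ^ 2)
    {θ : ℕ → Fin q → ℝ} (hθ : Tendsto θ atTop (𝓝 β₀))
    (hmodel : ∀ θ ∈ B, MeanModel S (F θ : Measure (Subject n q)) θ)
    {A : Matrix (Fin p) (Fin s × Fin q) ℝ}
    (hA : A * secondMoment S (F β₀ : Measure (Subject n q)) β₀ * Aᵀ = 1) :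
    TendstoInDistribution
      (fun N (z : Fin N → Subject n q) => A *ᵥ (√(N : ℝ) • gbar S z (θ N))) atTop id
      (fun N => sampleLaw (F (θ N)) N) (Measure.pi fun _ : Fin p => gaussianReal 0 1) := by
  have hBn : B ∈ 𝓝 β₀ := mem_interior_iff_mem_nhds.1 hβ₀
  have hGm := measurable_biSup_enorm_score (n := n) hS B
  obtain ⟨c, hc0, hc⟩ := exists_enorm_mulVec_sq_le A
  simp only [← inv_sqrt_smul_sum_mulVec_score]
  have hfc : Continuous (Function.uncurry fun (β : Fin q → ℝ) (z : Subject n q) =>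
      A *ᵥ score S β z) := by
    have := (continuous_const (y := A)).matrix_mulVec (continuous_score (n := n) (q := q) hS)
    exact this
  refine tendstoInDistribution_triangular hF hGm hUI hfc (τ₀ := β₀) hc0 ?_ hθ hθ ?_ fun i j => ?_
  · filter_upwards [hBn] with β hβ z
    refine (hc _).trans ?_
    gcongr
    exact (enorm_score_sq_le hβ z).trans le_add_self
  · filter_upwards [hθ.eventually hBn, hθ.eventually (hUI.eventually_lintegral_ne_top hGm)]
      with N hNB hfin i
    have hInt := fun a => (memLp_score_apply (n := n) hS hNB hfin a).integrable one_le_two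
    simp only [Matrix.mulVec, dotProduct]
    rw [integral_finsetSum _ fun a _ => (hInt a).const_mul _]
    refine Finset.sum_eq_zero fun a _ => ?_
    rw [integral_const_mul, integral_score_eq_zero hS (hmodel _ hNB) a (hInt a), mul_zero]
  · have hfin := (hUI.eventually_lintegral_ne_top hGm).self_of_nhds
    have hmem := fun a => memLp_score_apply (n := n) hS (interior_subset hβ₀) hfin a
    have hInt : ∀ a b, Integrable (fun z => score S β₀ z a * score S β₀ z b)
        (F β₀ : Measure (Subject n q)) := fun a b => (hmem a).integrable_mul (hmem b)
    have hentry := congrFun (congrFun hA i) j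
    rw [Matrix.one_apply] at hentry
    rw [← hentry]
    have hexp : ∀ z : Subject n q, (A *ᵥ score S β₀ z) i * (A *ᵥ score S β₀ z) j =
        ∑ b, ∑ a, A i a * A j b * (score S β₀ z a * score S β₀ z b) := fun z => by
      simp only [Matrix.mulVec, dotProduct]
      rw [Finset.sum_mul_sum, Finset.sum_comm]
      refine Finset.sum_congr rfl fun b _ => Finset.sum_congr rfl fun a _ => by ring
    simp only [hexp]
    rw [integral_finsetSum _ fun b _ => integrable_finsetSum _ fun a _ => (hInt a b).const_mul _]
    simp only [Matrix.mul_apply, Matrix.transpose_apply, Finset.sum_mul]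
    refine Finset.sum_congr rfl fun b _ => ?_
    rw [integral_finsetSum _ fun a _ => (hInt a b).const_mul _]
    refine Finset.sum_congr rfl fun a _ => ?_
    rw [integral_const_mul, secondMoment, Matrix.of_apply]
    ring

/-- The quadratic approximation of the test statistic has a noncentral chi-squared limit. -/
theorem tendstoInDistribution_sum_sq (hS : S.Regular) (hβ₀ : β₀ ∈ interior B)
    (hF : ContinuousAt F β₀)
    (hUI : UnifIntegrableNear F β₀ fun z => ⨆ β ∈ B, ‖score S β z‖ₑ ^ 2)
    {θ : ℕ → Fin q → ℝ} (hθ : Tendsto θ atTop (𝓝 β₀))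
    (hmodel : ∀ θ ∈ B, MeanModel S (F θ : Measure (Subject n q)) θ)
    {A : Matrix (Fin p) (Fin s × Fin q) ℝ}
    (hA : A * secondMoment S (F β₀ : Measure (Subject n q)) β₀ * Aᵀ = 1) (δsq : ℝ) :
    TendstoInDistribution
      (fun N (z : Fin N → Subject n q) => ∑ i : Fin p,
        ((A *ᵥ (√(N : ℝ) • gbar S z (θ N))) i + if (i : ℕ) = 0 then √δsq else 0) ^ 2) atTop id
      (fun N => sampleLaw (F (θ N)) N) (noncentralChiSquared p δsq) := by
  have hg : Continuous fun x : Fin p → ℝ =>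
      ∑ i : Fin p, (x i + if (i : ℕ) = 0 then √δsq else 0) ^ 2 := by fun_prop
  have h := (tendstoInDistribution_mulVec_gbar hS hβ₀ hF hUI hθ hmodel hA).continuous_comp hg
  refine ⟨h.forall_aemeasurable, aemeasurable_id, ?_⟩
  have hlim : (⟨(noncentralChiSquared p δsq).map id,
      Measure.isProbabilityMeasure_map aemeasurable_id⟩ : ProbabilityMeasure ℝ) =
      ⟨_, Measure.isProbabilityMeasure_map h.aemeasurable_limit⟩ :=
    Subtype.ext (Measure.map_id.trans (map_sum_sq_pi_gaussianReal p δsq).symm)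
  rw [hlim]
  exact h.tendsto

lemma aemeasurable_Q (hS : S.Regular) {N : ℕ} {μ : Measure (Fin N → Subject n q)}
    {β : (Fin N → Subject n q) → Fin q → ℝ} (hβ : AEMeasurable β μ) :
    AEMeasurable (fun z => Q S z (β z)) μ := by
  have := (measurable_Q (N := N) (n := n) (q := q) hS).comp_aemeasurable
    (aemeasurable_id.prodMk hβ)
  exact this

lemma integral_score_eq_zero_iff (hS : S.Regular) {P : Measure (Subject n q)} [IsFiniteMeasure P]
    {β : Fin q → ℝ} (hβ : β ∈ B) (hfin : ∫⁻ z, ⨆ β ∈ B, ‖score S β z‖ₑ ^ 2 ∂P ≠ ∞) :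
    (fun a => ∫ z, score S β z a ∂P) = 0 ↔ ∫ z, score S β z ∂P = 0 := by
  have hInt := fun a => (memLp_score_apply (n := n) hS hβ hfin a).integrable one_le_two
  have : ∫ z, score S β z ∂P = fun a => ∫ z, score S β z a ∂P :=
    funext fun a => eval_integral hInt a
  rw [this]

/-- The test statistic differs from its quadratic approximation by a term that converges to zero
in probability. -/
theorem tendsto_measure_approx (hS : S.Regular) (hB : IsCompact B) (hβ₀ : β₀ ∈ interior B)
    (hF : ContinuousAt F β₀)
    (hUI : UnifIntegrableNear F β₀ fun z => ⨆ β ∈ B, ‖score S β z‖ₑ ^ 2)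
    (hUI' : UnifIntegrableNear F β₀ fun z => ⨆ β ∈ B, ‖fderiv ℝ (fun b => score S b z) β‖ₑ)
    (hmodel : ∀ θ ∈ B, MeanModel S (F θ : Measure (Subject n q)) θ)
    {v : Fin q → ℝ} {s₁ s₂ : Set (Fin q → ℝ)} {W : (N : ℕ) → (Fin N → Subject n q) → ℝ}
    {β₁ β₂ : (N : ℕ) → (Fin N → Subject n q) → Fin q → ℝ}
    (happrox : ∀ ε > 0, ∀ R : ℝ, ∃ η > 0, ∃ N₀ : ℕ, ∀ N ≥ N₀, ∀ z : Fin N → Subject n q,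
      UniformlyClose S B (F β₀ : Measure (Subject n q)) η z →
      ‖√(N : ℝ) • gbar S z (localAlt β₀ v N)‖ ≤ R → ∀ b₁ ∈ argmin (Q S z) s₁,
      ∀ b₂ ∈ argmin (Q S z) s₂, |Q S z b₂ - Q S z b₁ - W N z| ≤ ε)
    (h₁ : ∀ N, ∀ᵐ z ∂(sampleLaw (F (localAlt β₀ v N)) N), β₁ N z ∈ argmin (Q S z) s₁)
    (h₂ : ∀ N, ∀ᵐ z ∂(sampleLaw (F (localAlt β₀ v N)) N), β₂ N z ∈ argmin (Q S z) s₂)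
    {ε : ℝ} (hε : 0 < ε) :
    Tendsto (fun N => sampleLaw (F (localAlt β₀ v N)) N
      {z | ε < |Q S z (β₂ N z) - Q S z (β₁ N z) - W N z|}) atTop (𝓝 0) := by
  refine ENNReal.tendsto_nhds_zero.2 fun δ hδ => ?_
  obtain ⟨d, hd0, hd⟩ : ∃ d : ℝ, 0 < d ∧ ENNReal.ofReal d + ENNReal.ofReal d ≤ δ := by
    rcases eq_or_ne δ ∞ with rfl | hδt
    · exact ⟨1, one_pos, le_top⟩
    · have hpos := ENNReal.toReal_pos hδ.ne' hδt
      refine ⟨δ.toReal / 2, by positivity, ?_⟩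
      rw [← ENNReal.ofReal_add (by positivity) (by positivity), add_halves,
        ENNReal.ofReal_toReal hδt]
  have hθ := tendsto_localAlt β₀ v
  -- The order of choices matters: `R` comes from tightness alone, `η` and `N₀` depend on `R`, and
  -- the law of large numbers is then applied with this `η`.
  obtain ⟨R, hR⟩ := exists_eventually_measure_norm_gt_le hS hβ₀ hF hUI hθ hmodel hd0
  obtain ⟨η, hη, N₀, hN₀⟩ := happrox ε hε R
  have hclose := ENNReal.tendsto_nhds_zero.1
    (tendsto_measure_not_uniformlyClose hS hB hF hUI hUI' hθ hη) (ENNReal.ofReal d)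
    (ENNReal.ofReal_pos.2 hd0)
  filter_upwards [hR, hclose, eventually_ge_atTop N₀] with N hNR hNc hN
  refine le_trans (measure_mono_ae ?_) ((measure_union_le _ _).trans ((add_le_add hNR hNc).trans hd))
  filter_upwards [h₁ N, h₂ N] with z hz₁ hz₂ hz
  by_contra hcon
  have hcon' : ¬ (R < ‖√(N : ℝ) • gbar S z (localAlt β₀ v N)‖ ∨
    ¬ UniformlyClose S B (F β₀ : Measure (Subject n q)) η z) := hcon
  rw [not_or, not_lt, not_not] at hcon'
  exact absurd (hN₀ N hN z hcon'.2 hcon'.1 _ hz₁ _ hz₂) (not_le.2 hz)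

end Limit

end QIF

end

theorem theorem4p3 {n q s p : ℕ} (hpq : p < q)
    -- inverse link, variance function, dispersion, basis matrices
    (S : QIF.Spec n s) (hh : ContDiff ℝ 2 S.h) (hv : ContDiff ℝ 1 S.v)
    (hvpos : ∀ u, 0 < S.v u) (hφ : 0 < S.φ)
    -- compact parameter space; `F θ` is the law of one subject when `θ` is the true parameter
    (B : Set (Fin q → ℝ)) (hB : IsCompact B)
    (F : (Fin q → ℝ) → ProbabilityMeasure (QIF.Subject n q))
    (hmodel : ∀ θ ∈ B, QIF.MeanModel S (F θ) θ)
    (β₀ : Fin q → ℝ) (hβ₀ : β₀ ∈ interior B)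
    -- regularity of the model near `β₀`, and finite moments, uniformly in the parameters
    (hcont : ContinuousAt F β₀)
    (hUI : QIF.UnifIntegrableNear F β₀ fun z => ⨆ β ∈ B, ‖QIF.score S β z‖ₑ ^ 2)
    (hUI' : QIF.UnifIntegrableNear F β₀ fun z =>
      ⨆ β ∈ B, ‖fderiv ℝ (fun b => QIF.score S b z) β‖ₑ)
    -- identifiability, and nondegeneracy
    (hident : ∀ β ∈ B, ∫ z, QIF.score S β z ∂(F β₀ : Measure (QIF.Subject n q)) = 0 ↔ β = β₀)
    (hSig : ∀ β ∈ B, (QIF.secondMoment S (F β₀ : Measure (QIF.Subject n q)) β).PosDef)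
    (hJ : IsUnit (QIF.infoMatrix S (F β₀ : Measure (QIF.Subject n q)) β₀))
    -- the linear hypothesis `Lᵀ β = b`, which holds at `β₀`, and the direction `v`
    (L : Matrix (Fin q) (Fin p) ℝ) (hL : LinearIndependent ℝ L.col)
    (b : Fin p → ℝ) (hb : Lᵀ *ᵥ β₀ = b) (v : Fin q → ℝ)
    -- the unrestricted and the constrained minimizers
    (βhat βtil : (N : ℕ) → (Fin N → QIF.Subject n q) → Fin q → ℝ)
    (hhat_meas : ∀ N, AEMeasurable (βhat N) (QIF.sampleLaw (F (QIF.localAlt β₀ v N)) N))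
    (htil_meas : ∀ N, AEMeasurable (βtil N) (QIF.sampleLaw (F (QIF.localAlt β₀ v N)) N))
    (hhat : ∀ N, ∀ᵐ z ∂(QIF.sampleLaw (F (QIF.localAlt β₀ v N)) N),
      βhat N z ∈ QIF.argmin (QIF.Q S z) B)
    (htil : ∀ N, ∀ᵐ z ∂(QIF.sampleLaw (F (QIF.localAlt β₀ v N)) N),
      βtil N z ∈ QIF.argmin (QIF.Q S z) {β | β ∈ B ∧ Lᵀ *ᵥ β = b}) :
    TendstoInDistribution
      (fun N (z : Fin N → QIF.Subject n q) => QIF.Q S z (βtil N z) - QIF.Q S z (βhat N z))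
      atTop id
      (fun N => QIF.sampleLaw (F (QIF.localAlt β₀ v N)) N)
      (QIF.noncentralChiSquared p
        (v ⬝ᵥ ((L * (Lᵀ * (QIF.infoMatrix S (F β₀ : Measure (QIF.Subject n q)) β₀)⁻¹ * L)⁻¹ * Lᵀ)
          *ᵥ v))) := by
  have hS : S.Regular := ⟨hh, hv, hvpos, hφ⟩
  have hβB : β₀ ∈ B := interior_subset hβ₀
  have hGm := QIF.measurable_biSup_enorm_score (n := n) hS B
  have hfin := (hUI.eventually_lintegral_ne_top hGm).self_of_nhds
  obtain ⟨A, hAS, hA⟩ := QIF.exists_standardization (hSig β₀ hβB)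
    (QIF.expJacobian S (F β₀ : Measure (QIF.Subject n q)) β₀) hJ L hL v
  have hinj : ∀ u, QIF.expJacobian S (F β₀ : Measure (QIF.Subject n q)) β₀ *ᵥ u = 0 → u = 0 :=
    fun u hu => QIF.mulVec_injective_of_isUnit_info hJ (hu.trans (Matrix.mulVec_zero _).symm)
  refine QIF.tendstoInDistribution_of_sub_tendsto_zero
    (QIF.tendstoInDistribution_sum_sq hS hβ₀ hcont hUI (QIF.tendsto_localAlt β₀ v) hmodel hAS _)
    (fun N => (QIF.aemeasurable_Q hS (htil_meas N)).sub (QIF.aemeasurable_Q hS (hhat_meas N)))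
    fun ε hε => QIF.tendsto_measure_approx hS hB hβ₀ hcont hUI hUI' hmodel
      (fun ε hε R => QIF.exists_uniformlyClose_imp_approx hS hB hβ₀ (fun a => ?_) (fun a b => ?_)
        (fun a k => ?_) (fun β hβ => ?_) hSig hinj hb v hA hε R) hhat htil hε
  · exact QIF.continuousOn_integral_of_envelope hcont
      (measurable_const.mul (measurable_const.add hGm)) (hUI.const_mul_one_add hGm one_ne_zero)
      (QIF.continuous_score_apply hS a) fun β hβ z => QIF.enorm_score_apply_le hβ z a
  · exact QIF.continuousOn_integral_of_envelope hcont hGm hUI (QIF.continuous_score_mul hS a b)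
      fun β hβ z => QIF.enorm_score_mul_le hβ z a b
  · exact QIF.continuousOn_integral_of_envelope hcont
      (QIF.measurable_biSup_enorm_fderiv_score hS B) hUI'
      (f := fun β z => QIF.jacobian (fun b => QIF.score S b z) β a k)
      (QIF.continuous_jacobian_score hS a k) fun β hβ z => QIF.enorm_jacobian_score_le hβ z a k
  -- Identifiability is stated for the vector-valued integral and is used coordinatewise; the two
  -- agree because each coordinate is integrable.
  · rw [QIF.integral_score_eq_zero_iff hS hβ hfin, hident β hβ]
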